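/- Let $k$ be a field and $A$ a finite-dimensional Frobenius $k$-algebra (i.e. $A$ carries a non-degenerate bilinear form with $\langle ab,c\rangle=\langle a,bc\rangle$), and let $A^{\mathrm e}=A\otimes_k A^{\mathrm{op}}$. An $A$-bimodule is a left $A^{\mathrm e}$-module via $(a\otimes b^{\circ})m=amb$; it is also regarded as a right $A^{\mathrm e}$-module via $x(a\otimes b^{\circ})=bxa$. *Conventions.* Complexes have differentials $d_i\colon C_i\to C_{i-1}$. $\mathrm{Hom}_{A^{\mathrm e}}(C,C')^s=\prod_i\mathrm{Hom}_{A^{\mathrm e}}(C_i,C'_{i-s})$, with differential $f\mapsto d f-(-1)^s f d$; a bimodule is a complex concentrated in degree $0$. $(C\,\widehat\otimes_A C')_n=\prod_{p+q=n}C_p\otimes_A C'_q$, with differential $d\otimes 1+(-1)^p\,1\otimes d$ on $C_p\otimes_A C'_q$; $C\,\widehat\otimes_{A^{\mathrm e}}C'$ is defined in the same way. Let $T$ be a complete resolution of $A$ over $A^{\mathrm e}$: a complex $(T_i)_{i\in\mathbb Z}$ of finitely generated projective $A^{\mathrm e}$-modules such that $T$ and $\mathrm{Hom}_{A^{\mathrm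 e}}(T,A^{\mathrm e})$ are exact, with a surjection $\varepsilon\colon T_0\to A$ whose kernel is $d_1(T_1)$. For bimodules $M,N$ put $\widehat H^n(A,M)=H^n(\mathrm{Hom}_{A^{\mathrm e}}(T,M))$ and $\widehat H_n(A,N)=H_n(T\otimes_{A^{\mathrm e}}N)$. Let $\widehat\Delta\colon T\to T\,\widehat\otimes_A T$ be a diagonal approximation: a chain map of complexes of bimodules with $(\varepsilon\,\widehat\otimes_A\varepsilon)\widehat\Delta=\varepsilon$ (under $A\otimes_A A=A$); write $\widehat\Delta_{p,q}\colon T_{p+q}\to T_p\otimes_A T_q$ for its components. *Cup and cap product.* The cup product $\smile\colon\widehat H^r(A,M)\otimes\widehat H^s(A,N)\to\widehat H^{r+s}(A,M\otimes_A N)$ is induced by $u\otimes v\mapsto(u\,\widehat\otimes_A v)\widehat\Delta=(-1)^{rs}(u\otimes v)\widehat\Delta_{r,s}$. The cap product $\frown\colon\widehat H^r(A,M)\otimes\widehat H_s(A,N)\to\widehat H_{s-r}(A,M\otimes_A N)$ is induced by applying $\widehat\Delta\otimes 1$ to $T\otimes_{A^{\mathrm e}}N$ and then $u\otimes((x\otimes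 y)\otimes n)\mapsto(-1)^{r|x|}x\otimes(u(y)\otimes n)$, where $u$ vanishes outside $T_r$. *Composition products.* The map $\varepsilon\otimes_A 1\colon T\otimes_A N\to A\otimes_A N=N$ induces linear maps $$\alpha_s\colon H^s(\mathrm{Hom}_{A^{\mathrm e}}(T,T\otimes_A N))\to\widehat H^s(A,N),\qquad \beta_s\colon H_s(T\,\widehat\otimes_{A^{\mathrm e}}(T\otimes_A N))\to\widehat H_s(A,N).$$ For $u\in\mathrm{Hom}_{A^{\mathrm e}}(T_r,M)$, the assignments $u\otimes w\mapsto(u\otimes_A 1_N)\circ w$ and $u\otimes(x\otimes(x'\otimes n))\mapsto(-1)^{r|x|}x\otimes(u(x')\otimes n)$ induce pairings $$\circ\colon\widehat H^r(A,M)\otimes H^s(\mathrm{Hom}_{A^{\mathrm e}}(T,T\otimes_A N))\to\widehat H^{r+s}(A,M\otimes_A N),$$ $$\bullet\colon\widehat H^r(A,M)\otimes H_s(T\,\widehat\otimes_{A^{\mathrm e}}(T\otimes_A N))\to\widehat H_{s-r}(A,M\otimes_A N).$$ **Theorem.** For all $A$, $T$, $\widehat\Delta$ as above, all $A$-bimodules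 $M,N$ (not necessarily finitely generated) and all $r,s\in\mathbb Z$: 1. $\alpha_s$ is an isomorphism, and $u\smile v=u\circ\alpha_s^{-1}(v)$ for all $u\in\widehat H^r(A,M)$ and $v\in\widehat H^s(A,N)$. 2. $\beta_s$ is an isomorphism, and $u\frown z=u\bullet\beta_s^{-1}(z)$ for all $u\in\widehat H^r(A,M)$ and $z\in\widehat H_s(A,N)$. That is, the composition products on Tate-Hochschild cohomology and homology agree with the cup product and the cap product. -/

import Mathlib

open scoped TensorProduct

set_option linter.unusedSectionVars false
set_option linter.unusedSimpArgs false

noncomputable section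

namespace TateHochschild

universe w w'

/-! ### Frobenius algebras, bimodules -/

/-- `A` carries a non-degenerate associative bilinear form `⟨a b, c⟩ = ⟨a, b c⟩`.
(Finite dimensionality is a separate hypothesis.) -/
def IsFrobenius (k A : Type*) [Field k] [Ring A] [Algebra k A] : Prop :=
  ∃ B : A →ₗ[k] A →ₗ[k] k, B.Nondegenerate ∧ ∀ a b c : A, B (a * b) c = B a (b * c)

/-- The enveloping algebra `A ⊗ Aᵒᵖ`. An `A`-bimodule (with `k` acting centrally) is a left module
`M` over it: `a m b` is `(a ⊗ₜ op b) • m`. -/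
def Env (k A : Type*) [Field k] [Ring A] [Algebra k A] : Type _ := A ⊗[k] Aᵐᵒᵖ

instance (k A : Type*) [Field k] [Ring A] [Algebra k A] : Ring (Env k A) :=
  inferInstanceAs (Ring (A ⊗[k] Aᵐᵒᵖ))

instance (k A : Type*) [Field k] [Ring A] [Algebra k A] : Algebra k (Env k A) :=
  inferInstanceAs (Algebra k (A ⊗[k] Aᵐᵒᵖ))

instance (k A : Type*) [Field k] [Ring A] [Algebra k A] : Semiring (Env k A) := Ring.toSemiring

instance (k A : Type*) [Field k] [Ring A] [Algebra k A] : SMul k (Env k A) := Algebra.toSMul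

section Bimodule

variable {k A : Type*} [Field k] [Ring A] [Algebra k A]

/-- The element `a ⊗ b°` of the enveloping algebra; `env k a b • m` is `a m b`. -/
def env (k : Type*) {A : Type*} [Field k] [Ring A] [Algebra k A] (a b : A) : Env k A :=
  (a ⊗ₜ[k] MulOpposite.op b : A ⊗[k] Aᵐᵒᵖ)

theorem env_mul (a b c d : A) : env k a b * env k c d = env k (a * c) (d * b) :=
  Algebra.TensorProduct.tmul_mul_tmul a c (MulOpposite.op b) (MulOpposite.op d)

theorem env_one : env k (1 : A) 1 = 1 := rfl

theorem env_add_left (a a' b : A) : env k (a + a') b = env k a b + env k a' b :=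
  TensorProduct.add_tmul _ _ _

theorem env_add_right (a b b' : A) : env k a (b + b') = env k a b + env k a b' :=
  TensorProduct.tmul_add _ _ _

theorem env_smul_left (c : k) (a b : A) : env k (c • a) b = c • env k a b := rfl

theorem env_smul_right (c : k) (a b : A) : env k a (c • b) = c • env k a b :=
  TensorProduct.tmul_smul c a (MulOpposite.op b)

theorem env_induction {P : Env k A → Prop} (zero : P 0) (tmul : ∀ a b, P (env k a b))
    (add : ∀ e f, P e → P f → P (e + f)) (e : Env k A) : P e :=
  TensorProduct.induction_on (motive := P) e zero (fun a b => tmul a b.unop) add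

/-- The regular bimodule `A`. -/
instance regularBimodule : Module (Env k A) A :=
  (TensorProduct.Algebra.module : Module (A ⊗[k] Aᵐᵒᵖ) A)

theorem env_smul_self (a b x : A) : env k a b • x = a * x * b := by
  change a • (MulOpposite.op b • x) = _
  simp [mul_assoc]

instance : IsScalarTower k (Env k A) A where
  smul_assoc c e x := by
    induction e using env_induction with
    | zero => rw [smul_zero, zero_smul, smul_zero]
    | tmul a b =>
      rw [← env_smul_left, env_smul_self, env_smul_self, smul_mul_assoc, smul_mul_assoc]
    | add e f he hf => rw [smul_add, add_smul, add_smul, smul_add, he, hf]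

variable {X Y : Type*}
  [AddCommGroup X] [Module k X] [Module (Env k A) X] [IsScalarTower k (Env k A) X]
  [AddCommGroup Y] [Module k Y] [Module (Env k A) Y] [IsScalarTower k (Env k A) Y]

instance bimodule_smulCommClass : SMulCommClass (Env k A) k X :=
  IsScalarTower.to_smulCommClass'

instance bimodule_smulCommClass' : SMulCommClass k (Env k A) X :=
  IsScalarTower.to_smulCommClass

/-- A `k`-linear map commuting with both actions of `A` is a bimodule map. -/
def bimoduleHom (f : X →ₗ[k] Y) (h : ∀ a b x, f (env k a b • x) = env k (A := A) a b • f x) :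
    X →ₗ[Env k A] Y where
  toFun := f
  map_add' := map_add f
  map_smul' e x := by
    induction e using env_induction with
    | zero => rw [zero_smul, map_zero, map_zero, zero_smul]
    | tmul a b => exact h a b x
    | add e e' he he' => simp only [add_smul, map_add, he, he', RingHom.id_apply]

@[simp] theorem bimoduleHom_apply (f : X →ₗ[k] Y)
    (h : ∀ a b x, f (env k a b • x) = env k (A := A) a b • f x) (x : X) :
    bimoduleHom f h x = f x := rfl

end Bimodule

/-! ### The tensor product `M ⊗_A N` of bimodules -/

section BTensor

variable (k A : Type*) [Field k] [Ring A] [Algebra k A]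
variable (M N : Type*)
  [AddCommGroup M] [Module k M] [Module (Env k A) M] [IsScalarTower k (Env k A) M]
  [AddCommGroup N] [Module k N] [Module (Env k A) N] [IsScalarTower k (Env k A) N]

/-- The relations `m a ⊗ n = m ⊗ a n`. -/
def bRel : Submodule k (M ⊗[k] N) :=
  Submodule.span k {z | ∃ (m : M) (a : A) (n : N),
    z = (env k 1 a • m) ⊗ₜ[k] n - m ⊗ₜ[k] (env k a 1 • n)}

/-- The tensor product `M ⊗_A N` of two `A`-bimodules. -/
def BTensor : Type _ := (M ⊗[k] N) ⧸ bRel k A M N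

instance : AddCommGroup (BTensor k A M N) := Submodule.Quotient.addCommGroup (bRel k A M N)
instance : Module k (BTensor k A M N) := Submodule.Quotient.module (bRel k A M N)

/-- The projection `M ⊗_k N → M ⊗_A N`. -/
def BTensor.mkQ : M ⊗[k] N →ₗ[k] BTensor k A M N := (bRel k A M N).mkQ

variable {M N}

/-- The element `m ⊗_A n`. -/
def BTensor.mk (m : M) (n : N) : BTensor k A M N := BTensor.mkQ k A M N (m ⊗ₜ[k] n)

variable {k A}

theorem BTensor.add_mk (m m' : M) (n : N) :
    BTensor.mk k A (m + m') n = BTensor.mk k A m n + BTensor.mk k A m' n := by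
  simp only [BTensor.mk, TensorProduct.add_tmul, map_add]

theorem BTensor.mk_add (m : M) (n n' : N) :
    BTensor.mk k A m (n + n') = BTensor.mk k A m n + BTensor.mk k A m n' := by
  simp only [BTensor.mk, TensorProduct.tmul_add, map_add]

theorem BTensor.smul_mk (c : k) (m : M) (n : N) :
    BTensor.mk k A (c • m) n = c • BTensor.mk k A m n := by
  simp only [BTensor.mk, ← TensorProduct.smul_tmul', map_smul]

theorem BTensor.mk_smul (c : k) (m : M) (n : N) :
    BTensor.mk k A m (c • n) = c • BTensor.mk k A m n := by
  simp only [BTensor.mk, TensorProduct.tmul_smul, map_smul]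

theorem BTensor.mk_balanced (m : M) (a : A) (n : N) :
    BTensor.mk k A (env k 1 a • m) n = BTensor.mk k A m (env k a 1 • n) := by
  rw [← sub_eq_zero, BTensor.mk, BTensor.mk, ← map_sub]
  exact (Submodule.Quotient.mk_eq_zero _).2 (Submodule.subset_span ⟨m, a, n, rfl⟩)

theorem BTensor.hom_ext {P : Type*} [AddCommGroup P] [Module k P]
    {f g : BTensor k A M N →ₗ[k] P}
    (h : ∀ m n, f (BTensor.mk k A m n) = g (BTensor.mk k A m n)) : f = g :=
  Submodule.linearMap_qext _ (TensorProduct.ext' h)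

/-- A `k`-bilinear `A`-balanced map induces a map on `M ⊗_A N`. -/
def BTensor.lift {P : Type*} [AddCommGroup P] [Module k P] (f : M →ₗ[k] N →ₗ[k] P)
    (h : ∀ m (a : A) n, f (env k 1 a • m) n = f m (env k a 1 • n)) : BTensor k A M N →ₗ[k] P :=
  (bRel k A M N).liftQ (TensorProduct.lift f) (by
    rw [bRel, Submodule.span_le]
    rintro _ ⟨m, a, n, rfl⟩
    simp [h])

@[simp] theorem BTensor.lift_mk {P : Type*} [AddCommGroup P] [Module k P] (f : M →ₗ[k] N →ₗ[k] P)
    (h : ∀ m (a : A) n, f (env k 1 a • m) n = f m (env k a 1 • n)) (m : M) (n : N) :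
    BTensor.lift f h (BTensor.mk k A m n) = f m n :=
  (Submodule.liftQ_apply _ _ _).trans (TensorProduct.lift.tmul _ _)

/-- `m ⊗_A n` as a `k`-bilinear map. -/
def BTensor.mkₗ : M →ₗ[k] N →ₗ[k] BTensor k A M N :=
  LinearMap.mk₂ k (BTensor.mk k A) BTensor.add_mk BTensor.smul_mk BTensor.mk_add BTensor.mk_smul

@[simp] theorem BTensor.mkₗ_apply (m : M) (n : N) :
    BTensor.mkₗ m n = BTensor.mk k A m n := rfl

/-- The left action `a (m ⊗ n) = a m ⊗ n`. -/
def BTensor.leftAct : A →ₐ[k] Module.End k (BTensor k A M N) :=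
  AlgHom.ofLinearMap
    { toFun := fun a => BTensor.lift (BTensor.mkₗ ∘ₗ Algebra.lsmul k k M (env k a 1))
        (fun m b n => by
          simp only [LinearMap.comp_apply, Algebra.lsmul_coe, BTensor.mkₗ_apply,
            ← BTensor.mk_balanced, smul_smul, env_mul, one_mul, mul_one])
      map_add' := fun a b => BTensor.hom_ext fun m n => by
        simp [env_add_left]
      map_smul' := fun c a => BTensor.hom_ext fun m n => by
        simp [env_smul_left] }
    (BTensor.hom_ext fun m n => by simp [env_one])
    (fun a b => BTensor.hom_ext fun m n => by
      simp [smul_smul, env_mul])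

/-- The right action `(m ⊗ n) b = m ⊗ n b`. -/
def BTensor.rightAct : Aᵐᵒᵖ →ₐ[k] Module.End k (BTensor k A M N) :=
  AlgHom.ofLinearMap
    { toFun := fun b => BTensor.lift
        (BTensor.mkₗ.compl₂ (Algebra.lsmul k k N (env k 1 b.unop)))
        (fun m a n => by
          simp only [LinearMap.compl₂_apply, Algebra.lsmul_coe, BTensor.mkₗ_apply,
            BTensor.mk_balanced, smul_smul, env_mul, one_mul, mul_one])
      map_add' := fun a b => BTensor.hom_ext fun m n => by
        simp [env_add_right, BTensor.mk_add]
      map_smul' := fun c a => BTensor.hom_ext fun m n => by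
        simp [env_smul_right] }
    (BTensor.hom_ext fun m n => by simp [env_one])
    (fun a b => BTensor.hom_ext fun m n => by
      simp [smul_smul, env_mul])

/-- The bimodule structure `a (m ⊗ n) b = a m ⊗ n b`. -/
def BTensor.act : Env k A →ₐ[k] Module.End k (BTensor k A M N) :=
  (Algebra.TensorProduct.lift BTensor.leftAct BTensor.rightAct
    (fun a b => BTensor.hom_ext fun m n => by
      simp [BTensor.leftAct, BTensor.rightAct]) :
    A ⊗[k] Aᵐᵒᵖ →ₐ[k] Module.End k (BTensor k A M N))

instance : Module (Env k A) (BTensor k A M N) :=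
  Module.compHom (BTensor k A M N) (BTensor.act (k := k) (A := A) (M := M) (N := N)).toRingHom

instance : IsScalarTower k (Env k A) (BTensor k A M N) where
  smul_assoc c e x := by
    change BTensor.act (c • e) x = c • BTensor.act e x
    simp

theorem BTensor.env_smul_mk (a b : A) (m : M) (n : N) :
    env k a b • BTensor.mk k A m n = BTensor.mk k A (env k a 1 • m) (env k 1 b • n) := by
  have h : BTensor.act (M := M) (N := N) (env k a b) =
      BTensor.leftAct a * BTensor.rightAct (MulOpposite.op b) :=
    Algebra.TensorProduct.lift_tmul _ _ _ _ _
  change BTensor.act (env k a b) (BTensor.mk k A m n) = _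
  rw [h]
  simp [BTensor.leftAct, BTensor.rightAct]

theorem BTensor.bimodule_hom_ext {P : Type*} [AddCommGroup P] [Module k P] [Module (Env k A) P]
    [IsScalarTower k (Env k A) P] {f g : BTensor k A M N →ₗ[Env k A] P}
    (h : ∀ m n, f (BTensor.mk k A m n) = g (BTensor.mk k A m n)) : f = g := by
  have := BTensor.hom_ext (f := f.restrictScalars k) (g := g.restrictScalars k) h
  exact LinearMap.ext fun x => LinearMap.congr_fun this x

theorem BTensor.lift_env_smul {P : Type*} [AddCommGroup P] [Module k P] [Module (Env k A) P]
    [IsScalarTower k (Env k A) P] (f : M →ₗ[k] N →ₗ[k] P)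
    (h : ∀ m (a : A) n, f (env k 1 a • m) n = f m (env k a 1 • n))
    (h' : ∀ (a b : A) m n, f (env k a 1 • m) (env k 1 b • n) = env k a b • f m n)
    (a b : A) (x : BTensor k A M N) :
    BTensor.lift f h (env k a b • x) = env k a b • BTensor.lift f h x := by
  have := BTensor.hom_ext
    (f := BTensor.lift f h ∘ₗ Algebra.lsmul k k (BTensor k A M N) (env k a b))
    (g := Algebra.lsmul k k P (env k a b) ∘ₗ BTensor.lift f h)
    (fun m n => by simp [BTensor.env_smul_mk, h'])
  exact LinearMap.congr_fun this x

/-- A balanced map compatible with the outer actions induces a bimodule map on `M ⊗_A N`. -/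
def BTensor.bimoduleLift {P : Type*} [AddCommGroup P] [Module k P] [Module (Env k A) P]
    [IsScalarTower k (Env k A) P] (f : M →ₗ[k] N →ₗ[k] P)
    (h : ∀ m (a : A) n, f (env k 1 a • m) n = f m (env k a 1 • n))
    (h' : ∀ (a b : A) m n, f (env k a 1 • m) (env k 1 b • n) = env k a b • f m n) :
    BTensor k A M N →ₗ[Env k A] P :=
  bimoduleHom (BTensor.lift f h) (BTensor.lift_env_smul f h h')

@[simp] theorem BTensor.bimoduleLift_mk {P : Type*} [AddCommGroup P] [Module k P]
    [Module (Env k A) P] [IsScalarTower k (Env k A) P] (f : M →ₗ[k] N →ₗ[k] P)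
    (h : ∀ m (a : A) n, f (env k 1 a • m) n = f m (env k a 1 • n))
    (h' : ∀ (a b : A) m n, f (env k a 1 • m) (env k 1 b • n) = env k a b • f m n)
    (m : M) (n : N) : BTensor.bimoduleLift f h h' (BTensor.mk k A m n) = f m n :=
  BTensor.lift_mk f h m n

variable {M' N' : Type*}
  [AddCommGroup M'] [Module k M'] [Module (Env k A) M'] [IsScalarTower k (Env k A) M']
  [AddCommGroup N'] [Module k N'] [Module (Env k A) N'] [IsScalarTower k (Env k A) N']

/-- The map `f ⊗_A g`, without signs. -/
def BTensor.map (f : M →ₗ[Env k A] M') (g : N →ₗ[Env k A] N') :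
    BTensor k A M N →ₗ[Env k A] BTensor k A M' N' :=
  BTensor.bimoduleLift (BTensor.mkₗ.compl₁₂ (f.restrictScalars k) (g.restrictScalars k))
    (fun m a n => by simp [BTensor.mk_balanced])
    (fun a b m n => by simp [BTensor.env_smul_mk])

@[simp] theorem BTensor.map_mk (f : M →ₗ[Env k A] M') (g : N →ₗ[Env k A] N') (m : M) (n : N) :
    BTensor.map f g (BTensor.mk k A m n) = BTensor.mk k A (f m) (g n) := by
  simp [BTensor.map]

/-- The canonical map `A ⊗_A N → N`, `a ⊗ n ↦ a n`. -/
def BTensor.lid : BTensor k A A N →ₗ[Env k A] N :=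
  BTensor.bimoduleLift
    (LinearMap.mk₂ k (fun (a : A) (n : N) => env k a 1 • n)
      (fun a b n => by rw [env_add_left, add_smul])
      (fun c a n => by rw [env_smul_left, smul_assoc])
      (fun a n n' => smul_add _ _ _)
      (fun c a n => smul_comm _ _ _))
    (fun m a n => by simp [env_smul_self, smul_smul, env_mul])
    (fun a b m n => by simp [env_smul_self, smul_smul, env_mul])

@[simp] theorem BTensor.lid_mk (a : A) (n : N) :
    BTensor.lid (BTensor.mk k A a n) = env k a 1 • n := by
  simp [BTensor.lid]

end BTensor

section BTensorMap

variable {k A : Type*} [Field k] [Ring A] [Algebra k A]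
variable {M N M' N' M'' N'' : Type*}
  [AddCommGroup M] [Module k M] [Module (Env k A) M] [IsScalarTower k (Env k A) M]
  [AddCommGroup N] [Module k N] [Module (Env k A) N] [IsScalarTower k (Env k A) N]
  [AddCommGroup M'] [Module k M'] [Module (Env k A) M'] [IsScalarTower k (Env k A) M']
  [AddCommGroup N'] [Module k N'] [Module (Env k A) N'] [IsScalarTower k (Env k A) N']
  [AddCommGroup M''] [Module k M''] [Module (Env k A) M''] [IsScalarTower k (Env k A) M'']
  [AddCommGroup N''] [Module k N''] [Module (Env k A) N''] [IsScalarTower k (Env k A) N'']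

theorem BTensor.map_map (f : M →ₗ[Env k A] M') (g : N →ₗ[Env k A] N')
    (f' : M' →ₗ[Env k A] M'') (g' : N' →ₗ[Env k A] N'') (x : BTensor k A M N) :
    BTensor.map f' g' (BTensor.map f g x) = BTensor.map (f' ∘ₗ f) (g' ∘ₗ g) x :=
  LinearMap.congr_fun (BTensor.bimodule_hom_ext (f := BTensor.map f' g' ∘ₗ BTensor.map f g)
    (fun m n => by simp)) x

theorem BTensor.map_comp_map (f : M →ₗ[Env k A] M') (g : N →ₗ[Env k A] N')
    (f' : M' →ₗ[Env k A] M'') (g' : N' →ₗ[Env k A] N'') :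
    BTensor.map f' g' ∘ₗ BTensor.map f g = BTensor.map (f' ∘ₗ f) (g' ∘ₗ g) :=
  LinearMap.ext fun x => BTensor.map_map f g f' g' x

theorem BTensor.map_add_left (f f' : M →ₗ[Env k A] M') (g : N →ₗ[Env k A] N') :
    BTensor.map (f + f') g = BTensor.map f g + BTensor.map f' g :=
  BTensor.bimodule_hom_ext fun m n => by simp [BTensor.add_mk]

theorem BTensor.map_add_right (f : M →ₗ[Env k A] M') (g g' : N →ₗ[Env k A] N') :
    BTensor.map f (g + g') = BTensor.map f g + BTensor.map f g' :=
  BTensor.bimodule_hom_ext fun m n => by simp [BTensor.mk_add]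

theorem BTensor.map_smul_left (c : k) (f : M →ₗ[Env k A] M') (g : N →ₗ[Env k A] N') :
    BTensor.map (c • f) g = c • BTensor.map f g :=
  BTensor.bimodule_hom_ext fun m n => by simp [BTensor.smul_mk]

theorem BTensor.map_smul_right (c : k) (f : M →ₗ[Env k A] M') (g : N →ₗ[Env k A] N') :
    BTensor.map f (c • g) = c • BTensor.map f g :=
  BTensor.bimodule_hom_ext fun m n => by simp [BTensor.mk_smul]

/-- `BTensor.map` as a `k`-bilinear map. -/
def BTensor.mapₗ :
    (M →ₗ[Env k A] M') →ₗ[k] (N →ₗ[Env k A] N') →ₗ[k]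
      (BTensor k A M N →ₗ[Env k A] BTensor k A M' N') :=
  LinearMap.mk₂ k BTensor.map BTensor.map_add_left BTensor.map_smul_left
    BTensor.map_add_right BTensor.map_smul_right

theorem BTensor.map_zero_left (g : N →ₗ[Env k A] N') :
    BTensor.map (0 : M →ₗ[Env k A] M') g = 0 :=
  (BTensor.mapₗ (k := k) (A := A) (M := M) (M' := M') (N := N) (N' := N')).map_zero₂ g

theorem BTensor.map_zero_right (f : M →ₗ[Env k A] M') :
    BTensor.map f (0 : N →ₗ[Env k A] N') = 0 :=
  (BTensor.mapₗ (k := k) (A := A) (M := M) (M' := M') (N := N) (N' := N') f).map_zero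

theorem BTensor.map_units_left (c : ℤˣ) (f : M →ₗ[Env k A] M') (g : N →ₗ[Env k A] N') :
    BTensor.map (c • f) g = c • BTensor.map f g := by
  rcases Int.units_eq_one_or c with rfl | rfl
  · simp only [one_smul]
  · simp only [Units.neg_smul, one_smul]
    exact (BTensor.mapₗ (k := k) (A := A) (M := M) (M' := M') (N := N) (N' := N')).map_neg₂ f g

theorem BTensor.map_units_right (c : ℤˣ) (f : M →ₗ[Env k A] M') (g : N →ₗ[Env k A] N') :
    BTensor.map f (c • g) = c • BTensor.map f g := by
  rcases Int.units_eq_one_or c with rfl | rfl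
  · simp only [one_smul]
  · simp only [Units.neg_smul, one_smul]
    exact (BTensor.mapₗ (k := k) (A := A) (M := M) (M' := M') (N := N) (N' := N') f).map_neg g

theorem BTensor.map_neg_left (f : M →ₗ[Env k A] M') (g : N →ₗ[Env k A] N') :
    BTensor.map (-f) g = -BTensor.map f g :=
  (BTensor.mapₗ (k := k) (A := A) (M := M) (M' := M') (N := N) (N' := N')).map_neg₂ f g

theorem BTensor.map_neg_right (f : M →ₗ[Env k A] M') (g : N →ₗ[Env k A] N') :
    BTensor.map f (-g) = -BTensor.map f g :=
  (BTensor.mapₗ (k := k) (A := A) (M := M) (M' := M') (N := N) (N' := N') f).map_neg g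

end BTensorMap

/-! ### The tensor product `X ⊗_{Aᵉ} N` -/

section ETensor

variable (k A : Type*) [Field k] [Ring A] [Algebra k A]
variable (X N : Type*)
  [AddCommGroup X] [Module k X] [Module (Env k A) X] [IsScalarTower k (Env k A) X]
  [AddCommGroup N] [Module k N] [Module (Env k A) N] [IsScalarTower k (Env k A) N]

/-- The relations `x (a ⊗ b°) ⊗ n = x ⊗ (a ⊗ b°) n`, where the right action of the enveloping
algebra on a bimodule is `x (a ⊗ b°) = b x a`. -/
def eRel : Submodule k (X ⊗[k] N) :=
  Submodule.span k {z | ∃ (x : X) (a b : A) (n : N),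
    z = (env k b a • x) ⊗ₜ[k] n - x ⊗ₜ[k] (env k a b • n)}

/-- The tensor product `X ⊗_{Aᵉ} N` of two bimodules, `X` being regarded as a right and `N` as a
left module over the enveloping algebra. -/
def ETensor : Type _ := (X ⊗[k] N) ⧸ eRel k A X N

instance : AddCommGroup (ETensor k A X N) := Submodule.Quotient.addCommGroup (eRel k A X N)
instance : Module k (ETensor k A X N) := Submodule.Quotient.module (eRel k A X N)

/-- The projection `X ⊗_k N → X ⊗_{Aᵉ} N`. -/
def ETensor.mkQ : X ⊗[k] N →ₗ[k] ETensor k A X N := (eRel k A X N).mkQ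

variable {X N}

/-- The element `x ⊗_{Aᵉ} n`. -/
def ETensor.mk (x : X) (n : N) : ETensor k A X N := ETensor.mkQ k A X N (x ⊗ₜ[k] n)

variable {k A}

theorem ETensor.add_mk (x x' : X) (n : N) :
    ETensor.mk k A (x + x') n = ETensor.mk k A x n + ETensor.mk k A x' n := by
  simp only [ETensor.mk, TensorProduct.add_tmul, map_add]

theorem ETensor.mk_add (x : X) (n n' : N) :
    ETensor.mk k A x (n + n') = ETensor.mk k A x n + ETensor.mk k A x n' := by
  simp only [ETensor.mk, TensorProduct.tmul_add, map_add]

theorem ETensor.smul_mk (c : k) (x : X) (n : N) :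
    ETensor.mk k A (c • x) n = c • ETensor.mk k A x n := by
  simp only [ETensor.mk, ← TensorProduct.smul_tmul', map_smul]

theorem ETensor.mk_smul (c : k) (x : X) (n : N) :
    ETensor.mk k A x (c • n) = c • ETensor.mk k A x n := by
  simp only [ETensor.mk, TensorProduct.tmul_smul, map_smul]

theorem ETensor.mk_balanced (x : X) (a b : A) (n : N) :
    ETensor.mk k A (env k b a • x) n = ETensor.mk k A x (env k a b • n) := by
  rw [← sub_eq_zero, ETensor.mk, ETensor.mk, ← map_sub]
  exact (Submodule.Quotient.mk_eq_zero _).2 (Submodule.subset_span ⟨x, a, b, n, rfl⟩)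

theorem ETensor.hom_ext {P : Type*} [AddCommGroup P] [Module k P]
    {f g : ETensor k A X N →ₗ[k] P}
    (h : ∀ x n, f (ETensor.mk k A x n) = g (ETensor.mk k A x n)) : f = g :=
  Submodule.linearMap_qext _ (TensorProduct.ext' h)

/-- A `k`-bilinear `Aᵉ`-balanced map induces a map on `X ⊗_{Aᵉ} N`. -/
def ETensor.lift {P : Type*} [AddCommGroup P] [Module k P] (f : X →ₗ[k] N →ₗ[k] P)
    (h : ∀ x (a b : A) n, f (env k b a • x) n = f x (env k a b • n)) : ETensor k A X N →ₗ[k] P :=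
  (eRel k A X N).liftQ (TensorProduct.lift f) (by
    rw [eRel, Submodule.span_le]
    rintro _ ⟨x, a, b, n, rfl⟩
    simp [h])

@[simp] theorem ETensor.lift_mk {P : Type*} [AddCommGroup P] [Module k P] (f : X →ₗ[k] N →ₗ[k] P)
    (h : ∀ x (a b : A) n, f (env k b a • x) n = f x (env k a b • n)) (x : X) (n : N) :
    ETensor.lift f h (ETensor.mk k A x n) = f x n :=
  (Submodule.liftQ_apply _ _ _).trans (TensorProduct.lift.tmul _ _)

/-- `x ⊗_{Aᵉ} n` as a `k`-bilinear map. -/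
def ETensor.mkₗ : X →ₗ[k] N →ₗ[k] ETensor k A X N :=
  LinearMap.mk₂ k (ETensor.mk k A) ETensor.add_mk ETensor.smul_mk ETensor.mk_add ETensor.mk_smul

@[simp] theorem ETensor.mkₗ_apply (x : X) (n : N) :
    ETensor.mkₗ x n = ETensor.mk k A x n := rfl

variable {X' N' X'' N'' : Type*}
  [AddCommGroup X'] [Module k X'] [Module (Env k A) X'] [IsScalarTower k (Env k A) X']
  [AddCommGroup N'] [Module k N'] [Module (Env k A) N'] [IsScalarTower k (Env k A) N']
  [AddCommGroup X''] [Module k X''] [Module (Env k A) X''] [IsScalarTower k (Env k A) X'']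
  [AddCommGroup N''] [Module k N''] [Module (Env k A) N''] [IsScalarTower k (Env k A) N'']

/-- The map `f ⊗_{Aᵉ} g`, without signs. -/
def ETensor.map (f : X →ₗ[Env k A] X') (g : N →ₗ[Env k A] N') :
    ETensor k A X N →ₗ[k] ETensor k A X' N' :=
  ETensor.lift (ETensor.mkₗ.compl₁₂ (f.restrictScalars k) (g.restrictScalars k))
    (fun x a b n => by simp [ETensor.mk_balanced])

@[simp] theorem ETensor.map_mk (f : X →ₗ[Env k A] X') (g : N →ₗ[Env k A] N') (x : X) (n : N) :
    ETensor.map f g (ETensor.mk k A x n) = ETensor.mk k A (f x) (g n) := by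
  simp [ETensor.map]

theorem ETensor.map_map (f : X →ₗ[Env k A] X') (g : N →ₗ[Env k A] N')
    (f' : X' →ₗ[Env k A] X'') (g' : N' →ₗ[Env k A] N'') (x : ETensor k A X N) :
    ETensor.map f' g' (ETensor.map f g x) = ETensor.map (f' ∘ₗ f) (g' ∘ₗ g) x :=
  LinearMap.congr_fun (ETensor.hom_ext (f := ETensor.map f' g' ∘ₗ ETensor.map f g)
    (fun m n => by simp)) x

theorem ETensor.map_comp_map (f : X →ₗ[Env k A] X') (g : N →ₗ[Env k A] N')
    (f' : X' →ₗ[Env k A] X'') (g' : N' →ₗ[Env k A] N'') :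
    ETensor.map f' g' ∘ₗ ETensor.map f g = ETensor.map (f' ∘ₗ f) (g' ∘ₗ g) :=
  LinearMap.ext fun x => ETensor.map_map f g f' g' x

theorem ETensor.map_add_left (f f' : X →ₗ[Env k A] X') (g : N →ₗ[Env k A] N') :
    ETensor.map (f + f') g = ETensor.map f g + ETensor.map f' g :=
  ETensor.hom_ext fun m n => by simp [ETensor.add_mk]

theorem ETensor.map_add_right (f : X →ₗ[Env k A] X') (g g' : N →ₗ[Env k A] N') :
    ETensor.map f (g + g') = ETensor.map f g + ETensor.map f g' :=
  ETensor.hom_ext fun m n => by simp [ETensor.mk_add]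

theorem ETensor.map_smul_left (c : k) (f : X →ₗ[Env k A] X') (g : N →ₗ[Env k A] N') :
    ETensor.map (c • f) g = c • ETensor.map f g :=
  ETensor.hom_ext fun m n => by simp [ETensor.smul_mk]

theorem ETensor.map_smul_right (c : k) (f : X →ₗ[Env k A] X') (g : N →ₗ[Env k A] N') :
    ETensor.map f (c • g) = c • ETensor.map f g :=
  ETensor.hom_ext fun m n => by simp [ETensor.mk_smul]

/-- `ETensor.map` as a `k`-bilinear map. -/
def ETensor.mapₗ :
    (X →ₗ[Env k A] X') →ₗ[k] (N →ₗ[Env k A] N') →ₗ[k]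
      (ETensor k A X N →ₗ[k] ETensor k A X' N') :=
  LinearMap.mk₂ k ETensor.map ETensor.map_add_left ETensor.map_smul_left
    ETensor.map_add_right ETensor.map_smul_right

theorem ETensor.map_zero_left (g : N →ₗ[Env k A] N') :
    ETensor.map (0 : X →ₗ[Env k A] X') g = 0 :=
  (ETensor.mapₗ (k := k) (A := A) (X := X) (X' := X') (N := N) (N' := N')).map_zero₂ g

theorem ETensor.map_zero_right (f : X →ₗ[Env k A] X') :
    ETensor.map f (0 : N →ₗ[Env k A] N') = 0 :=
  (ETensor.mapₗ (k := k) (A := A) (X := X) (X' := X') (N := N) (N' := N') f).map_zero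

theorem ETensor.map_units_left (c : ℤˣ) (f : X →ₗ[Env k A] X') (g : N →ₗ[Env k A] N') :
    ETensor.map (c • f) g = c • ETensor.map f g := by
  rcases Int.units_eq_one_or c with rfl | rfl
  · simp only [one_smul]
  · simp only [Units.neg_smul, one_smul]
    exact (ETensor.mapₗ (k := k) (A := A) (X := X) (X' := X') (N := N) (N' := N')).map_neg₂ f g

theorem ETensor.map_units_right (c : ℤˣ) (f : X →ₗ[Env k A] X') (g : N →ₗ[Env k A] N') :
    ETensor.map f (c • g) = c • ETensor.map f g := by
  rcases Int.units_eq_one_or c with rfl | rfl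
  · simp only [one_smul]
  · simp only [Units.neg_smul, one_smul]
    exact (ETensor.mapₗ (k := k) (A := A) (X := X) (X' := X') (N := N) (N' := N') f).map_neg g

theorem ETensor.map_neg_left (f : X →ₗ[Env k A] X') (g : N →ₗ[Env k A] N') :
    ETensor.map (-f) g = -ETensor.map f g :=
  (ETensor.mapₗ (k := k) (A := A) (X := X) (X' := X') (N := N) (N' := N')).map_neg₂ f g

theorem ETensor.map_neg_right (f : X →ₗ[Env k A] X') (g : N →ₗ[Env k A] N') :
    ETensor.map f (-g) = -ETensor.map f g :=
  (ETensor.mapₗ (k := k) (A := A) (X := X) (X' := X') (N := N) (N' := N') f).map_neg g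

/-- The trilinear map `(x ⊗ m, n) ↦ x ⊗ (m ⊗ n)`. -/
def assocAux (k A X M N : Type*) [Field k] [Ring A] [Algebra k A]
    [AddCommGroup X] [Module k X] [Module (Env k A) X] [IsScalarTower k (Env k A) X]
    [AddCommGroup M] [Module k M] [Module (Env k A) M] [IsScalarTower k (Env k A) M]
    [AddCommGroup N] [Module k N] [Module (Env k A) N] [IsScalarTower k (Env k A) N] :
    BTensor k A X M →ₗ[k] N →ₗ[k] ETensor k A X (BTensor k A M N) :=
  BTensor.lift
    (LinearMap.mk₂ k (fun (x : X) (m : M) =>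
        (ETensor.mkₗ x ∘ₗ BTensor.mkₗ m : N →ₗ[k] ETensor k A X (BTensor k A M N)))
      (fun x x' m => LinearMap.ext fun n => by simp [ETensor.add_mk])
      (fun c x m => LinearMap.ext fun n => by simp [ETensor.smul_mk])
      (fun x m m' => LinearMap.ext fun n => by simp [BTensor.add_mk, ETensor.mk_add])
      (fun c x m => LinearMap.ext fun n => by simp [BTensor.smul_mk, ETensor.mk_smul]))
    (fun x a m => LinearMap.ext fun n => by
      simp [ETensor.mk_balanced, BTensor.env_smul_mk, env_one])

@[simp] theorem assocAux_mk {M : Type*}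
    [AddCommGroup M] [Module k M] [Module (Env k A) M] [IsScalarTower k (Env k A) M]
    (x : X) (m : M) (n : N) :
    assocAux k A X M N (BTensor.mk k A x m) n = ETensor.mk k A x (BTensor.mk k A m n) := by
  simp [assocAux]

theorem assocAux_balanced {M : Type*}
    [AddCommGroup M] [Module k M] [Module (Env k A) M] [IsScalarTower k (Env k A) M]
    (z : BTensor k A X M) (a b : A) (n : N) :
    assocAux k A X M N (env k b a • z) n = assocAux k A X M N z (env k a b • n) := by
  have := BTensor.hom_ext
    (f := (assocAux k A X M N).flip n ∘ₗ Algebra.lsmul k k (BTensor k A X M) (env k b a))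
    (g := (assocAux k A X M N).flip (env k a b • n))
    (fun x m => by
      simp only [LinearMap.comp_apply, LinearMap.flip_apply, Algebra.lsmul_coe,
        BTensor.env_smul_mk, assocAux_mk, ETensor.mk_balanced, BTensor.mk_balanced,
        smul_smul, env_mul, one_mul, env_one, one_smul])
  exact LinearMap.congr_fun this z

/-- The canonical map `(X ⊗_A M) ⊗_{Aᵉ} N → X ⊗_{Aᵉ} (M ⊗_A N)`,
`(x ⊗ m) ⊗ n ↦ x ⊗ (m ⊗ n)`. -/
def assoc (k A X M N : Type*) [Field k] [Ring A] [Algebra k A]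
    [AddCommGroup X] [Module k X] [Module (Env k A) X] [IsScalarTower k (Env k A) X]
    [AddCommGroup M] [Module k M] [Module (Env k A) M] [IsScalarTower k (Env k A) M]
    [AddCommGroup N] [Module k N] [Module (Env k A) N] [IsScalarTower k (Env k A) N] :
    ETensor k A (BTensor k A X M) N →ₗ[k] ETensor k A X (BTensor k A M N) :=
  ETensor.lift (assocAux k A X M N) assocAux_balanced

@[simp] theorem assoc_mk {M : Type*}
    [AddCommGroup M] [Module k M] [Module (Env k A) M] [IsScalarTower k (Env k A) M]
    (x : X) (m : M) (n : N) :
    assoc k A X M N (ETensor.mk k A (BTensor.mk k A x m) n) =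
      ETensor.mk k A x (BTensor.mk k A m n) := by
  rw [assoc, ETensor.lift_mk, assocAux_mk]

end ETensor

/-! ### Homology of `k`-linear maps -/

section Homology

variable {k : Type*} [Field k]
  {X Y Z X' Y' Z' X'' Y'' Z'' : Type*}
  [AddCommGroup X] [Module k X] [AddCommGroup Y] [Module k Y] [AddCommGroup Z] [Module k Z]
  [AddCommGroup X'] [Module k X'] [AddCommGroup Y'] [Module k Y'] [AddCommGroup Z'] [Module k Z']
  [AddCommGroup X''] [Module k X''] [AddCommGroup Y''] [Module k Y'']
  [AddCommGroup Z''] [Module k Z'']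

/-- The homology `ker g / im f` at the middle term of `X → Y → Z` (where `g f = 0`). -/
abbrev Homology (f : X →ₗ[k] Y) (g : Y →ₗ[k] Z) : Type _ :=
  LinearMap.ker g ⧸ (LinearMap.range f).submoduleOf (LinearMap.ker g)

/-- The homology class of a cycle. -/
def Homology.mk (f : X →ₗ[k] Y) (g : Y →ₗ[k] Z) (y : Y) (hy : g y = 0) : Homology f g :=
  ((LinearMap.range f).submoduleOf (LinearMap.ker g)).mkQ ⟨y, hy⟩

/-- The map induced on homology by a map sending cycles to cycles and boundaries to boundaries. -/
def Homology.map (f : X →ₗ[k] Y) (g : Y →ₗ[k] Z) (f' : X' →ₗ[k] Y') (g' : Y' →ₗ[k] Z')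
    (φ : Y →ₗ[k] Y') (hc : ∀ y, g y = 0 → g' (φ y) = 0)
    (hb : ∀ x, φ (f x) ∈ LinearMap.range f') : Homology f g →ₗ[k] Homology f' g' :=
  Submodule.mapQ _ _ (φ.restrict (p := LinearMap.ker g) (q := LinearMap.ker g') hc) (by
    rintro ⟨y, hy⟩ ⟨x, hx⟩
    change φ y ∈ LinearMap.range f'
    have : f x = y := hx
    exact this ▸ hb x)

/-- The bilinear map induced on homology by a bilinear map sending pairs of cycles to cycles, and
pairs of a cycle and a boundary to boundaries. -/
def Homology.map₂ (f : X →ₗ[k] Y) (g : Y →ₗ[k] Z) (f' : X' →ₗ[k] Y') (g' : Y' →ₗ[k] Z')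
    (f'' : X'' →ₗ[k] Y'') (g'' : Y'' →ₗ[k] Z'') (φ : Y →ₗ[k] Y' →ₗ[k] Y'')
    (hc : ∀ y y', g y = 0 → g' y' = 0 → g'' (φ y y') = 0)
    (hb : ∀ x y', g' y' = 0 → φ (f x) y' ∈ LinearMap.range f'')
    (hb' : ∀ y x', g y = 0 → φ y (f' x') ∈ LinearMap.range f'') :
    Homology f g →ₗ[k] Homology f' g' →ₗ[k] Homology f'' g'' :=
  Submodule.liftQ _
    (LinearMap.mk₂ k
      (fun (y : LinearMap.ker g) (c : Homology f' g') =>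
        Homology.map f' g' f'' g'' (φ y) (fun y' hy' => hc y y' y.2 hy') (fun x' => hb' y x' y.2) c)
      (fun y y₂ c => by
        obtain ⟨y', rfl⟩ := Submodule.mkQ_surjective _ c
        simp only [Homology.map, Submodule.mkQ_apply, Submodule.mapQ_apply]
        rw [← Submodule.Quotient.mk_add]
        congr 1
        ext1
        simp only [map_add, map_smul, Submodule.coe_add, Submodule.coe_smul,
          LinearMap.add_apply, LinearMap.smul_apply]
        rfl)
      (fun a y c => by
        obtain ⟨y', rfl⟩ := Submodule.mkQ_surjective _ c
        simp only [Homology.map, Submodule.mkQ_apply, Submodule.mapQ_apply]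
        rw [← Submodule.Quotient.mk_smul]
        congr 1
        ext1
        simp only [map_add, map_smul, Submodule.coe_add, Submodule.coe_smul,
          LinearMap.add_apply, LinearMap.smul_apply]
        rfl)
      (fun y c c' => map_add _ c c')
      (fun a y c => map_smul _ a c))
    (by
      rintro ⟨y, hy⟩ ⟨x, hx⟩
      have hxy : f x = y := hx
      subst hxy
      rw [LinearMap.mem_ker]
      refine LinearMap.ext fun c => ?_
      obtain ⟨⟨y', hy'⟩, rfl⟩ := Submodule.mkQ_surjective _ c
      exact (Submodule.Quotient.mk_eq_zero _).2 (hb x y' hy'))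

theorem Homology.map_mk (f : X →ₗ[k] Y) (g : Y →ₗ[k] Z) (f' : X' →ₗ[k] Y') (g' : Y' →ₗ[k] Z')
    (φ : Y →ₗ[k] Y') (hc : ∀ y, g y = 0 → g' (φ y) = 0)
    (hb : ∀ x, φ (f x) ∈ LinearMap.range f') (y : Y) (hy : g y = 0) :
    Homology.map f g f' g' φ hc hb (Homology.mk f g y hy) = Homology.mk f' g' (φ y) (hc y hy) :=
  rfl

theorem Homology.map₂_mk (f : X →ₗ[k] Y) (g : Y →ₗ[k] Z) (f' : X' →ₗ[k] Y') (g' : Y' →ₗ[k] Z')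
    (f'' : X'' →ₗ[k] Y'') (g'' : Y'' →ₗ[k] Z'') (φ : Y →ₗ[k] Y' →ₗ[k] Y'')
    (hc : ∀ y y', g y = 0 → g' y' = 0 → g'' (φ y y') = 0)
    (hb : ∀ x y', g' y' = 0 → φ (f x) y' ∈ LinearMap.range f'')
    (hb' : ∀ y x', g y = 0 → φ y (f' x') ∈ LinearMap.range f'')
    (y : Y) (hy : g y = 0) (y' : Y') (hy' : g' y' = 0) :
    Homology.map₂ f g f' g' f'' g'' φ hc hb hb' (Homology.mk f g y hy) (Homology.mk f' g' y' hy') =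
      Homology.mk f'' g'' (φ y y') (hc y y' hy hy') :=
  rfl

end Homology

section

/-! ### Complexes of bimodules -/

/-- A `ℤ`-graded chain complex of `A`-bimodules, with differentials of degree `-1`. -/
structure BimodComplex (k A : Type*) [Field k] [Ring A] [Algebra k A] where
  X : ℤ → Type w
  [acg : ∀ i, AddCommGroup (X i)]
  [mod : ∀ i, Module k (X i)]
  [bimod : ∀ i, Module (Env k A) (X i)]
  [tower : ∀ i, IsScalarTower k (Env k A) (X i)]
  d : ∀ i j : ℤ, j + 1 = i → X i →ₗ[Env k A] X j
  d_comp_d : ∀ i j l (hij : j + 1 = i) (hjl : l + 1 = j), d j l hjl ∘ₗ d i j hij = 0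

attribute [instance] BimodComplex.acg BimodComplex.mod BimodComplex.bimod BimodComplex.tower

variable {k A : Type*} [Field k] [Ring A] [Algebra k A]

/-- The complex `C ⊗_A N` for a bimodule `N` (concentrated in degree `0`). -/
abbrev BimodComplex.tensorRight (C : BimodComplex.{w} k A) (N : Type w')
    [AddCommGroup N] [Module k N] [Module (Env k A) N] [IsScalarTower k (Env k A) N] :
    BimodComplex k A where
  X i := BTensor k A (C.X i) N
  d i j h := BTensor.map (C.d i j h) LinearMap.id
  d_comp_d i j l hij hjl := BTensor.bimodule_hom_ext fun x n => by
    have := LinearMap.congr_fun (C.d_comp_d i j l hij hjl) x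
    simp only [LinearMap.comp_apply] at this
    simp only [LinearMap.comp_apply, BTensor.map_mk, this, LinearMap.zero_apply]
    exact (BTensor.mkₗ (k := k) (A := A) (M := C.X l) (N := N)).map_zero₂ n

theorem map_units_smul {R X Y : Type*} [Ring R] [AddCommGroup X] [AddCommGroup Y] [Module R X]
    [Module R Y] (f : X →ₗ[R] Y) (c : ℤˣ) (x : X) : f (c • x) = c • f x := by
  rcases Int.units_eq_one_or c with rfl | rfl <;> simp [Units.neg_smul]

/-- The terms `∏_{p+q=n} C_p ⊗_A C'_q` of the complete tensor product. -/
abbrev CompleteTensorX (C : BimodComplex.{w} k A) (C' : BimodComplex.{w'} k A) (n : ℤ) :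
    Type _ :=
  ∀ p : {p : ℤ × ℤ // p.1 + p.2 = n}, BTensor k A (C.X p.1.1) (C'.X p.1.2)

/-- The differential of the complete tensor product: the component in `C_p ⊗_A C'_q` of `d x` is
`(d ⊗ 1) x_{p+1,q} + (-1)^p (1 ⊗ d) x_{p,q+1}`. -/
def completeTensorD (C : BimodComplex.{w} k A) (C' : BimodComplex.{w'} k A) (i j : ℤ)
    (h : j + 1 = i) : CompleteTensorX C C' i →ₗ[Env k A] CompleteTensorX C C' j :=
  LinearMap.pi (φ := fun p : {p : ℤ × ℤ // p.1 + p.2 = j} =>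
      BTensor k A (C.X p.1.1) (C'.X p.1.2)) fun p =>
    { toFun := fun x =>
        BTensor.map (C.d (p.1.1 + 1) p.1.1 rfl) LinearMap.id
            (x ⟨(p.1.1 + 1, p.1.2), by have := p.2; dsimp only; omega⟩) +
          p.1.1.negOnePow • BTensor.map LinearMap.id (C'.d (p.1.2 + 1) p.1.2 rfl)
            (x ⟨(p.1.1, p.1.2 + 1), by have := p.2; dsimp only; omega⟩)
      map_add' := fun x y => by
        simp only [Pi.add_apply, map_add, smul_add]
        abel
      map_smul' := fun c x => by
        simp only [Pi.smul_apply, map_smul, RingHom.id_apply, smul_add]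
        rw [smul_comm] }

theorem completeTensorD_apply (C : BimodComplex.{w} k A) (C' : BimodComplex.{w'} k A) (i j : ℤ)
    (h : j + 1 = i) (x : CompleteTensorX C C' i) (p q : ℤ) (hp : p + q = j) :
    completeTensorD C C' i j h x ⟨(p, q), hp⟩ =
      BTensor.map (C.d (p + 1) p rfl) LinearMap.id (x ⟨(p + 1, q), by dsimp only; omega⟩) +
      p.negOnePow • BTensor.map LinearMap.id (C'.d (q + 1) q rfl)
        (x ⟨(p, q + 1), by dsimp only; omega⟩) :=
  rfl

/-- The complete tensor product `C ⊗̂_A C'`. -/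
abbrev completeTensor (C : BimodComplex.{w} k A) (C' : BimodComplex.{w'} k A) :
    BimodComplex k A where
  X := CompleteTensorX C C'
  d := completeTensorD C C'
  d_comp_d i j l hij hjl := LinearMap.ext fun x => funext fun ⟨(p, q), hp⟩ => by
    simp only [LinearMap.comp_apply, completeTensorD_apply, map_add, map_neg, map_units_smul,
      BTensor.map_map, LinearMap.comp_id, LinearMap.id_comp, C.d_comp_d, C'.d_comp_d,
      BTensor.map_zero_left, BTensor.map_zero_right, LinearMap.zero_apply, Int.negOnePow_succ,
      Units.neg_smul, smul_zero, zero_add, add_zero, smul_neg, neg_add_cancel]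
    rfl

/-! ### Hom complexes and their cohomology -/

section Hom

variable (C : BimodComplex.{w} k A) (C' : BimodComplex.{w'} k A)
variable (M : Type*) [AddCommGroup M] [Module k M] [Module (Env k A) M]
  [IsScalarTower k (Env k A) M]

/-- The differential `Hom_{Aᵉ}(C, M)^s → Hom_{Aᵉ}(C, M)^{s+1}`, `u ↦ -(-1)^s u d`, where
`Hom_{Aᵉ}(C, M)^s = Hom_{Aᵉ}(C_s, M)`. -/
def coD (s t : ℤ) (h : s + 1 = t) :
    (C.X s →ₗ[Env k A] M) →ₗ[k] (C.X t →ₗ[Env k A] M) where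
  toFun u := -(s.negOnePow • (u ∘ₗ C.d t s h))
  map_add' u v := by rw [LinearMap.add_comp, smul_add, neg_add]
  map_smul' c u := by
    rw [LinearMap.smul_comp, RingHom.id_apply, smul_comm, smul_neg]

/-- The cohomology `H^n(Hom_{Aᵉ}(C, M))`. -/
abbrev HomCohomology (n : ℤ) : Type _ :=
  Homology (coD C M (n - 1) n (sub_add_cancel n 1)) (coD C M n (n + 1) rfl)

/-- `Hom_{Aᵉ}(C, C')^s = ∏_i Hom_{Aᵉ}(C_i, C'_{i-s})`, the maps of (homological) degree `-s`. -/
def HomCochain (s : ℤ) : Type _ :=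
  ∀ p : {p : ℤ × ℤ // p.2 + s = p.1}, C.X p.1.1 →ₗ[Env k A] C'.X p.1.2

instance (s : ℤ) : AddCommGroup (HomCochain C C' s) :=
  inferInstanceAs (AddCommGroup (∀ p : {p : ℤ × ℤ // p.2 + s = p.1},
    C.X p.1.1 →ₗ[Env k A] C'.X p.1.2))

instance (s : ℤ) : Module k (HomCochain C C' s) where
  smul c f := fun p => c • f p
  one_smul f := funext fun p => one_smul k (f p)
  mul_smul a b f := funext fun p => mul_smul a b (f p)
  smul_zero a := funext fun _ => smul_zero a
  smul_add a f g := funext fun p => smul_add a (f p) (g p)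
  add_smul a b f := funext fun p => add_smul a b (f p)
  zero_smul f := funext fun p => zero_smul k (f p)

variable {C C'} in
/-- The component `C_i → C'_j`, `i = j + s`, of a map of degree `-s`. -/
def HomCochain.v {s : ℤ} (f : HomCochain C C' s) (i j : ℤ) (h : j + s = i) :
    C.X i →ₗ[Env k A] C'.X j :=
  f ⟨(i, j), h⟩

variable {C C'} in
theorem HomCochain.ext {s : ℤ} {f g : HomCochain C C' s} (h : ∀ i j hij, f.v i j hij = g.v i j hij) :
    f = g :=
  funext fun ⟨(i, j), hij⟩ => h i j hij

variable {C C'} in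
theorem HomCochain.add_v {s : ℤ} (f g : HomCochain C C' s) (i j : ℤ) (h : j + s = i) :
    (f + g).v i j h = f.v i j h + g.v i j h := rfl

variable {C C'} in
theorem HomCochain.smul_v {s : ℤ} (c : k) (f : HomCochain C C' s) (i j : ℤ) (h : j + s = i) :
    (c • f).v i j h = c • f.v i j h := rfl

variable {C C'} in
/-- The differential `f ↦ d f - (-1)^s f d` on maps of degree `-s`, as a function. -/
def homDFun (s t : ℤ) (h : s + 1 = t) (f : HomCochain C C' s) : HomCochain C C' t := fun p =>
  C'.d (p.1.2 + 1) p.1.2 rfl ∘ₗ f.v p.1.1 (p.1.2 + 1) (by have := p.2; omega) -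
    s.negOnePow • (f.v (p.1.1 - 1) p.1.2 (by have := p.2; omega) ∘ₗ
      C.d p.1.1 (p.1.1 - 1) (sub_add_cancel _ _))

variable {C C'} in
theorem homDFun_v (s t : ℤ) (h : s + 1 = t) (f : HomCochain C C' s) (i j : ℤ) (hij : j + t = i) :
    (homDFun s t h f).v i j hij =
      C'.d (j + 1) j rfl ∘ₗ f.v i (j + 1) (by omega) -
        s.negOnePow • (f.v (i - 1) j (by omega) ∘ₗ C.d i (i - 1) (sub_add_cancel _ _)) :=
  rfl

/-- The differential `f ↦ d f - (-1)^s f d` on maps of degree `-s`. -/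
def homD (s t : ℤ) (h : s + 1 = t) : HomCochain C C' s →ₗ[k] HomCochain C C' t where
  toFun f := homDFun s t h f
  map_add' f g := HomCochain.ext fun i j hij => by
    simp only [homDFun_v, HomCochain.add_v, LinearMap.comp_add, LinearMap.add_comp, smul_add]
    abel
  map_smul' c f := HomCochain.ext fun i j hij => by
    simp only [homDFun_v, HomCochain.smul_v, LinearMap.comp_smul, LinearMap.smul_comp,
      RingHom.id_apply, smul_sub]
    rw [smul_comm]

theorem homD_v (s t : ℤ) (h : s + 1 = t) (f : HomCochain C C' s) (i j : ℤ) (hij : j + t = i) :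
    (homD C C' s t h f).v i j hij =
      C'.d (j + 1) j rfl ∘ₗ f.v i (j + 1) (by omega) -
        s.negOnePow • (f.v (i - 1) j (by omega) ∘ₗ C.d i (i - 1) (sub_add_cancel _ _)) :=
  rfl

/-- The cohomology `H^n(Hom_{Aᵉ}(C, C'))`. -/
abbrev HomComplexCohomology (n : ℤ) : Type _ :=
  Homology (homD C C' (n - 1) n (sub_add_cancel n 1)) (homD C C' n (n + 1) rfl)

end Hom

/-! ### Tensor complexes over the enveloping algebra and their homology -/

section Tensor

variable (C : BimodComplex.{w} k A) (C' : BimodComplex.{w'} k A)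
variable (N : Type*) [AddCommGroup N] [Module k N] [Module (Env k A) N]
  [IsScalarTower k (Env k A) N]

/-- The differential `d ⊗ 1` of `C ⊗_{Aᵉ} N`. -/
def tensorD (i j : ℤ) (h : j + 1 = i) :
    ETensor k A (C.X i) N →ₗ[k] ETensor k A (C.X j) N :=
  ETensor.map (C.d i j h) LinearMap.id

/-- The homology `H_n(C ⊗_{Aᵉ} N)`. -/
abbrev TensorHomology (n : ℤ) : Type _ :=
  Homology (tensorD C N (n + 1) n rfl) (tensorD C N n (n - 1) (sub_add_cancel n 1))

/-- The terms `∏_{p+q=n} C_p ⊗_{Aᵉ} C'_q` of the complete tensor product over the enveloping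
algebra. -/
abbrev CompleteEnvTensorX (n : ℤ) : Type _ :=
  ∀ p : {p : ℤ × ℤ // p.1 + p.2 = n}, ETensor k A (C.X p.1.1) (C'.X p.1.2)

/-- The differential of the complete tensor product `C ⊗̂_{Aᵉ} C'`: the component in
`C_p ⊗_{Aᵉ} C'_q` of `d x` is `(d ⊗ 1) x_{p+1,q} + (-1)^p (1 ⊗ d) x_{p,q+1}`. -/
def completeEnvTensorD (i j : ℤ) (h : j + 1 = i) :
    CompleteEnvTensorX C C' i →ₗ[k] CompleteEnvTensorX C C' j :=
  LinearMap.pi (φ := fun p : {p : ℤ × ℤ // p.1 + p.2 = j} =>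
      ETensor k A (C.X p.1.1) (C'.X p.1.2)) fun p =>
    { toFun := fun x =>
        ETensor.map (C.d (p.1.1 + 1) p.1.1 rfl) LinearMap.id
            (x ⟨(p.1.1 + 1, p.1.2), by have := p.2; dsimp only; omega⟩) +
          p.1.1.negOnePow • ETensor.map LinearMap.id (C'.d (p.1.2 + 1) p.1.2 rfl)
            (x ⟨(p.1.1, p.1.2 + 1), by have := p.2; dsimp only; omega⟩)
      map_add' := fun x y => by
        simp only [Pi.add_apply, map_add, smul_add]
        abel
      map_smul' := fun c x => by
        simp only [Pi.smul_apply, map_smul, RingHom.id_apply, smul_add]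
        rw [smul_comm] }

/-- The homology `H_n(C ⊗̂_{Aᵉ} C')`. -/
abbrev CompleteEnvTensorHomology (n : ℤ) : Type _ :=
  Homology (X := CompleteEnvTensorX C C' (n + 1)) (Y := CompleteEnvTensorX C C' n)
    (Z := CompleteEnvTensorX C C' (n - 1)) (completeEnvTensorD C C' (n + 1) n rfl)
    (completeEnvTensorD C C' n (n - 1) (sub_add_cancel n 1))

end Tensor

/-! ### Complete resolutions and diagonal approximations -/

/-- A complete resolution of `A` over its enveloping algebra: a totally acyclic complex of finitely
generated projective bimodules with an augmentation `ε : T_0 → A` identifying `A` with the cokernel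
of `T_1 → T_0`, equivalently with the image of `T_0 → T_{-1}`. -/
structure CompleteResolution (k A : Type*) [Field k] [Ring A] [Algebra k A]
    extends BimodComplex.{w} k A where
  finite : ∀ i, Module.Finite (Env k A) (X i)
  projective : ∀ i, Module.Projective (Env k A) (X i)
  exact : ∀ i j l (hij : j + 1 = i) (hjl : l + 1 = j), Function.Exact (d i j hij) (d j l hjl)
  dual_exact : ∀ i j l (hij : j + 1 = i) (hjl : l + 1 = j) (f : X j →ₗ[Env k A] Env k A),
    f ∘ₗ d i j hij = 0 → ∃ g : X l →ₗ[Env k A] Env k A, g ∘ₗ d j l hjl = f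
  aug : X 0 →ₗ[Env k A] A
  aug_surjective : Function.Surjective aug
  aug_exact : Function.Exact (d 1 0 (zero_add 1)) aug

/-- The Tate-Hochschild cohomology `Ĥ^n(A, M)`, computed with `T`. -/
abbrev TateCohomology (T : CompleteResolution.{w} k A) (M : Type*) [AddCommGroup M] [Module k M]
    [Module (Env k A) M] [IsScalarTower k (Env k A) M] (n : ℤ) : Type _ :=
  HomCohomology T.toBimodComplex M n

/-- The Tate-Hochschild homology `Ĥ_n(A, N)`, computed with `T`. -/
abbrev TateHomology (T : CompleteResolution.{w} k A) (N : Type*) [AddCommGroup N] [Module k N]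
    [Module (Env k A) N] [IsScalarTower k (Env k A) N] (n : ℤ) : Type _ :=
  TensorHomology T.toBimodComplex N n

/-- A diagonal approximation: a chain map `Δ : T → T ⊗̂_A T` with `(ε ⊗̂_A ε) Δ = ε`
(under `A ⊗_A A = A`). -/
structure DiagonalApproximation (T : CompleteResolution.{w} k A) where
  toHom : ∀ n, T.X n →ₗ[Env k A] (completeTensor T.toBimodComplex T.toBimodComplex).X n
  comm : ∀ i j (h : j + 1 = i),
    (completeTensor T.toBimodComplex T.toBimodComplex).d i j h ∘ₗ toHom i = toHom j ∘ₗ T.d i j h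
  aug : ∀ x : T.X 0,
    BTensor.lid (BTensor.map T.aug T.aug (toHom 0 x ⟨(0, 0), zero_add 0⟩)) = T.aug x

/-- The component `Δ_{p,q} : T_n → T_p ⊗_A T_q`, `p + q = n`. -/
def DiagonalApproximation.component {T : CompleteResolution.{w} k A}
    (Δ : DiagonalApproximation T) (p q n : ℤ) (h : p + q = n) :
    T.X n →ₗ[Env k A] BTensor k A (T.X p) (T.X q) :=
  LinearMap.proj (⟨(p, q), h⟩ : {p : ℤ × ℤ // p.1 + p.2 = n}) ∘ₗ Δ.toHom n

end

section

variable {k A : Type*} [Field k] [Ring A] [Algebra k A] {T : CompleteResolution.{w} k A}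

theorem DiagonalApproximation.component_comp_d (Δ : DiagonalApproximation T)
    (p p' q q' n n' : ℤ) (hp : p + 1 = p') (hq : q + 1 = q') (hn : n + 1 = n') (h : p + q = n) :
    Δ.component p q n h ∘ₗ T.d n' n hn =
      BTensor.map (T.d p' p hp) LinearMap.id ∘ₗ Δ.component p' q n' (by omega) +
        p.negOnePow •
          (BTensor.map LinearMap.id (T.d q' q hq) ∘ₗ Δ.component p q' n' (by omega)) := by
  subst hp hq
  have := Δ.comm n' n hn
  rw [DiagonalApproximation.component, LinearMap.comp_assoc, ← this]
  rfl

theorem comp_units_smul {R X Y Z : Type*} [Ring R] [AddCommGroup X] [AddCommGroup Y]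
    [AddCommGroup Z] [Module R X] [Module R Y] [Module R Z] (f : Y →ₗ[R] Z) (c : ℤˣ)
    (g : X →ₗ[R] Y) : f ∘ₗ (c • g) = c • (f ∘ₗ g) :=
  LinearMap.ext fun x => map_units_smul f c (g x)

theorem units_smul_comp {R X Y Z : Type*} [Ring R] [AddCommGroup X] [AddCommGroup Y]
    [AddCommGroup Z] [Module R X] [Module R Y] [Module R Z] (f : Y →ₗ[R] Z) (c : ℤˣ)
    (g : X →ₗ[R] Y) : (c • f) ∘ₗ g = c • (f ∘ₗ g) := rfl

theorem sign_aux {X : Type*} [AddCommGroup X] (a b c : ℤˣ) (x y : X) :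
    -((a * b) • c • (x + a • y)) = (c * b) • -(a • x) + a • (c * a) • -(b • y) := by
  rcases Int.units_eq_one_or a with rfl | rfl <;> rcases Int.units_eq_one_or b with rfl | rfl <;>
    rcases Int.units_eq_one_or c with rfl | rfl <;>
    simp only [mul_one, one_mul, one_smul, Units.neg_smul, neg_neg, neg_mul, mul_neg, smul_neg] <;>
    abel

theorem homD_v' {C : BimodComplex.{w} k A} {C' : BimodComplex.{w'} k A} (s t : ℤ) (h : s + 1 = t)
    (f : HomCochain C C' s) (i j i' j' : ℤ) (hij : j + t = i) (hi : i' + 1 = i) (hj : j + 1 = j') :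
    (homD C C' s t h f).v i j hij =
      C'.d j' j hj ∘ₗ f.v i j' (by omega) - s.negOnePow • (f.v i' j (by omega) ∘ₗ C.d i i' hi) := by
  obtain rfl : i' = i - 1 := by omega
  subst hj
  exact homD_v C C' s t h f i j hij

section Products

variable (M N : Type*)
  [AddCommGroup M] [Module k M] [Module (Env k A) M] [IsScalarTower k (Env k A) M]
  [AddCommGroup N] [Module k N] [Module (Env k A) N] [IsScalarTower k (Env k A) N]

/-! ### The cup product -/

section Cup

variable (Δ : DiagonalApproximation T)

/-- The cup product of cochains, `u ⌣ v = (u ⊗̂_A v) Δ`, for `u` and `v` of cohomological degrees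
`r` and `s`. The sign is `(-1)^{|v| |x|}` on elements `x ⊗ y` of `T_r ⊗_A T_s`. -/
def cupC (r s t : ℤ) (h : r + s = t) :
    (T.X r →ₗ[Env k A] M) →ₗ[k] (T.X s →ₗ[Env k A] N) →ₗ[k]
      (T.X t →ₗ[Env k A] BTensor k A M N) :=
  LinearMap.mk₂ k
    (fun u v => (r * s).negOnePow • (BTensor.map u v ∘ₗ Δ.component r s t h))
    (fun u u' v => by rw [BTensor.map_add_left, LinearMap.add_comp, smul_add])
    (fun c u v => by rw [BTensor.map_smul_left, LinearMap.smul_comp, smul_comm])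
    (fun u v v' => by rw [BTensor.map_add_right, LinearMap.add_comp, smul_add])
    (fun c u v => by rw [BTensor.map_smul_right, LinearMap.smul_comp, smul_comm])

theorem cupC_apply (r s t : ℤ) (h : r + s = t) (u : T.X r →ₗ[Env k A] M)
    (v : T.X s →ₗ[Env k A] N) :
    cupC M N Δ r s t h u v =
      (r * s).negOnePow • (BTensor.map u v ∘ₗ Δ.component r s t h) := rfl

theorem coD_apply (C : BimodComplex.{w} k A) (s t : ℤ) (h : s + 1 = t) (u : C.X s →ₗ[Env k A] M) :
    coD C M s t h u = -(s.negOnePow • (u ∘ₗ C.d t s h)) := rfl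

theorem cupC_leibniz (r r' s s' t t' : ℤ) (hr : r + 1 = r') (hs : s + 1 = s') (ht : t + 1 = t')
    (h : r + s = t) (u : T.X r →ₗ[Env k A] M) (v : T.X s →ₗ[Env k A] N) :
    coD T.toBimodComplex (BTensor k A M N) t t' ht (cupC M N Δ r s t h u v) =
      cupC M N Δ r' s t' (by omega) (coD T.toBimodComplex M r r' hr u) v +
        r.negOnePow • cupC M N Δ r s' t' (by omega) u (coD T.toBimodComplex N s s' hs v) := by
  have e1 := BTensor.map_comp_map (T.d r' r hr) LinearMap.id u v
  have e2 := BTensor.map_comp_map LinearMap.id (T.d s' s hs) u v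
  rw [LinearMap.comp_id] at e1 e2
  have e3 : BTensor.map u v ∘ₗ Δ.component r s t h ∘ₗ T.d t' t ht =
      BTensor.map (u ∘ₗ T.d r' r hr) v ∘ₗ Δ.component r' s t' (by omega) +
        r.negOnePow • (BTensor.map u (v ∘ₗ T.d s' s hs) ∘ₗ Δ.component r s' t' (by omega)) := by
    rw [Δ.component_comp_d r r' s s' t t' hr hs ht h, LinearMap.comp_add, comp_units_smul,
      ← LinearMap.comp_assoc, ← LinearMap.comp_assoc, e1, e2]
  rw [cupC_apply, coD_apply, units_smul_comp, LinearMap.comp_assoc, e3, cupC_apply, cupC_apply,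
    coD_apply, coD_apply, BTensor.map_neg_left, BTensor.map_neg_right, BTensor.map_units_left,
    BTensor.map_units_right, LinearMap.neg_comp, LinearMap.neg_comp, units_smul_comp,
    units_smul_comp]
  have c1 : (r' * s).negOnePow = (r * s).negOnePow * s.negOnePow := by
    rw [← Int.negOnePow_add, ← hr]; congr 1; ring
  have c2 : (r * s').negOnePow = (r * s).negOnePow * r.negOnePow := by
    rw [← Int.negOnePow_add, ← hs]; congr 1; ring
  have c3 : t.negOnePow = r.negOnePow * s.negOnePow := by rw [← Int.negOnePow_add, h]
  rw [c1, c2, c3]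
  exact sign_aux _ _ _ _ _

/-- The cup product `Ĥ^r(A, M) ⊗ Ĥ^s(A, N) → Ĥ^t(A, M ⊗_A N)`, `t = r + s`. -/
def cup (r s t : ℤ) (h : r + s = t) :
    TateCohomology T M r →ₗ[k] TateCohomology T N s →ₗ[k] TateCohomology T (BTensor k A M N) t :=
  Homology.map₂ _ _ _ _ _ _ (cupC M N Δ r s t h)
    (fun u v hu hv => by
      rw [cupC_leibniz M N Δ r (r + 1) s (s + 1) t (t + 1) rfl rfl rfl h, hu, hv, map_zero,
        map_zero, LinearMap.zero_apply, smul_zero, add_zero])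
    (fun x v hv => ⟨cupC M N Δ (r - 1) s (t - 1) (by omega) x v, by
      rw [cupC_leibniz M N Δ (r - 1) r s (s + 1) (t - 1) t (by omega) rfl (by omega) (by omega),
        hv, map_zero, smul_zero, add_zero]⟩)
    (fun u x hu => ⟨r.negOnePow • cupC M N Δ r (s - 1) (t - 1) (by omega) u x, by
      rw [map_units_smul, cupC_leibniz M N Δ r (r + 1) (s - 1) s (t - 1) t rfl (by omega)
        (by omega) (by omega), hu, map_zero, LinearMap.zero_apply, zero_add, smul_smul,
        Int.units_mul_self, one_smul]⟩)

end Cup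

/-! ### The composition product on cohomology -/

section Comp

variable (T)

/-- The map `ε ⊗_A 1 : T_0 ⊗_A N → A ⊗_A N = N`. -/
def augRight : BTensor k A (T.X 0) N →ₗ[Env k A] N :=
  BTensor.lid ∘ₗ BTensor.map T.aug LinearMap.id

theorem augRight_comp_d : augRight T N ∘ₗ BTensor.map (T.d 1 0 (zero_add 1)) LinearMap.id = 0 := by
  rw [augRight, LinearMap.comp_assoc, BTensor.map_comp_map, T.aug_exact.linearMap_comp_eq_zero,
    BTensor.map_zero_left, LinearMap.comp_zero]

/-- The cochain map `Hom_{Aᵉ}(T, ε ⊗_A 1) : Hom_{Aᵉ}(T, T ⊗_A N) → Hom_{Aᵉ}(T, N)` in degree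
`s`. -/
def augHomC (s : ℤ) :
    HomCochain T.toBimodComplex (T.tensorRight N) s →ₗ[k] (T.X s →ₗ[Env k A] N) where
  toFun w := augRight T N ∘ₗ w.v s 0 (zero_add s)
  map_add' w w' := by rw [HomCochain.add_v, LinearMap.comp_add]
  map_smul' c w := by rw [HomCochain.smul_v, LinearMap.comp_smul, RingHom.id_apply]

theorem augHomC_apply (s : ℤ) (w : HomCochain T.toBimodComplex (T.tensorRight N) s) :
    augHomC T N s w = augRight T N ∘ₗ w.v s 0 (zero_add s) := rfl

theorem augHomC_comm (s t : ℤ) (h : s + 1 = t)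
    (w : HomCochain T.toBimodComplex (T.tensorRight N) s) :
    augHomC T N t (homD T.toBimodComplex (T.tensorRight N) s t h w) =
      coD T.toBimodComplex N s t h (augHomC T N s w) := by
  rw [augHomC_apply, homD_v' s t h w t 0 s 1 (zero_add t) h (zero_add 1), LinearMap.comp_sub,
    ← LinearMap.comp_assoc, augRight_comp_d, LinearMap.zero_comp, zero_sub, comp_units_smul]
  rfl

/-- The map `H^s(Hom_{Aᵉ}(T, T ⊗_A N)) → Ĥ^s(A, N)` induced by `ε ⊗_A 1`. -/
def augHom (s : ℤ) :
    HomComplexCohomology T.toBimodComplex (T.tensorRight N) s →ₗ[k] TateCohomology T N s :=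
  Homology.map _ _ _ _ (augHomC T N s)
    (fun w hw => by rw [← augHomC_comm, hw, map_zero])
    (fun w => ⟨augHomC T N (s - 1) w, (augHomC_comm T N (s - 1) s _ w).symm⟩)

/-- The composition `u ⊗ w ↦ (u ⊗_A 1) ∘ w` of cochains, for `u` and `w` of cohomological degrees
`r` and `s`. -/
def compC (r s t : ℤ) (h : r + s = t) :
    (T.X r →ₗ[Env k A] M) →ₗ[k] HomCochain T.toBimodComplex (T.tensorRight N) s →ₗ[k]
      (T.X t →ₗ[Env k A] BTensor k A M N) :=
  LinearMap.mk₂ k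
    (fun u w => BTensor.map u LinearMap.id ∘ₗ w.v t r h)
    (fun u u' w => by rw [BTensor.map_add_left, LinearMap.add_comp])
    (fun c u w => by rw [BTensor.map_smul_left, LinearMap.smul_comp])
    (fun u w w' => by rw [HomCochain.add_v, LinearMap.comp_add])
    (fun c u w => by rw [HomCochain.smul_v, LinearMap.comp_smul])

theorem compC_apply (r s t : ℤ) (h : r + s = t) (u : T.X r →ₗ[Env k A] M)
    (w : HomCochain T.toBimodComplex (T.tensorRight N) s) :
    compC T M N r s t h u w = BTensor.map u LinearMap.id ∘ₗ w.v t r h := rfl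

theorem compC_leibniz (r r' s s' t t' : ℤ) (hr : r + 1 = r') (hs : s + 1 = s') (ht : t + 1 = t')
    (h : r + s = t) (u : T.X r →ₗ[Env k A] M)
    (w : HomCochain T.toBimodComplex (T.tensorRight N) s) :
    coD T.toBimodComplex (BTensor k A M N) t t' ht (compC T M N r s t h u w) =
      compC T M N r' s t' (by omega) (coD T.toBimodComplex M r r' hr u) w +
        r.negOnePow • compC T M N r s' t' (by omega) u
          (homD T.toBimodComplex (T.tensorRight N) s s' hs w) := by
  have e := BTensor.map_comp_map (T.d r' r hr) LinearMap.id u (LinearMap.id (M := N))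
  rw [LinearMap.comp_id] at e
  rw [compC_apply, compC_apply, compC_apply, coD_apply, coD_apply,
    homD_v' s s' hs w t' r t r' (by omega) ht hr, LinearMap.comp_sub, ← LinearMap.comp_assoc, e,
    BTensor.map_neg_left, BTensor.map_units_left, LinearMap.neg_comp, units_smul_comp,
    comp_units_smul, smul_sub, smul_smul, ← Int.negOnePow_add,
    show t.negOnePow = (r + s).negOnePow by rw [h], LinearMap.comp_assoc]
  abel

/-- The composition product
`Ĥ^r(A, M) ⊗ H^s(Hom_{Aᵉ}(T, T ⊗_A N)) → Ĥ^t(A, M ⊗_A N)`, `t = r + s`. -/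
def compositionProduct (r s t : ℤ) (h : r + s = t) :
    TateCohomology T M r →ₗ[k] HomComplexCohomology T.toBimodComplex (T.tensorRight N) s →ₗ[k]
      TateCohomology T (BTensor k A M N) t :=
  Homology.map₂ _ _ _ _ _ _ (compC T M N r s t h)
    (fun u v hu hv => by
      rw [compC_leibniz T M N r (r + 1) s (s + 1) t (t + 1) rfl rfl rfl h, hu, hv, map_zero,
        map_zero, LinearMap.zero_apply, smul_zero, add_zero])
    (fun x v hv => ⟨compC T M N (r - 1) s (t - 1) (by omega) x v, by
      rw [compC_leibniz T M N (r - 1) r s (s + 1) (t - 1) t (by omega) rfl (by omega) (by omega),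
        hv, map_zero, smul_zero, add_zero]⟩)
    (fun u x hu => ⟨r.negOnePow • compC T M N r (s - 1) (t - 1) (by omega) u x, by
      rw [map_units_smul, compC_leibniz T M N r (r + 1) (s - 1) s (t - 1) t rfl (by omega)
        (by omega) (by omega), hu, map_zero, LinearMap.zero_apply, zero_add, smul_smul,
        Int.units_mul_self, one_smul]⟩)

end Comp

end Products

end

section

variable {k A : Type*} [Field k] [Ring A] [Algebra k A] {T : CompleteResolution.{w} k A}

section CapProducts

variable (M N : Type*)
  [AddCommGroup M] [Module k M] [Module (Env k A) M] [IsScalarTower k (Env k A) M]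
  [AddCommGroup N] [Module k N] [Module (Env k A) N] [IsScalarTower k (Env k A) N]

/-! ### The cap product -/

section Cap

variable (Δ : DiagonalApproximation T)

theorem assoc_natural {X X' : Type*}
    [AddCommGroup X] [Module k X] [Module (Env k A) X] [IsScalarTower k (Env k A) X]
    [AddCommGroup X'] [Module k X'] [Module (Env k A) X'] [IsScalarTower k (Env k A) X']
    (f : X →ₗ[Env k A] X') (y : ETensor k A (BTensor k A X M) N) :
    ETensor.map f LinearMap.id (assoc k A X M N y) =
      assoc k A X' M N (ETensor.map (BTensor.map f LinearMap.id) LinearMap.id y) := by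
  refine LinearMap.congr_fun (ETensor.hom_ext (f := ETensor.map f LinearMap.id ∘ₗ assoc k A X M N)
    (g := assoc k A X' M N ∘ₗ ETensor.map (BTensor.map f LinearMap.id) LinearMap.id)
    (fun b n => ?_)) y
  refine LinearMap.congr_fun (BTensor.hom_ext
    (f := ETensor.map f LinearMap.id ∘ₗ assoc k A X M N ∘ₗ ETensor.mkₗ.flip n)
    (g := assoc k A X' M N ∘ₗ ETensor.map (BTensor.map f LinearMap.id) LinearMap.id ∘ₗ
      ETensor.mkₗ.flip n) (fun x m => ?_)) b
  simp

/-- The cap product of a cochain `u` of degree `r` and a chain `z` of degree `s`: if `z = x ⊗ n`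
and `Δ x` has the component `∑ x' ⊗ x''` in `T_t ⊗_A T_r`, `t + r = s`, then
`u ⌢ z = ∑ (-1)^{|u| |x'|} x' ⊗ (u x'' ⊗ n)`. -/
def capC (r s t : ℤ) (h : t + r = s) :
    (T.X r →ₗ[Env k A] M) →ₗ[k] ETensor k A (T.X s) N →ₗ[k]
      ETensor k A (T.X t) (BTensor k A M N) :=
  LinearMap.mk₂ k
    (fun u z => (r * t).negOnePow • assoc k A (T.X t) M N
      (ETensor.map (BTensor.map LinearMap.id u ∘ₗ Δ.component t r s h) LinearMap.id z))
    (fun u u' z => by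
      rw [BTensor.map_add_right, LinearMap.add_comp, ETensor.map_add_left, LinearMap.add_apply,
        map_add, smul_add])
    (fun c u z => by
      rw [BTensor.map_smul_right, LinearMap.smul_comp, ETensor.map_smul_left,
        LinearMap.smul_apply, map_smul, smul_comm])
    (fun u z z' => by rw [map_add, map_add, smul_add])
    (fun c u z => by rw [map_smul, map_smul, smul_comm])

theorem capC_apply (r s t : ℤ) (h : t + r = s) (u : T.X r →ₗ[Env k A] M)
    (z : ETensor k A (T.X s) N) :
    capC M N Δ r s t h u z = (r * t).negOnePow • assoc k A (T.X t) M N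
      (ETensor.map (BTensor.map LinearMap.id u ∘ₗ Δ.component t r s h) LinearMap.id z) := rfl

theorem cap_sign_aux {X : Type*} [AddCommGroup X] (a b c : ℤˣ) (x y : X) :
    (c * a) • x = (c * b) • -(a • y) + a • c • (x + b • y) := by
  rcases Int.units_eq_one_or a with rfl | rfl <;> rcases Int.units_eq_one_or b with rfl | rfl <;>
    rcases Int.units_eq_one_or c with rfl | rfl <;>
    simp only [mul_one, one_mul, one_smul, Units.neg_smul, neg_neg, neg_mul, mul_neg, smul_neg] <;>
    abel

theorem capC_leibniz (r r' s s' t t' : ℤ) (hr : r + 1 = r') (hs : s' + 1 = s) (ht : t' + 1 = t)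
    (h : t + r = s) (u : T.X r →ₗ[Env k A] M) (z : ETensor k A (T.X s) N) :
    tensorD T.toBimodComplex (BTensor k A M N) t t' ht (capC M N Δ r s t h u z) =
      capC M N Δ r' s t' (by omega) (coD T.toBimodComplex M r r' hr u) z +
        r.negOnePow • capC M N Δ r s' t' (by omega) u (tensorD T.toBimodComplex N s s' hs z) := by
  have e1 := BTensor.map_comp_map (T.d t t' ht) LinearMap.id LinearMap.id u
  have e2 := BTensor.map_comp_map LinearMap.id (T.d r' r hr) (LinearMap.id (M := T.X t')) u
  have e4 := BTensor.map_comp_map LinearMap.id u (T.d t t' ht) LinearMap.id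
  rw [LinearMap.comp_id, LinearMap.id_comp] at e1 e4
  rw [LinearMap.comp_id] at e2
  have e3 : (BTensor.map LinearMap.id u ∘ₗ Δ.component t' r s' (by omega)) ∘ₗ T.d s s' hs =
      BTensor.map (T.d t t' ht) u ∘ₗ Δ.component t r s h +
        t'.negOnePow • (BTensor.map LinearMap.id (u ∘ₗ T.d r' r hr) ∘ₗ
          Δ.component t' r' s (by omega)) := by
    rw [LinearMap.comp_assoc, Δ.component_comp_d t' t r r' s' s ht hr hs, LinearMap.comp_add,
      comp_units_smul, ← LinearMap.comp_assoc, ← LinearMap.comp_assoc, e1, e2]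
  rw [capC_apply, capC_apply, capC_apply, coD_apply, tensorD, tensorD, map_units_smul,
    assoc_natural, ETensor.map_map, ETensor.map_map, LinearMap.comp_id, e3,
    ← LinearMap.comp_assoc, e4, ETensor.map_add_left, ETensor.map_units_left, BTensor.map_neg_right,
    BTensor.map_units_right, LinearMap.neg_comp, units_smul_comp, ETensor.map_neg_left,
    ETensor.map_units_left, LinearMap.neg_apply, LinearMap.add_apply, map_neg, map_add]
  have c1 : (r' * t').negOnePow = (r * t').negOnePow * t'.negOnePow := by
    rw [← Int.negOnePow_add, ← hr]; congr 1; ring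
  have c2 : (r * t).negOnePow = (r * t').negOnePow * r.negOnePow := by
    rw [← Int.negOnePow_add, ← ht]; congr 1; ring
  rw [c1, c2]
  have u1 : ∀ (c : ℤˣ) (f : ETensor k A (T.X s) N →ₗ[k] ETensor k A (BTensor k A (T.X t') M) N),
    assoc k A (T.X t') M N ((c • f) z) = c • assoc k A (T.X t') M N (f z) :=
    fun c f => map_units_smul _ c (f z)
  rw [u1, u1]
  exact cap_sign_aux _ _ _ _ _

/-- The cap product `Ĥ^r(A, M) ⊗ Ĥ_s(A, N) → Ĥ_t(A, M ⊗_A N)`, `t = s - r`. -/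
def cap (r s t : ℤ) (h : t + r = s) :
    TateCohomology T M r →ₗ[k] TateHomology T N s →ₗ[k] TateHomology T (BTensor k A M N) t :=
  Homology.map₂ _ _ _ _ _ _ (capC M N Δ r s t h)
    (fun u z hu hz => by
      rw [capC_leibniz M N Δ r (r + 1) s (s - 1) t (t - 1) rfl (by omega) (by omega) h, hu, hz,
        map_zero, map_zero, LinearMap.zero_apply, smul_zero, add_zero])
    (fun x z hz => ⟨capC M N Δ (r - 1) s (t + 1) (by omega) x z, by
      rw [capC_leibniz M N Δ (r - 1) r s (s - 1) (t + 1) t (by omega) (by omega) rfl (by omega),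
        hz, map_zero, smul_zero, add_zero]⟩)
    (fun u x hu => ⟨r.negOnePow • capC M N Δ r (s + 1) (t + 1) (by omega) u x, by
      rw [map_units_smul, capC_leibniz M N Δ r (r + 1) (s + 1) s (t + 1) t rfl rfl rfl (by omega),
        hu, map_zero, LinearMap.zero_apply, zero_add, smul_smul, Int.units_mul_self, one_smul]⟩)

end Cap

/-! ### The composition product on homology -/

section CapComp

variable (T)

theorem completeEnvTensorD_apply (C : BimodComplex.{w} k A) (C' : BimodComplex.{w'} k A)
    (i j : ℤ) (h : j + 1 = i) (z : CompleteEnvTensorX C C' i) (p p' q q' : ℤ) (hp : p + 1 = p')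
    (hq : q + 1 = q') (hpq : p + q = j) :
    completeEnvTensorD C C' i j h z ⟨(p, q), hpq⟩ =
      ETensor.map (C.d p' p hp) LinearMap.id (z ⟨(p', q), by dsimp only; omega⟩) +
      p.negOnePow • ETensor.map LinearMap.id (C'.d q' q hq)
        (z ⟨(p, q'), by dsimp only; omega⟩) := by
  subst hp hq
  rfl

/-- The chain map `1 ⊗ (ε ⊗_A 1) : T ⊗̂_{Aᵉ} (T ⊗_A N) → T ⊗_{Aᵉ} N` in degree `s`. -/
def augTensorC (s : ℤ) :
    CompleteEnvTensorX T.toBimodComplex (T.tensorRight N) s →ₗ[k] ETensor k A (T.X s) N where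
  toFun z := ETensor.map LinearMap.id (augRight T N) (z ⟨(s, 0), add_zero s⟩)
  map_add' z z' := map_add _ _ _
  map_smul' c z := by rw [Pi.smul_apply, map_smul, RingHom.id_apply]

theorem augTensorC_apply (s : ℤ)
    (z : CompleteEnvTensorX T.toBimodComplex (T.tensorRight N) s) :
    augTensorC T N s z = ETensor.map LinearMap.id (augRight T N) (z ⟨(s, 0), add_zero s⟩) := rfl

theorem augTensorC_comm (s t : ℤ) (h : t + 1 = s)
    (z : CompleteEnvTensorX T.toBimodComplex (T.tensorRight N) s) :
    augTensorC T N t (completeEnvTensorD T.toBimodComplex (T.tensorRight N) s t h z) =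
      tensorD T.toBimodComplex N s t h (augTensorC T N s z) := by
  rw [augTensorC_apply, augTensorC_apply,
    completeEnvTensorD_apply T.toBimodComplex (T.tensorRight N) s t h z t s 0 1 h (zero_add 1)
      (add_zero t), tensorD, map_add, map_units_smul, ETensor.map_map, ETensor.map_map,
    ETensor.map_map, augRight_comp_d, ETensor.map_zero_right, LinearMap.zero_apply, smul_zero,
    add_zero]
  rfl

/-- The map `H_s(T ⊗̂_{Aᵉ} (T ⊗_A N)) → Ĥ_s(A, N)` induced by `ε ⊗_A 1`. -/
def augTensor (s : ℤ) :
    CompleteEnvTensorHomology T.toBimodComplex (T.tensorRight N) s →ₗ[k] TateHomology T N s :=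
  Homology.map _ _ _ _ (augTensorC T N s)
    (fun z hz => by rw [← augTensorC_comm, hz, map_zero])
    (fun z => ⟨augTensorC T N (s + 1) z, (augTensorC_comm T N (s + 1) s rfl z).symm⟩)

/-- The composition `u ⊗ (x ⊗ (x' ⊗ n)) ↦ (-1)^{|u| |x|} x ⊗ (u x' ⊗ n)` of a cochain `u` of
degree `r` with a chain of degree `s`. -/
def capCompC (r s t : ℤ) (h : t + r = s) :
    (T.X r →ₗ[Env k A] M) →ₗ[k] CompleteEnvTensorX T.toBimodComplex (T.tensorRight N) s →ₗ[k]
      ETensor k A (T.X t) (BTensor k A M N) :=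
  LinearMap.mk₂ k
    (fun u z => (r * t).negOnePow •
      ETensor.map LinearMap.id (BTensor.map u LinearMap.id) (z ⟨(t, r), h⟩))
    (fun u u' z => by
      rw [BTensor.map_add_left, ETensor.map_add_right, LinearMap.add_apply, smul_add])
    (fun c u z => by
      rw [BTensor.map_smul_left, ETensor.map_smul_right, LinearMap.smul_apply, smul_comm])
    (fun u z z' => by rw [Pi.add_apply, map_add, smul_add])
    (fun c u z => by rw [Pi.smul_apply, map_smul, smul_comm])

theorem capCompC_apply (r s t : ℤ) (h : t + r = s) (u : T.X r →ₗ[Env k A] M)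
    (z : CompleteEnvTensorX T.toBimodComplex (T.tensorRight N) s) :
    capCompC T M N r s t h u z = (r * t).negOnePow •
      ETensor.map LinearMap.id (BTensor.map u LinearMap.id) (z ⟨(t, r), h⟩) := rfl

theorem capCompC_leibniz (r r' s s' t t' : ℤ) (hr : r + 1 = r') (hs : s' + 1 = s)
    (ht : t' + 1 = t) (h : t + r = s) (u : T.X r →ₗ[Env k A] M)
    (z : CompleteEnvTensorX T.toBimodComplex (T.tensorRight N) s) :
    tensorD T.toBimodComplex (BTensor k A M N) t t' ht (capCompC T M N r s t h u z) =
      capCompC T M N r' s t' (by omega) (coD T.toBimodComplex M r r' hr u) z +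
        r.negOnePow • capCompC T M N r s' t' (by omega) u
          (completeEnvTensorD T.toBimodComplex (T.tensorRight N) s s' hs z) := by
  have e1 := BTensor.map_comp_map (T.d r' r hr) LinearMap.id u (LinearMap.id (M := N))
  rw [LinearMap.comp_id] at e1
  have c1 : (r' * t').negOnePow = (r * t').negOnePow * t'.negOnePow := by
    rw [← Int.negOnePow_add, ← hr]; congr 1; ring
  have c2 : (r * t).negOnePow = (r * t').negOnePow * r.negOnePow := by
    rw [← Int.negOnePow_add, ← ht]; congr 1; ring
  rw [capCompC_apply, capCompC_apply, capCompC_apply, coD_apply, tensorD, map_units_smul,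
    completeEnvTensorD_apply T.toBimodComplex (T.tensorRight N) s s' hs z t' t r r' ht hr (by omega),
    map_add, map_units_smul, ETensor.map_map, ETensor.map_map, ETensor.map_map, LinearMap.comp_id,
    LinearMap.id_comp, LinearMap.id_comp, LinearMap.comp_id, e1, BTensor.map_neg_left,
    BTensor.map_units_left, ETensor.map_neg_right, ETensor.map_units_right, LinearMap.neg_apply,
    c1, c2]
  exact cap_sign_aux _ _ _ _ _

/-- The composition product
`Ĥ^r(A, M) ⊗ H_s(T ⊗̂_{Aᵉ} (T ⊗_A N)) → Ĥ_t(A, M ⊗_A N)`, `t = s - r`. -/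
def capCompositionProduct (r s t : ℤ) (h : t + r = s) :
    TateCohomology T M r →ₗ[k]
      CompleteEnvTensorHomology T.toBimodComplex (T.tensorRight N) s →ₗ[k]
        TateHomology T (BTensor k A M N) t :=
  Homology.map₂ _ _ _ _ _ _ (capCompC T M N r s t h)
    (fun u z hu hz => by
      rw [capCompC_leibniz T M N r (r + 1) s (s - 1) t (t - 1) rfl (by omega) (by omega) h, hu, hz,
        map_zero, map_zero, LinearMap.zero_apply, smul_zero, add_zero])
    (fun x z hz => ⟨capCompC T M N (r - 1) s (t + 1) (by omega) x z, by
      rw [capCompC_leibniz T M N (r - 1) r s (s - 1) (t + 1) t (by omega) (by omega) rfl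
        (by omega), hz, map_zero, smul_zero, add_zero]⟩)
    (fun u x hu => ⟨r.negOnePow • capCompC T M N r (s + 1) (t + 1) (by omega) u x, by
      rw [map_units_smul, capCompC_leibniz T M N r (r + 1) (s + 1) s (t + 1) t rfl rfl rfl
        (by omega), hu, map_zero, LinearMap.zero_apply, zero_add, smul_smul, Int.units_mul_self,
        one_smul]⟩)

end CapComp

end CapProducts

end

end TateHochschild

end

namespace TateHochschild

universe w w'

/-! ### Dual bases and traces -/

/-! The diagonal provides explicit inverses of both comparison maps. A cocycle v on T_s lifts to the
cocycle (1 ⊗ v)Δ in Hom(T, T ⊗_A N), and (u ⊗ 1) ∘ (1 ⊗ v)Δ = (u ⊗ v)Δ with the same sign, so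
composing u with this lift is the cup product already on cochains (`compC_homLift`). Applying ε ⊗ 1
to the lift gives v ∘ (ε ⊗ 1)Δ. Since (ε ⊗ 1)Δ is a chain endomorphism of T over A, it is homotopic
to the identity, and α sends the class of the lift to the class of v (`augHom_homLift`). For
homology, Δ ⊗ 1 lifts cycles of T ⊗ N over A^e, composition gives the cap product
(`capCompC_tensorLift`), and β involves (1 ⊗ ε)Δ instead. What remains is injectivity of α and β,
and the homotopy to the identity.

Both follow from one principle: a cocycle of Hom(T, C), or a cycle of the complete tensor product of
T and C over A^e, bounds as soon as its augmentation does (`exists_homD_eq`,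
`exists_completeEnvTensorD_eq`). Here C is T ⊗_A N, or T itself for the homotopy. The equation to
solve is a system indexed by the degree j in C, unbounded in both directions. It is solved first at
j = 0, where the augmentation makes it solvable, then upward by exactness in the C direction and
downward by exactness in the T direction (`exists_total_primitive`). The total complexes are
products, so both recursions may be infinite.

The exactness comes from the Frobenius form. Its Casimir element Σ x_i ⊗ y_i averages k-linear maps
to one-sided A-linear ones. By Higman's criterion A and all T_i are relatively projective and
injective for either one-sided action, so the augmented complex T splits one-sidedly
(`CompleteResolution.hasContraction`). The right splitting survives tensoring with any N. Moreover
the identity of T_j ⊗_A N is the left trace of a right linear map, so averaging on the left turns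
right linear splittings of T into bimodule maps (`exists_comp_eq_of_isTraceIdentity`).
`ETensor.traceMap` is the analogue for tensor products. No finiteness of N enters. -/

/-- Dual bases of a Frobenius algebra with respect to the form `(a, b) ↦ form (a b)`. -/
structure DualBases (k R : Type*) [Field k] [Ring R] [Algebra k R] where
  n : ℕ
  x : Fin n → R
  y : Fin n → R
  form : R →ₗ[k] k
  left : ∀ a, ∑ i, form (y i * a) • x i = a
  right : ∀ a, ∑ i, form (a * x i) • y i = a

/-- A basis and its dual with respect to B, with form a ↦ B(a, 1). Associativity gives B(ac, 1) =
B(a, c), so the two identities are the coordinate expansions in the two bases. -/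
theorem IsFrobenius.exists_dualBases {k A : Type*} [Field k] [Ring A] [Algebra k A]
    [FiniteDimensional k A] (hA : IsFrobenius k A) : Nonempty (DualBases k A) := by
  obtain ⟨B, hB, hassoc⟩ := hA
  classical
  let b := Module.finBasis k A
  let b' := LinearMap.BilinForm.dualBasis B hB b
  have hform : ∀ a c, B (a * c) 1 = B a c := fun a c => by rw [hassoc, mul_one]
  have hd : ∀ i j, B (b' i) (b j) = if j = i then 1 else 0 :=
    LinearMap.BilinForm.apply_dualBasis_left hB b
  refine ⟨⟨_, b, b', B.flip 1, fun a => ?_, fun a => ?_⟩⟩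
  · simp only [LinearMap.flip_apply, hform]
    refine (Finset.sum_congr rfl fun i _ => ?_).trans (b.sum_repr a)
    rw [LinearMap.congr_fun (b.ext fun j => by simp [hd, Finsupp.single_apply] :
      B (b' i) = b.coord i) a, b.coord_apply]
  · simp only [LinearMap.flip_apply, hform]
    refine (Finset.sum_congr rfl fun i _ => ?_).trans (b'.sum_repr a)
    rw [← LinearMap.flip_apply, LinearMap.congr_fun (b'.ext fun j => by
      simp [hd, Finsupp.single_apply, eq_comm] : B.flip (b i) = b'.coord i) a, b'.coord_apply]

section DualBases

variable {k R : Type*} [Field k] [Ring R] [Algebra k R] (D : DualBases k R)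

/-- Expanding a x_i in the x_j, and y_j a in the y_i, produces the same matrix form(y_j a x_i), so
both sides are the same double sum. -/
theorem DualBases.casimir {P : Type*} [AddCommGroup P] [Module k P] (F : R →ₗ[k] R →ₗ[k] P)
    (a : R) : ∑ i, F (a * D.x i) (D.y i) = ∑ i, F (D.x i) (D.y i * a) := by
  have h1 : ∀ i, F (a * D.x i) (D.y i) =
      ∑ j, D.form (D.y j * a * D.x i) • F (D.x j) (D.y i) := fun i => by
    conv_lhs => rw [← D.left (a * D.x i)]
    simp [mul_assoc]
  have h2 : ∀ j, F (D.x j) (D.y j * a) =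
      ∑ i, D.form (D.y j * a * D.x i) • F (D.x j) (D.y i) := fun j => by
    conv_lhs => rw [← D.right (D.y j * a)]
    simp
  simp only [h1, h2]
  exact Finset.sum_comm

/-- The dual bases of the opposite algebra. -/
def DualBases.op : DualBases k Rᵐᵒᵖ where
  n := D.n
  x i := MulOpposite.op (D.y i)
  y i := MulOpposite.op (D.x i)
  form := D.form ∘ₗ (MulOpposite.opLinearEquiv k).symm.toLinearMap
  left a := by
    refine MulOpposite.unop_injective ?_
    simpa using D.right a.unop
  right a := by
    refine MulOpposite.unop_injective ?_
    simpa using D.left a.unop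

end DualBases

section Trace

variable {k A R R' : Type*} [Field k] [Ring A] [Algebra k A] [Ring R] [Algebra k R]
  [Ring R'] [Algebra k R']
variable {X Y Z P : Type*}
  [AddCommGroup X] [Module k X] [Module (Env k A) X] [IsScalarTower k (Env k A) X]
  [AddCommGroup Y] [Module k Y] [Module (Env k A) Y] [IsScalarTower k (Env k A) Y]
  [AddCommGroup Z] [Module k Z] [Module (Env k A) Z] [IsScalarTower k (Env k A) Z]
  [AddCommGroup P] [Module k P] [Module (Env k A) P] [IsScalarTower k (Env k A) P]

/-- A `k`-linear map of bimodules that is linear over `R`, acting through `ρ : R → Aᵉ`. -/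
def IsLinearOver (ρ : R →ₐ[k] Env k A) (φ : X →ₗ[k] Y) : Prop :=
  ∀ b x, φ (ρ b • x) = ρ b • φ x

variable {ρ : R →ₐ[k] Env k A} {ρ' : R' →ₐ[k] Env k A}

theorem isLinearOver_restrictScalars (f : X →ₗ[Env k A] Y) :
    IsLinearOver ρ (f.restrictScalars k) := fun b x => f.map_smul (ρ b) x

theorem IsLinearOver.comp {φ : Y →ₗ[k] Z} {ψ : X →ₗ[k] Y} (hφ : IsLinearOver ρ φ)
    (hψ : IsLinearOver ρ ψ) : IsLinearOver ρ (φ ∘ₗ ψ) := fun b x => by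
  rw [LinearMap.comp_apply, LinearMap.comp_apply, hψ, hφ]

theorem IsLinearOver.id : IsLinearOver ρ (LinearMap.id : X →ₗ[k] X) := fun _ _ => rfl

theorem IsLinearOver.sub {φ ψ : X →ₗ[k] Y} (hφ : IsLinearOver ρ φ)
    (hψ : IsLinearOver ρ ψ) : IsLinearOver ρ (φ - ψ) := fun b x => by
  rw [LinearMap.sub_apply, LinearMap.sub_apply, hψ, hφ, smul_sub]

variable (D : DualBases k R) (ρ)

/-- The trace `∑ xᵢ φ(yᵢ -)` of a `k`-linear map. -/
def trace (φ : X →ₗ[k] Y) : X →ₗ[k] Y :=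
  ∑ i, Algebra.lsmul k k Y (ρ (D.x i)) ∘ₗ φ ∘ₗ Algebra.lsmul k k X (ρ (D.y i))

theorem trace_apply (φ : X →ₗ[k] Y) (x : X) :
    trace ρ D φ x = ∑ i, ρ (D.x i) • φ (ρ (D.y i) • x) := by
  simp [trace, LinearMap.sum_apply]

/-- The Casimir identity for (c, d) ↦ c φ(d x) carries b from the outer factors x_i to the inner
factors y_i. -/
theorem trace_isLinearOver (φ : X →ₗ[k] Y) : IsLinearOver ρ (trace ρ D φ) := fun b x => by
  rw [trace_apply, trace_apply, Finset.smul_sum]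
  have := D.casimir (P := Y) (LinearMap.mk₂ k (fun c d => ρ c • φ (ρ d • x))
    (fun c c' d => by rw [map_add, add_smul]) (fun e c d => by rw [map_smul, smul_assoc])
    (fun c d d' => by rw [map_add, add_smul, map_add, smul_add])
    (fun e c d => by rw [map_smul ρ, smul_assoc, map_smul φ, smul_comm])) b
  simp only [LinearMap.mk₂_apply, map_mul, mul_smul] at this
  exact this.symm

/-- A commuting action passes through every x_i and y_i. Hence the left trace of a right linear map
is a bimodule map. -/
theorem trace_isLinearOver_of_commute (hc : ∀ a b, Commute (ρ a) (ρ' b)) {φ : X →ₗ[k] Y}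
    (hφ : IsLinearOver ρ' φ) : IsLinearOver ρ' (trace ρ D φ) := fun b x => by
  rw [trace_apply, trace_apply, Finset.smul_sum]
  refine Finset.sum_congr rfl fun i _ => ?_
  rw [smul_smul, (hc _ _).eq, ← smul_smul, hφ, smul_smul, (hc _ _).eq, ← smul_smul]

variable {ρ}

theorem comp_trace {f : Y →ₗ[k] Z} (hf : IsLinearOver ρ f) (φ : X →ₗ[k] Y) :
    f ∘ₗ trace ρ D φ = trace ρ D (f ∘ₗ φ) := LinearMap.ext fun x => by
  simp only [LinearMap.comp_apply, trace_apply, map_sum, hf _ _]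

theorem trace_comp {f : X →ₗ[k] Y} (hf : IsLinearOver ρ f) (φ : Y →ₗ[k] Z) :
    trace ρ D φ ∘ₗ f = trace ρ D (φ ∘ₗ f) := LinearMap.ext fun x => by
  simp only [LinearMap.comp_apply, trace_apply, hf _ _]

/-- Over a field, a section of d onto its range extends to the whole target. -/
theorem exists_pseudoinverse {V W : Type*} [AddCommGroup V] [Module k V] [AddCommGroup W]
    [Module k W] (d : V →ₗ[k] W) : ∃ d' : W →ₗ[k] V, ∀ v, d (d' (d v)) = d v := by
  obtain ⟨g, hg⟩ := d.rangeRestrict.exists_rightInverse_of_surjective d.range_rangeRestrict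
  obtain ⟨d', hd'⟩ := g.exists_extend
  refine ⟨d', fun v => ?_⟩
  have h1 : d' (d v) = g (d.rangeRestrict v) := LinearMap.congr_fun hd' (d.rangeRestrict v)
  rw [h1]
  exact congrArg Subtype.val (LinearMap.congr_fun hg (d.rangeRestrict v))

/-- Bimodules whose identity is a trace; such bimodules are both projective and injective for
maps linear over `R` (Higman's criterion). -/
theorem exists_lift_of_trace {θ : P →ₗ[k] P} (hθ : trace ρ D θ = LinearMap.id)
    {e : P →ₗ[k] Y} (he : IsLinearOver ρ e) {d : X →ₗ[k] Y} (hd : IsLinearOver ρ d)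
    (h : ∀ p, ∃ x, d x = e p) : ∃ l : P →ₗ[k] X, IsLinearOver ρ l ∧ d ∘ₗ l = e := by
  obtain ⟨d', hd'⟩ := exists_pseudoinverse d
  -- A k-linear lift is averaged. As e lands in the image of d, d d' e = e, and therefore d Tr(d' e
  -- θ) = Tr(e θ) = e Tr(θ) = e.
  refine ⟨trace ρ D (d' ∘ₗ e ∘ₗ θ), trace_isLinearOver _ _ _, ?_⟩
  have : d ∘ₗ d' ∘ₗ e ∘ₗ θ = e ∘ₗ θ := LinearMap.ext fun p => by
    obtain ⟨x, hx⟩ := h (θ p)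
    simp only [LinearMap.comp_apply, ← hx, hd']
  rw [comp_trace D hd, this, ← comp_trace D he, hθ, LinearMap.comp_id]

/-- Dual averaging: e vanishes on ker d, so e d' d = e, and Tr(θ e d') d = Tr(θ e) = Tr(θ) e = e. -/
theorem exists_extension_of_trace {θ : P →ₗ[k] P} (hθ : trace ρ D θ = LinearMap.id)
    {e : X →ₗ[k] P} (he : IsLinearOver ρ e) {d : X →ₗ[k] Y} (hd : IsLinearOver ρ d)
    (h : ∀ x, d x = 0 → e x = 0) : ∃ l : Y →ₗ[k] P, IsLinearOver ρ l ∧ l ∘ₗ d = e := by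
  obtain ⟨d', hd'⟩ := exists_pseudoinverse d
  refine ⟨trace ρ D (θ ∘ₗ e ∘ₗ d'), trace_isLinearOver _ _ _, ?_⟩
  have : (θ ∘ₗ e ∘ₗ d') ∘ₗ d = θ ∘ₗ e := LinearMap.ext fun x => by
    simp only [LinearMap.comp_apply]
    congr 1
    rw [← sub_eq_zero, ← map_sub]
    exact h _ (by rw [map_sub, hd', sub_self])
  rw [trace_comp D hd, this, ← trace_comp D he, hθ, LinearMap.id_comp]

/-- The identity is the `R`-trace of an `R'`-linear map. -/
def IsTraceIdentity (ρ : R →ₐ[k] Env k A) (ρ' : R' →ₐ[k] Env k A) (D : DualBases k R)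
    (θ : P →ₗ[k] P) : Prop :=
  IsLinearOver ρ' θ ∧ trace ρ D θ = LinearMap.id

/-- On a free module θ acts coordinatewise. A projective module is a retract of a free one by
bimodule maps π and σ, and Tr(π θ σ) = π Tr(θ) σ. -/
theorem exists_isTraceIdentity_of_projective [Module.Projective (Env k A) P]
    {θ : Env k A →ₗ[k] Env k A} (hθ : IsTraceIdentity ρ ρ' D θ) :
    ∃ θ' : P →ₗ[k] P, IsTraceIdentity ρ ρ' D θ' := by
  obtain ⟨σ, hσ⟩ := Module.projective_def'.1 ‹Module.Projective (Env k A) P›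
  set π : (P →₀ Env k A) →ₗ[Env k A] P := Finsupp.linearCombination (Env k A) id
  have hm : IsTraceIdentity ρ ρ' D (P := P →₀ Env k A) (Finsupp.mapRange.linearMap θ) := by
    constructor
    · intro b x
      ext p
      exact hθ.1 b (x p)
    · refine LinearMap.ext fun x => Finsupp.ext fun p => ?_
      rw [trace_apply, Finsupp.finsetSum_apply]
      have := LinearMap.congr_fun hθ.2 (x p)
      rwa [trace_apply] at this
  refine ⟨π.restrictScalars k ∘ₗ Finsupp.mapRange.linearMap θ ∘ₗ σ.restrictScalars k,
    (isLinearOver_restrictScalars π).comp (hm.1.comp (isLinearOver_restrictScalars σ)), ?_⟩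
  rw [← comp_trace D (isLinearOver_restrictScalars π),
    ← trace_comp D (isLinearOver_restrictScalars σ), hm.2, LinearMap.id_comp]
  exact LinearMap.ext fun x => LinearMap.congr_fun hσ x

end Trace

/-! ### The left and right actions -/

section Actions

variable (k A : Type*) [Field k] [Ring A] [Algebra k A]

/-- The left action of `A` on bimodules. -/
def leftHom : A →ₐ[k] Env k A :=
  (Algebra.TensorProduct.includeLeft : A →ₐ[k] A ⊗[k] Aᵐᵒᵖ)

/-- The right action of `A` on bimodules. -/
def rightHom : Aᵐᵒᵖ →ₐ[k] Env k A :=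
  (Algebra.TensorProduct.includeRight : Aᵐᵒᵖ →ₐ[k] A ⊗[k] Aᵐᵒᵖ)

variable {k A}

theorem leftHom_apply (a : A) : leftHom k A a = env k a 1 := rfl

theorem rightHom_op (a : A) : rightHom k A (MulOpposite.op a) = env k 1 a := rfl

theorem rightHom_apply (a : Aᵐᵒᵖ) : rightHom k A a = env k 1 a.unop := rfl

theorem commute_left_right (a : A) (b : Aᵐᵒᵖ) : Commute (leftHom k A a) (rightHom k A b) := by
  rw [leftHom_apply, rightHom_apply, Commute, SemiconjBy, env_mul, env_mul]
  simp

/-- Take θ(a ⊗ b) = form(a) 1 ⊗ b, which is right linear. Its left trace Σ form(y_i a) x_i ⊗ b is a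
⊗ b. -/
theorem exists_left_env (D : DualBases k A) :
    ∃ θ : Env k A →ₗ[k] Env k A, IsTraceIdentity (leftHom k A) (rightHom k A) D θ := by
  let θ : Env k A →ₗ[k] Env k A := (TensorProduct.map
    (LinearMap.toSpanSingleton k A 1 ∘ₗ D.form) LinearMap.id : A ⊗[k] Aᵐᵒᵖ →ₗ[k] A ⊗[k] Aᵐᵒᵖ)
  have hθ : ∀ a b : A, θ (env k a b) = D.form a • env k 1 b := fun a b => by
    exact (TensorProduct.map_tmul _ _ _ _).trans (TensorProduct.smul_tmul' _ _ _).symm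
  refine ⟨θ, fun b x => ?_, LinearMap.ext fun x => ?_⟩
  · induction x using env_induction with
    | zero => simp
    | tmul c d =>
      simp only [rightHom_apply, smul_eq_mul, env_mul, hθ, one_mul, mul_smul_comm]
    | add e f he hf => rw [smul_add, map_add, he, hf, map_add, smul_add]
  · induction x using env_induction with
    | zero => simp
    | tmul c d =>
      conv_rhs => rw [LinearMap.id_apply, ← D.left c]
      rw [trace_apply]
      have : ∀ s : Finset (Fin D.n), env k (∑ i ∈ s, D.form (D.y i * c) • D.x i) d =
          ∑ i ∈ s, D.form (D.y i * c) • env k (D.x i) d := fun s => by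
        simp only [← env_smul_left]
        exact TensorProduct.sum_tmul _ _ _
      rw [this]
      refine Finset.sum_congr rfl fun i _ => ?_
      simp only [leftHom_apply, smul_eq_mul, env_mul, hθ, mul_one, mul_smul_comm]
    | add e f he hf => rw [map_add, he, hf, map_add]

theorem exists_right_env (D : DualBases k A) :
    ∃ θ : Env k A →ₗ[k] Env k A, IsTraceIdentity (rightHom k A) (leftHom k A) D.op θ := by
  let θ : Env k A →ₗ[k] Env k A := (TensorProduct.map LinearMap.id
    (LinearMap.toSpanSingleton k Aᵐᵒᵖ 1 ∘ₗ D.op.form) : A ⊗[k] Aᵐᵒᵖ →ₗ[k] A ⊗[k] Aᵐᵒᵖ)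
  have hθ : ∀ a b : A, θ (env k a b) = D.form b • env k a 1 := fun a b => by
    exact (TensorProduct.map_tmul _ _ _ _).trans
      (TensorProduct.tmul_smul (D.form b) a (1 : Aᵐᵒᵖ))
  refine ⟨θ, fun b x => ?_, LinearMap.ext fun x => ?_⟩
  · induction x using env_induction with
    | zero => simp
    | tmul c d =>
      simp only [leftHom_apply, smul_eq_mul, env_mul, hθ, mul_one, mul_smul_comm]
    | add e f he hf => rw [smul_add, map_add, he, hf, map_add, smul_add]
  · induction x using env_induction with
    | zero => simp
    | tmul c d =>
      conv_rhs => rw [LinearMap.id_apply, ← D.right d]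
      rw [trace_apply]
      have : ∀ s : Finset (Fin D.n), env k c (∑ i ∈ s, D.form (d * D.x i) • D.y i) =
          ∑ i ∈ s, D.form (d * D.x i) • env k c (D.y i) := fun s => by
        simp only [← env_smul_right]
        exact map_sum (TensorProduct.mk k A Aᵐᵒᵖ c ∘ₗ (MulOpposite.opLinearEquiv k).toLinearMap) _ s
      rw [this]
      refine Finset.sum_congr rfl fun i _ => ?_
      change rightHom k A (MulOpposite.op (D.y i)) •
        θ (rightHom k A (MulOpposite.op (D.x i)) • env k c d) = _
      simp only [rightHom_op, smul_eq_mul, env_mul, hθ, one_mul, mul_smul_comm]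
    | add e f he hf => rw [map_add, he, hf, map_add]

/-- Here θ(a) = form(a) 1. It is not linear for the right action in general, so A is only handled
one side at a time. -/
theorem exists_left_regular (D : DualBases k A) :
    ∃ θ : A →ₗ[k] A, trace (leftHom k A) D θ = LinearMap.id := by
  refine ⟨LinearMap.toSpanSingleton k A 1 ∘ₗ D.form, LinearMap.ext fun a => ?_⟩
  rw [trace_apply]
  simpa [leftHom_apply, env_smul_self] using D.left a

theorem exists_right_regular (D : DualBases k A) :
    ∃ θ : A →ₗ[k] A, trace (rightHom k A) D.op θ = LinearMap.id := by
  refine ⟨LinearMap.toSpanSingleton k A 1 ∘ₗ D.form, LinearMap.ext fun a => ?_⟩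
  refine Eq.trans ?_ (D.right a)
  rw [trace_apply]
  refine Finset.sum_congr rfl fun i _ => ?_
  simp [DualBases.op, rightHom_apply, env_smul_self]

end Actions

/-! ### One-sided contractions -/

section Contraction

variable {k A R : Type*} [Field k] [Ring A] [Algebra k A] [Ring R] [Algebra k R]

/-- A complex augmented by `η : C_0 → N` is contractible, over `R`, in non-negative degrees. -/
structure HasContraction (ρ : R →ₐ[k] Env k A) (C : BimodComplex.{w} k A) {N : Type*}
    [AddCommGroup N] [Module k N] [Module (Env k A) N] [IsScalarTower k (Env k A) N]
    (η : C.X 0 →ₗ[Env k A] N) : Prop where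
  aug : ∃ (σ : N →ₗ[k] C.X 0) (τ : C.X 0 →ₗ[k] C.X 1), IsLinearOver ρ σ ∧ IsLinearOver ρ τ ∧
    (∀ n, η (σ n) = n) ∧ ∀ x, σ (η x) + C.d 1 0 (zero_add 1) (τ x) = x
  pos : ∀ (l j i : ℤ) (hjl : l + 1 = j) (hij : j + 1 = i),
    ∃ (σ : C.X l →ₗ[k] C.X j) (τ : C.X j →ₗ[k] C.X i), IsLinearOver ρ σ ∧ IsLinearOver ρ τ ∧
      ∀ x, σ (C.d j l hjl x) + C.d i j hij (τ x) = x

variable (T : CompleteResolution.{w} k A)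

/-- Relative projectivity and injectivity over R give, starting from a section of ε, an R-linear s
with d s d = d for every differential: by lifting in positive degrees and by extension in negative
ones. -/
theorem CompleteResolution.hasContraction {ρ : R →ₐ[k] Env k A} (D : DualBases k R)
    (hT : ∀ i, ∃ θ : T.X i →ₗ[k] T.X i, trace ρ D θ = LinearMap.id)
    (hA : ∃ θ : A →ₗ[k] A, trace ρ D θ = LinearMap.id) :
    HasContraction ρ T.toBimodComplex T.aug := by
  have hlin : ∀ i j (h : j + 1 = i), IsLinearOver ρ ((T.d i j h).restrictScalars k) :=
    fun i j h => isLinearOver_restrictScalars _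
  have haug : ∃ (σ : A →ₗ[k] T.X 0) (τ : T.X 0 →ₗ[k] T.X 1), IsLinearOver ρ σ ∧
      IsLinearOver ρ τ ∧ (∀ n, T.aug (σ n) = n) ∧
      ∀ x, σ (T.aug x) + T.d 1 0 (zero_add 1) (τ x) = x := by
    obtain ⟨θA, hθA⟩ := hA
    obtain ⟨θ, hθ⟩ := hT 0
    have hl : IsLinearOver ρ (T.aug.restrictScalars k) := isLinearOver_restrictScalars _
    obtain ⟨σ, hσ, hσ'⟩ := exists_lift_of_trace D hθA (e := LinearMap.id) IsLinearOver.id hl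
      T.aug_surjective
    have hσ'' : ∀ n, T.aug (σ n) = n := LinearMap.congr_fun hσ'
    obtain ⟨τ, hτ, hτ'⟩ := exists_lift_of_trace D hθ
      (e := LinearMap.id - σ ∘ₗ T.aug.restrictScalars k) (IsLinearOver.id.sub (hσ.comp hl))
      (hlin 1 0 (zero_add 1)) (fun p => (T.aug_exact _).1 (by simp [hσ'']))
    refine ⟨σ, τ, hσ, hτ, hσ'', fun x => ?_⟩
    have : T.d 1 0 (zero_add 1) (τ x) = x - σ (T.aug x) := LinearMap.congr_fun hτ' x
    rw [this]; abel
  have key : ∀ i : ℤ, ∀ j (h : i + 1 = j), ∃ s : T.X i →ₗ[k] T.X j, IsLinearOver ρ s ∧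
      ∀ x, T.d j i h (s (T.d j i h x)) = T.d j i h x := by
    intro i
    induction i using Int.induction_on with
    | zero =>
      rintro j h
      obtain rfl : j = 1 := by omega
      obtain ⟨σ, τ, hσ, hτ, -, h2⟩ := haug
      refine ⟨τ, hτ, fun x => ?_⟩
      have := h2 (T.d 1 0 h x)
      rwa [T.aug_exact.apply_apply_eq_zero, map_zero, zero_add] at this
    -- The map 1 - s d lands in cycles, that is in the image of the next differential, and lifts
    -- through it.
    | succ i ih =>
      rintro j h
      obtain ⟨s, hs, hs'⟩ := ih _ rfl
      obtain ⟨θ, hθ⟩ := hT ((i : ℤ) + 1)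
      obtain ⟨τ, hτ, hτ'⟩ := exists_lift_of_trace D hθ
        (e := LinearMap.id - s ∘ₗ (T.d _ _ rfl).restrictScalars k)
        (IsLinearOver.id.sub (hs.comp (hlin _ _ _)))
        (hlin j _ h) (fun p => (T.exact _ _ _ h rfl _).1 (by simp [hs']))
      refine ⟨τ, hτ, fun x => ?_⟩
      have := LinearMap.congr_fun hτ' (T.d j _ h x)
      simpa [(T.exact _ _ _ h rfl).apply_apply_eq_zero] using this
    -- The map 1 - d s kills boundaries, that is the kernel of the next differential down, and
    -- therefore extends along that differential.
    | pred i ih =>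
      rintro j h
      obtain rfl : j = -(i : ℤ) := by omega
      obtain ⟨s, hs, hs'⟩ := ih _ rfl
      obtain ⟨θ, hθ⟩ := hT (-(i : ℤ))
      obtain ⟨τ, hτ, hτ'⟩ := exists_extension_of_trace D hθ
        (e := LinearMap.id - (T.d _ _ rfl).restrictScalars k ∘ₗ s)
        (IsLinearOver.id.sub ((hlin _ _ _).comp hs))
        (hlin _ _ h) (fun p hp => by
          obtain ⟨q, rfl⟩ := (T.exact _ _ _ rfl h _).1 hp
          simp [hs'])
      refine ⟨τ, hτ, fun x => ?_⟩
      have h1 : τ (T.d _ _ h x) = x - T.d _ _ rfl (s x) := LinearMap.congr_fun hτ' x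
      rw [h1, map_sub, (T.exact _ _ _ rfl h).apply_apply_eq_zero, sub_zero]
  refine ⟨haug, fun l j i hjl hij => ?_⟩
  obtain ⟨s, hs, hs'⟩ := key l j hjl
  obtain ⟨t, ht, ht'⟩ := key j i hij
  -- The element x - s d x is a cycle, hence a boundary, and d t is the identity on boundaries.
  refine ⟨s, t ∘ₗ (LinearMap.id - s ∘ₗ (T.d j l hjl).restrictScalars k), hs,
    ht.comp (IsLinearOver.id.sub (hs.comp (hlin _ _ _))), fun x => ?_⟩
  obtain ⟨y, hy⟩ := (T.exact _ _ _ hij hjl (x - s (T.d j l hjl x))).1 (by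
    rw [map_sub, hs', sub_self])
  have : T.d i j hij (t (x - s (T.d j l hjl x))) = x - s (T.d j l hjl x) := by
    rw [← hy, ht']
  change s _ + T.d i j hij (t (x - s (T.d j l hjl x))) = x
  rw [this]
  abel

variable {T}

theorem CompleteResolution.exists_left_trace (T : CompleteResolution.{w} k A) (D : DualBases k A)
    (i : ℤ) : ∃ θ : T.X i →ₗ[k] T.X i, IsTraceIdentity (leftHom k A) (rightHom k A) D θ := by
  have := T.projective i
  obtain ⟨θ, hθ⟩ := exists_left_env D
  exact exists_isTraceIdentity_of_projective D hθ

theorem CompleteResolution.exists_right_trace (T : CompleteResolution.{w} k A) (D : DualBases k A)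
    (i : ℤ) : ∃ θ : T.X i →ₗ[k] T.X i, IsTraceIdentity (rightHom k A) (leftHom k A) D.op θ := by
  have := T.projective i
  obtain ⟨θ, hθ⟩ := exists_right_env D
  exact exists_isTraceIdentity_of_projective D.op hθ

theorem CompleteResolution.hasContraction_left (T : CompleteResolution.{w} k A)
    (D : DualBases k A) : HasContraction (leftHom k A) T.toBimodComplex T.aug :=
  T.hasContraction D (fun i => (T.exists_left_trace D i).imp fun _ h => h.2)
    (exists_left_regular D)

theorem CompleteResolution.hasContraction_right (T : CompleteResolution.{w} k A)
    (D : DualBases k A) : HasContraction (rightHom k A) T.toBimodComplex T.aug :=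
  T.hasContraction D.op (fun i => (T.exists_right_trace D i).imp fun _ h => h.2)
    (exists_right_regular D)

end Contraction

/-! ### Tensor products with one-sided maps -/

section OneSided

variable {k A : Type*} [Field k] [Ring A] [Algebra k A]
variable {X X' X'' Y N M M' M'' : Type*}
  [AddCommGroup X] [Module k X] [Module (Env k A) X] [IsScalarTower k (Env k A) X]
  [AddCommGroup X'] [Module k X'] [Module (Env k A) X'] [IsScalarTower k (Env k A) X']
  [AddCommGroup X''] [Module k X''] [Module (Env k A) X''] [IsScalarTower k (Env k A) X'']
  [AddCommGroup Y] [Module k Y] [Module (Env k A) Y] [IsScalarTower k (Env k A) Y]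
  [AddCommGroup N] [Module k N] [Module (Env k A) N] [IsScalarTower k (Env k A) N]
  [AddCommGroup M] [Module k M] [Module (Env k A) M] [IsScalarTower k (Env k A) M]
  [AddCommGroup M'] [Module k M'] [Module (Env k A) M'] [IsScalarTower k (Env k A) M']
  [AddCommGroup M''] [Module k M''] [Module (Env k A) M''] [IsScalarTower k (Env k A) M'']

theorem IsLinearOver.env_left {φ : X →ₗ[k] Y} (h : IsLinearOver (leftHom k A) φ) (a : A) (x : X) :
    φ (env k a 1 • x) = env k a 1 • φ x := h a x

theorem IsLinearOver.env_right {φ : X →ₗ[k] Y} (h : IsLinearOver (rightHom k A) φ) (a : A)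
    (x : X) : φ (env k 1 a • x) = env k 1 a • φ x := h (MulOpposite.op a) x

theorem env_eq_mul (a b : A) : env k a b = env k a 1 * env k 1 b := by
  rw [env_mul, mul_one, mul_one]

theorem env_eq_mul' (a b : A) : env k a b = env k 1 b * env k a 1 := by
  rw [env_mul, one_mul, one_mul]

/-- The map `φ ⊗_A 1` for a right linear map `φ`. -/
def BTensor.rmap (N : Type*) [AddCommGroup N] [Module k N] [Module (Env k A) N]
    [IsScalarTower k (Env k A) N] (φ : X →ₗ[k] Y) (h : IsLinearOver (rightHom k A) φ) :
    BTensor k A X N →ₗ[k] BTensor k A Y N :=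
  BTensor.lift (BTensor.mkₗ ∘ₗ φ) (fun m a n => by
    simp only [LinearMap.comp_apply, BTensor.mkₗ_apply, h.env_right, BTensor.mk_balanced])

@[simp] theorem BTensor.rmap_mk (φ : X →ₗ[k] Y) (h : IsLinearOver (rightHom k A) φ) (x : X)
    (n : N) : BTensor.rmap N φ h (BTensor.mk k A x n) = BTensor.mk k A (φ x) n :=
  BTensor.lift_mk _ _ _ _

theorem BTensor.rmap_isLinearOver (φ : X →ₗ[k] Y) (h : IsLinearOver (rightHom k A) φ) :
    IsLinearOver (rightHom k A) (BTensor.rmap N φ h) := fun b x => by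
  refine LinearMap.congr_fun (BTensor.hom_ext
    (f := BTensor.rmap N φ h ∘ₗ Algebra.lsmul k k _ (rightHom k A b))
    (g := Algebra.lsmul k k _ (rightHom k A b) ∘ₗ BTensor.rmap N φ h) (fun m n => ?_)) x
  simp [rightHom_apply, BTensor.env_smul_mk, env_one]

/-- Right linearity of θ makes θ ⊗ 1 well defined, and the left trace touches only the first factor.
No condition on N is needed. -/
theorem IsTraceIdentity.rmap {D : DualBases k A} {θ : X →ₗ[k] X}
    (h : IsTraceIdentity (leftHom k A) (rightHom k A) D θ) :
    IsTraceIdentity (leftHom k A) (rightHom k A) D (BTensor.rmap N θ h.1) := by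
  refine ⟨BTensor.rmap_isLinearOver _ _, BTensor.hom_ext fun x n => ?_⟩
  have := LinearMap.congr_fun h.2 x
  rw [trace_apply, LinearMap.id_apply] at this
  conv_rhs => rw [LinearMap.id_apply, ← this, ← BTensor.mkₗ_apply, map_sum, LinearMap.sum_apply]
  rw [trace_apply]
  simp [leftHom_apply, BTensor.env_smul_mk, env_one]

/-- Right linear splittings can be tensored with N over A. Only the section of the augmentation
changes: it becomes n ↦ σ(1) ⊗ n. -/
theorem HasContraction.tensorRight {T : CompleteResolution.{w} k A}
    (h : HasContraction (rightHom k A) T.toBimodComplex T.aug) :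
    HasContraction (rightHom k A) (T.tensorRight N) (augRight T N) where
  aug := by
    obtain ⟨σ, τ, hσ, hτ, h1, h2⟩ := h.aug
    refine ⟨BTensor.mkₗ (σ 1), BTensor.rmap N τ hτ, fun b n => ?_,
      BTensor.rmap_isLinearOver _ _, fun n => ?_, fun x => ?_⟩
    · simp [rightHom_apply, BTensor.env_smul_mk, env_one]
    · simp [augRight, h1, env_one]
    · refine LinearMap.congr_fun (BTensor.hom_ext
        (f := BTensor.mkₗ (σ 1) ∘ₗ (augRight T N).restrictScalars k +
          (BTensor.map (T.d 1 0 (zero_add 1)) LinearMap.id).restrictScalars k ∘ₗ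
            BTensor.rmap N τ hτ) (g := LinearMap.id) (fun x n => ?_)) x
      -- By right linearity σ(ε x) = σ(1) ε(x), and ε(x) crosses the tensor sign.
      have e : BTensor.mk k A (σ 1) (env k (T.aug x) 1 • n) =
          BTensor.mk k A (σ (T.aug x)) n := by
        rw [← BTensor.mk_balanced, ← hσ.env_right, env_smul_self, one_mul, one_mul]
      simp [augRight, e, ← BTensor.add_mk, h2]
  pos l j i hjl hij := by
    obtain ⟨σ, τ, hσ, hτ, h1⟩ := h.pos l j i hjl hij
    refine ⟨BTensor.rmap N σ hσ, BTensor.rmap N τ hτ, BTensor.rmap_isLinearOver _ _,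
      BTensor.rmap_isLinearOver _ _, fun x => ?_⟩
    refine LinearMap.congr_fun (BTensor.hom_ext
      (f := BTensor.rmap N σ hσ ∘ₗ
          (BTensor.map (T.d j l hjl) (LinearMap.id (M := N))).restrictScalars k +
        (BTensor.map (T.d i j hij) LinearMap.id).restrictScalars k ∘ₗ BTensor.rmap N τ hτ)
      (g := LinearMap.id) (fun x n => ?_)) x
    simp [← BTensor.add_mk, h1]

/-- Extension of bimodule maps into relatively injective bimodules. -/
theorem exists_comp_eq_of_isTraceIdentity {D : DualBases k A} {θ : Y →ₗ[k] Y}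
    (hθ : IsTraceIdentity (leftHom k A) (rightHom k A) D θ) {d' : X' →ₗ[Env k A] X}
    {d : X →ₗ[Env k A] X''} {σ : X'' →ₗ[k] X} {τ : X →ₗ[k] X'}
    (hσ : IsLinearOver (rightHom k A) σ) (h : ∀ x, σ (d x) + d' (τ x) = x)
    (f : X →ₗ[Env k A] Y) (hf : f ∘ₗ d' = 0) : ∃ g : X'' →ₗ[Env k A] Y, g ∘ₗ d = f := by
  have hr : IsLinearOver (rightHom k A) (θ ∘ₗ f.restrictScalars k ∘ₗ σ) :=
    hθ.1.comp ((isLinearOver_restrictScalars f).comp hσ)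
  have h1 := trace_isLinearOver (leftHom k A) D (θ ∘ₗ f.restrictScalars k ∘ₗ σ)
  have h2 := trace_isLinearOver_of_commute (leftHom k A) D commute_left_right hr
  -- The extension is the left trace of θ f σ. It is left linear as a trace and right linear because
  -- θ, f and σ are. Since f kills the image of d', f σ d = f, so composing with d gives Tr(θ) f =
  -- f.
  refine ⟨bimoduleHom (trace (leftHom k A) D (θ ∘ₗ f.restrictScalars k ∘ₗ σ)) (fun a b x => by
    rw [env_eq_mul, mul_smul, mul_smul, h1.env_left, h2.env_right]), LinearMap.ext fun x => ?_⟩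
  have h3 : (θ ∘ₗ f.restrictScalars k ∘ₗ σ) ∘ₗ d.restrictScalars k =
      θ ∘ₗ f.restrictScalars k := LinearMap.ext fun x => by
    have e1 : f (d' (τ x)) = 0 := LinearMap.congr_fun hf (τ x)
    have e2 := congrArg f (h x)
    rw [map_add, e1, add_zero] at e2
    simp [e2]
  have h4 := trace_comp (ρ := leftHom k A) D (isLinearOver_restrictScalars d) (θ ∘ₗ f.restrictScalars k ∘ₗ σ)
  rw [h3, ← trace_comp D (isLinearOver_restrictScalars f), hθ.2] at h4
  exact LinearMap.congr_fun h4 x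

/-- The map `x ⊗ m ↦ ∑ φ(x xᵢ) ⊗ ψ(yᵢ m)` on `X ⊗_{Aᵉ} M`, for `φ` left linear and `ψ` right
linear. -/
def ETensor.traceMap (D : DualBases k A) (φ : X →ₗ[k] X') (hφ : IsLinearOver (leftHom k A) φ)
    (ψ : M →ₗ[k] M') (hψ : IsLinearOver (rightHom k A) ψ) :
    ETensor k A X M →ₗ[k] ETensor k A X' M' :=
  ETensor.lift (∑ i, ETensor.mkₗ.compl₁₂ (φ ∘ₗ Algebra.lsmul k k X (env k 1 (D.x i)))
      (ψ ∘ₗ Algebra.lsmul k k M (env k (D.y i) 1))) (fun x a b m => by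
    simp only [LinearMap.sum_apply, LinearMap.compl₁₂_apply, LinearMap.comp_apply,
      Algebra.lsmul_coe, ETensor.mkₗ_apply, smul_smul, env_mul, mul_one, one_mul]
    -- The Casimir identity moves a from x to m. The factor b moves by left linearity of φ,
    -- balancing of the tensor sign and right linearity of ψ.
    have := D.casimir (P := ETensor k A X' M') (LinearMap.mk₂ k
      (fun c d => ETensor.mk k A (φ (env k b c • x)) (ψ (env k d 1 • m)))
      (fun c c' d => by rw [env_add_right, add_smul, map_add, ETensor.add_mk])
      (fun e c d => by rw [env_smul_right, smul_assoc, map_smul φ, ETensor.smul_mk])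
      (fun c d d' => by rw [env_add_left, add_smul, map_add, ETensor.mk_add])
      (fun e c d => by rw [env_smul_left, smul_assoc, map_smul ψ, ETensor.mk_smul])) a
    simp only [LinearMap.mk₂_apply] at this
    rw [this]
    refine Finset.sum_congr rfl fun i _ => ?_
    rw [env_eq_mul, mul_smul, hφ.env_left, ETensor.mk_balanced, ← hψ.env_right, smul_smul,
      ← env_eq_mul'])

theorem ETensor.traceMap_mk (D : DualBases k A) (φ : X →ₗ[k] X')
    (hφ : IsLinearOver (leftHom k A) φ) (ψ : M →ₗ[k] M') (hψ : IsLinearOver (rightHom k A) ψ)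
    (x : X) (m : M) : ETensor.traceMap D φ hφ ψ hψ (ETensor.mk k A x m) =
      ∑ i, ETensor.mk k A (φ (env k 1 (D.x i) • x)) (ψ (env k (D.y i) 1 • m)) := by
  simp [ETensor.traceMap, LinearMap.sum_apply]

theorem ETensor.sum_mk_of_left {D : DualBases k A} {θ : M →ₗ[k] M}
    (hθ : IsTraceIdentity (leftHom k A) (rightHom k A) D θ) (x : X) (m : M) :
    ∑ i, ETensor.mk k A (env k 1 (D.x i) • x) (θ (env k (D.y i) 1 • m)) = ETensor.mk k A x m := by
  have := LinearMap.congr_fun hθ.2 m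
  rw [trace_apply, LinearMap.id_apply] at this
  conv_rhs => rw [← this, ← ETensor.mkₗ_apply, map_sum]
  refine Finset.sum_congr rfl fun i _ => ?_
  rw [ETensor.mk_balanced]
  rfl

theorem ETensor.sum_mk_of_right {D : DualBases k A} {θ : X →ₗ[k] X}
    (hθ : IsTraceIdentity (rightHom k A) (leftHom k A) D.op θ) (x : X) (m : M) :
    ∑ i, ETensor.mk k A (θ (env k 1 (D.x i) • x)) (env k (D.y i) 1 • m) = ETensor.mk k A x m := by
  have := LinearMap.congr_fun hθ.2 x
  rw [trace_apply, LinearMap.id_apply] at this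
  conv_rhs => rw [← this, ← ETensor.mkₗ_apply, map_sum, LinearMap.sum_apply]
  refine Finset.sum_congr rfl fun i _ => ?_
  rw [← ETensor.mk_balanced]
  rfl

/-- The trace maps built from σ and τ contract the complex tensored with M: σ d + d' τ = 1 leaves Σ
x x_i ⊗ θ(y_i m), which is x ⊗ Σ x_i θ(y_i m) = x ⊗ m. -/
theorem ETensor.exists_map_left_eq {D : DualBases k A} {θ : M →ₗ[k] M}
    (hθ : IsTraceIdentity (leftHom k A) (rightHom k A) D θ) {d' : X' →ₗ[Env k A] X}
    {d : X →ₗ[Env k A] X''} {σ : X'' →ₗ[k] X} {τ : X →ₗ[k] X'}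
    (hσ : IsLinearOver (leftHom k A) σ) (hτ : IsLinearOver (leftHom k A) τ)
    (h : ∀ x, σ (d x) + d' (τ x) = x) (z : ETensor k A X M)
    (hz : ETensor.map d LinearMap.id z = 0) : ∃ y, ETensor.map d' LinearMap.id y = z := by
  refine ⟨ETensor.traceMap D τ hτ θ hθ.1 z, ?_⟩
  have := LinearMap.congr_fun (ETensor.hom_ext
    (f := ETensor.traceMap D σ hσ θ hθ.1 ∘ₗ ETensor.map d LinearMap.id +
      ETensor.map d' LinearMap.id ∘ₗ ETensor.traceMap D τ hτ θ hθ.1) (g := LinearMap.id)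
    (fun x m => by
      simp only [LinearMap.add_apply, LinearMap.comp_apply, ETensor.map_mk, ETensor.traceMap_mk,
        map_sum, LinearMap.id_apply, ← map_smul, ← Finset.sum_add_distrib, ← ETensor.add_mk, h]
      exact ETensor.sum_mk_of_left hθ x m)) z
  simpa [hz] using this

/-- The mirror contraction: the splitting acts on the second factor and the trace identity is that
of X, so the y_i move left to give Σ θ(x x_i) y_i ⊗ m = x ⊗ m. -/
theorem ETensor.exists_map_right_eq {D : DualBases k A} {θ : X →ₗ[k] X}
    (hθ : IsTraceIdentity (rightHom k A) (leftHom k A) D.op θ) {d' : M' →ₗ[Env k A] M}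
    {d : M →ₗ[Env k A] M''} {σ : M'' →ₗ[k] M} {τ : M →ₗ[k] M'}
    (hσ : IsLinearOver (rightHom k A) σ) (hτ : IsLinearOver (rightHom k A) τ)
    (h : ∀ x, σ (d x) + d' (τ x) = x) (z : ETensor k A X M)
    (hz : ETensor.map LinearMap.id d z = 0) : ∃ y, ETensor.map LinearMap.id d' y = z := by
  refine ⟨ETensor.traceMap D θ hθ.1 τ hτ z, ?_⟩
  have := LinearMap.congr_fun (ETensor.hom_ext
    (f := ETensor.traceMap D θ hθ.1 σ hσ ∘ₗ ETensor.map LinearMap.id d +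
      ETensor.map LinearMap.id d' ∘ₗ ETensor.traceMap D θ hθ.1 τ hτ) (g := LinearMap.id)
    (fun x m => by
      simp only [LinearMap.add_apply, LinearMap.comp_apply, ETensor.map_mk, ETensor.traceMap_mk,
        map_sum, LinearMap.id_apply, ← map_smul, ← Finset.sum_add_distrib, ← ETensor.mk_add, h]
      exact ETensor.sum_mk_of_right hθ x m)) z
  simpa [hz] using this

theorem ETensor.map_id_surjective {f : M →ₗ[Env k A] M'} (hf : Function.Surjective f) :
    Function.Surjective (ETensor.map (LinearMap.id (M := X)) f) := by
  rw [← LinearMap.range_eq_top, eq_top_iff]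
  rintro z -
  obtain ⟨t, rfl⟩ := Submodule.mkQ_surjective _ z
  induction t using TensorProduct.induction_on with
  | zero => exact ⟨0, (map_zero _).trans (map_zero (eRel k A X M').mkQ).symm⟩
  | tmul x m =>
    obtain ⟨n, rfl⟩ := hf m
    exact ⟨ETensor.mk k A x n, ETensor.map_mk _ _ _ _⟩
  | add a b ha hb => exact (map_add (eRel k A X M').mkQ a b).symm ▸ Submodule.add_mem _ ha hb

end OneSided

/-! ### Solving equations in product total complexes -/

/-- The unknowns c_j satisfy a c_{j+1} + b c_j = w_j. If the equation at j holds, then w_{j+1} - b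
c_{j+1} is killed by a' and w_{j-1} - a c_j is killed by b', both because w is a cocycle. So c_{j+2}
exists by exactness of the a-direction when j ≥ 0, and c_{j-1} by exactness of the b-direction when
j ≤ 0. The pair u₀, u₁ starts both recursions. -/
theorem exists_total_primitive {U V W : ℤ → Type*} [∀ j, AddCommGroup (U j)]
    [∀ j, AddCommGroup (V j)] [∀ j, AddCommGroup (W j)]
    (a : ∀ j j' : ℤ, j + 1 = j' → U j' →+ V j) (b : ∀ j, U j →+ V j)
    (a' : ∀ j j' : ℤ, j + 1 = j' → V j' →+ W j) (b' : ∀ j, V j →+ W j)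
    (aa : ∀ j j' j'' h h' u, a' j j' h (a j' j'' h' u) = 0)
    (bb : ∀ j u, b' j (b j u) = 0)
    (ab : ∀ j j' h u, a' j j' h (b j' u) + b' j (a j j' h u) = 0)
    (up : ∀ j j' j'' h h', 0 ≤ j → ∀ v : V j', a' j j' h v = 0 → ∃ u, a j' j'' h' u = v)
    (down : ∀ j < 0, ∀ v : V j, b' j v = 0 → ∃ u, b j u = v)
    (w : ∀ j, V j) (hw : ∀ j j' h, a' j j' h (w j') + b' j (w j) = 0)
    (u₀ : U 0) (u₁ : U 1) (h₀ : a 0 1 (zero_add 1) u₁ + b 0 u₀ = w 0) :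
    ∃ c : ∀ j, U j, ∀ j j' h, a j j' h (c j') + b j (c j) = w j := by
  classical
  -- The value 0 only makes the recursion total; by `hP` a solution always exists along the
  -- sequence.
  let nxt (n : ℕ) (u : U n) : U (n + 1 : ℕ) :=
    if h : ∃ u', a n (n + 1 : ℕ) (by push_cast; rfl) u' + b n u = w n then h.choose else 0
  let P (n : ℕ) : U n := Nat.rec (motive := fun n : ℕ => U n) u₀ nxt n
  have hP : ∀ n : ℕ, a n (n + 1 : ℕ) (by push_cast; rfl) (P (n + 1)) + b n (P n) = w n := by
    intro n
    have hex : ∀ n : ℕ, (∃ u', a n (n + 1 : ℕ) (by push_cast; rfl) u' + b n (P n) = w n) →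
        a n (n + 1 : ℕ) (by push_cast; rfl) (P (n + 1)) + b n (P n) = w n := fun n hn => by
      change a n (n + 1 : ℕ) _ (nxt n (P n)) + b n (P n) = w n
      simp only [nxt, dif_pos hn]
      exact hn.choose_spec
    induction n with
    | zero => exact hex 0 ⟨u₁, h₀⟩
    | succ n ih =>
      obtain ⟨u, hu⟩ := up n (n + 1 : ℕ) (n + 1 + 1 : ℕ) (by push_cast; rfl) (by push_cast; rfl)
        (by omega) (w (n + 1 : ℕ) - b _ (P (n + 1))) (by
          have e1 := ab n (n + 1 : ℕ) (by push_cast; rfl) (P (n + 1))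
          have e2 := hw n (n + 1 : ℕ) (by push_cast; rfl)
          rw [← ih, map_add, bb, add_zero] at e2
          rw [map_sub, eq_neg_of_add_eq_zero_left e1, eq_neg_of_add_eq_zero_left e2, sub_self])
      exact hex _ ⟨u, by rw [hu, sub_add_cancel]⟩
  let prv (n : ℕ) (u : U (-(n : ℤ))) : U (-((n + 1 : ℕ) : ℤ)) :=
    if h : ∃ u', a _ (-(n : ℤ)) (by push_cast; ring) u + b (-((n + 1 : ℕ) : ℤ)) u' = w _
    then h.choose else 0
  let Q (n : ℕ) : U (-(n : ℤ)) := Nat.rec (motive := fun n : ℕ => U (-(n : ℤ))) u₀ prv n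
  have hQ : ∀ n : ℕ, a _ (-(n : ℤ)) (by push_cast; ring) (Q n) +
      b (-((n + 1 : ℕ) : ℤ)) (Q (n + 1)) = w _ := by
    intro n
    -- The step down only needs the equation at -n to be solvable with `Q n` in it. For n = 0 this
    -- is witnessed by u₁, which need not be the chosen `P 1`.
    have hprev : ∀ n : ℕ, (∃ j', ∃ h, ∃ u, a (-(n : ℤ)) j' h u + b _ (Q n) = w _) →
        a _ (-(n : ℤ)) (by push_cast; ring) (Q n) +
          b (-((n + 1 : ℕ) : ℤ)) (Q (n + 1)) = w _ := by
      rintro n ⟨j', h, u, hu⟩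
      obtain ⟨v, hv⟩ := down (-((n + 1 : ℕ) : ℤ)) (by push_cast; omega)
        (w _ - a _ (-(n : ℤ)) (by push_cast; ring) (Q n)) (by
          have e1 := ab (-((n + 1 : ℕ) : ℤ)) (-(n : ℤ)) (by push_cast; ring) (Q n)
          have e2 := hw (-((n + 1 : ℕ) : ℤ)) (-(n : ℤ)) (by push_cast; ring)
          rw [← hu, map_add, aa, zero_add] at e2
          rw [map_sub, eq_neg_of_add_eq_zero_right e1, eq_neg_of_add_eq_zero_right e2, sub_self])
      have hex : ∃ u', a _ (-(n : ℤ)) (by push_cast; ring) (Q n) +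
          b (-((n + 1 : ℕ) : ℤ)) u' = w _ := ⟨v, by rw [hv, add_sub_cancel]⟩
      change a _ (-(n : ℤ)) _ (Q n) + b _ (prv n (Q n)) = w _
      simp only [prv, dif_pos hex]
      exact hex.choose_spec
    induction n with
    | zero => exact hprev 0 ⟨1, by simp, u₁, h₀⟩
    | succ n ih => exact hprev _ ⟨_, _, _, ih⟩
  -- Both halves start at u₀, so the equation at j = -1 linking them is `hQ 0`.
  refine ⟨fun j => match j with
    | Int.ofNat n => P n
    | Int.negSucc n => Q (n + 1), fun j j' h => ?_⟩
  rcases j with n | n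
  · obtain rfl : j' = Int.ofNat (n + 1) := by rw [← h]; rfl
    exact hP n
  · rcases n with _ | n
    · obtain rfl : j' = Int.ofNat 0 := by rw [← h]; rfl
      exact hQ 0
    · obtain rfl : j' = Int.negSucc n := by rw [← h]; rfl
      exact hQ (n + 1)

/-! ### Primitives in the Hom complex and the complete tensor product. -/

section Primitives

variable {k A : Type*} [Field k] [Ring A] [Algebra k A]

theorem exists_comp_eq_of_projective {S P X Y : Type*} [Ring S] [AddCommGroup P] [Module S P]
    [Module.Projective S P] [AddCommGroup X] [Module S X] [AddCommGroup Y] [Module S Y]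
    (e : P →ₗ[S] Y) (d : X →ₗ[S] Y) (h : ∀ p, ∃ x, d x = e p) : ∃ l : P →ₗ[S] X, d ∘ₗ l = e := by
  obtain ⟨l, hl⟩ := Module.projective_lifting_property d.rangeRestrict
    (e.codRestrict (LinearMap.range d) h) d.surjective_rangeRestrict
  refine ⟨l, LinearMap.ext fun p => ?_⟩
  exact congrArg Subtype.val (LinearMap.congr_fun hl p)

/-- For fixed total degree, j determines the other degree i. A component is stored as a family over
this one-element index set, which replaces casts along degree equalities in the recursion. -/
theorem exists_pi_eq {ι : Type*} {P : ι → Prop} {F : ι → Type*} (i₀ : ι) (h₀ : P i₀)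
    (h : ∀ i, P i → i₀ = i) (x : F i₀) : ∃ f : ∀ i : {i // P i}, F i.1, f ⟨i₀, h₀⟩ = x :=
  ⟨fun i => (h i.1 i.2) ▸ x, rfl⟩

/-- The part `f ↦ d f` of the differential of the `Hom` complex. -/
def homStepTarget (T : BimodComplex.{w} k A) (C : BimodComplex.{w'} k A) (s t : ℤ) (h : s + 1 = t)
    (j j' : ℤ) (hj : j + 1 = j') :
    (∀ i : {i : ℤ // j' + s = i}, (T.X i.1 →ₗ[Env k A] C.X j')) →+
      (∀ i : {i : ℤ // j + t = i}, (T.X i.1 →ₗ[Env k A] C.X j)) where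
  toFun u i := C.d j' j hj ∘ₗ u ⟨i.1, by have := i.2; omega⟩
  map_zero' := funext fun ⟨i, hi⟩ => LinearMap.comp_zero _
  map_add' u v := funext fun ⟨i, hi⟩ => LinearMap.comp_add _ _ _

/-- The part `f ↦ -(-1)^s f d` of the differential of the `Hom` complex. -/
def homStepSource (T : BimodComplex.{w} k A) (C : BimodComplex.{w'} k A) (s t : ℤ) (h : s + 1 = t)
    (j : ℤ) :
    (∀ i : {i : ℤ // j + s = i}, (T.X i.1 →ₗ[Env k A] C.X j)) →+
      (∀ i : {i : ℤ // j + t = i}, (T.X i.1 →ₗ[Env k A] C.X j)) where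
  toFun u i := -(s.negOnePow • (u ⟨i.1 - 1, by have := i.2; omega⟩ ∘ₗ T.d i.1 (i.1 - 1) (sub_add_cancel _ _)))
  map_zero' := funext fun ⟨i, hi⟩ => by
    simp only [Pi.zero_apply, LinearMap.zero_comp, smul_zero, neg_zero]
  map_add' u v := funext fun ⟨i, hi⟩ => by
    simp only [Pi.add_apply, LinearMap.add_comp, smul_add, neg_add]

theorem homStepSource_apply (T : BimodComplex.{w} k A) (C : BimodComplex.{w'} k A) (s t : ℤ)
    (h : s + 1 = t) (j : ℤ) (u : ∀ i : {i : ℤ // j + s = i}, T.X i.1 →ₗ[Env k A] C.X j)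
    (i i' : ℤ) (hi : j + t = i) (hi' : i' + 1 = i) :
    homStepSource T C s t h j u ⟨i, hi⟩ =
      -(s.negOnePow • (u ⟨i', by omega⟩ ∘ₗ T.d i i' hi')) := by
  obtain rfl : i' = i - 1 := by omega
  rfl

/-- The part `1 ⊗ d` of the differential of the complete tensor product. -/
def tensorStepRight (T : BimodComplex.{w} k A) (C : BimodComplex.{w'} k A) (m n : ℤ)
    (h : n + 1 = m) (j j' : ℤ) (hj : j + 1 = j') :
    (∀ i : {i : ℤ // i + j' = m}, ETensor k A (T.X i.1) (C.X j')) →+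
      (∀ i : {i : ℤ // i + j = n}, ETensor k A (T.X i.1) (C.X j)) where
  toFun u i := i.1.negOnePow • ETensor.map LinearMap.id (C.d j' j hj) (u ⟨i.1, by have := i.2; omega⟩)
  map_zero' := funext fun ⟨i, hi⟩ => by
    rw [Pi.zero_apply, Pi.zero_apply, map_zero, smul_zero]
  map_add' u v := funext fun ⟨i, hi⟩ => by
    simp only [Pi.add_apply, map_add, smul_add]

/-- The part `d ⊗ 1` of the differential of the complete tensor product. -/
def tensorStepLeft (T : BimodComplex.{w} k A) (C : BimodComplex.{w'} k A) (m n : ℤ)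
    (h : n + 1 = m) (j : ℤ) :
    (∀ i : {i : ℤ // i + j = m}, ETensor k A (T.X i.1) (C.X j)) →+
      (∀ i : {i : ℤ // i + j = n}, ETensor k A (T.X i.1) (C.X j)) where
  toFun u i := ETensor.map (T.d (i.1 + 1) i.1 rfl) LinearMap.id (u ⟨i.1 + 1, by have := i.2; omega⟩)
  map_zero' := funext fun ⟨i, hi⟩ => map_zero _
  map_add' u v := funext fun ⟨i, hi⟩ => map_add _ _ _

theorem tensorStepLeft_apply (T : BimodComplex.{w} k A) (C : BimodComplex.{w'} k A) (m n : ℤ)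
    (h : n + 1 = m) (j : ℤ) (u : ∀ i : {i : ℤ // i + j = m}, ETensor k A (T.X i.1) (C.X j))
    (i i' : ℤ) (hi : i + j = n) (hi' : i + 1 = i') :
    tensorStepLeft T C m n h j u ⟨i, hi⟩ =
      ETensor.map (T.d i' i hi') LinearMap.id (u ⟨i', by omega⟩) := by
  subst hi'
  rfl

variable {T : CompleteResolution.{w} k A} {C : BimodComplex.{w'} k A}
variable {N : Type*} [AddCommGroup N] [Module k N] [Module (Env k A) N]
  [IsScalarTower k (Env k A) N] {η : C.X 0 →ₗ[Env k A] N} {D : DualBases k A}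

/-- A cocycle of the complex of maps from a complete resolution to an augmented complex is a
coboundary if its augmentation is. -/
theorem exists_homD_eq {R : Type*} [Ring R] [Algebra k R] {ρ : R →ₐ[k] Env k A}
    (hC : HasContraction ρ C η)
    (hT : HasContraction (rightHom k A) T.toBimodComplex T.aug)
    (hneg : ∀ j, ∃ θ : C.X j →ₗ[k] C.X j, IsTraceIdentity (leftHom k A) (rightHom k A) D θ)
    (s t t' : ℤ) (hs : s + 1 = t) (ht : t + 1 = t')
    (w : HomCochain T.toBimodComplex C t) (hw : homD T.toBimodComplex C t t' ht w = 0)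
    (y : T.X s →ₗ[Env k A] N) (hy : η ∘ₗ w.v t 0 (zero_add t) = coD T.toBimodComplex N s t hs y) :
    ∃ c, homD T.toBimodComplex C s t hs c = w := by
  have := T.projective
  obtain ⟨σ, τ, -, -, hσ, hτ⟩ := hC.aug
  -- The augmentation is used only here: with u₀ a lift of y along η, the map w_0 + (-1)^s u₀ d is
  -- killed by η, hence factors through d_1 as T_t is projective.
  obtain ⟨u₀, hu₀⟩ := exists_comp_eq_of_projective y η fun p => ⟨σ (y p), hσ _⟩
  obtain ⟨u₁, hu₁⟩ := exists_comp_eq_of_projective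
    (w.v t 0 (zero_add t) + s.negOnePow • (u₀ ∘ₗ T.d t s hs)) (C.d 1 0 (zero_add 1)) fun p => by
      have e : η ∘ₗ (w.v t 0 (zero_add t) + s.negOnePow • (u₀ ∘ₗ T.d t s hs)) = 0 := by
        rw [LinearMap.comp_add, hy, comp_units_smul, ← LinearMap.comp_assoc, hu₀, coD_apply,
          neg_add_cancel]
      have e' := LinearMap.congr_fun e p
      refine ⟨τ ((w.v t 0 (zero_add t) + s.negOnePow • (u₀ ∘ₗ T.d t s hs)) p), ?_⟩
      have e2 := hτ ((w.v t 0 (zero_add t) + s.negOnePow • (u₀ ∘ₗ T.d t s hs)) p)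
      rw [← LinearMap.comp_apply, e', LinearMap.zero_apply, map_zero, zero_add] at e2
      exact e2
  obtain ⟨u₀', hu₀'⟩ := exists_pi_eq (P := fun i => 0 + s = i)
    (F := fun i => T.X i →ₗ[Env k A] C.X 0) s (zero_add s) (by omega) u₀
  obtain ⟨u₁', hu₁'⟩ := exists_pi_eq (P := fun i => 1 + s = i)
    (F := fun i => T.X i →ₗ[Env k A] C.X 1) t (by omega) (by omega) u₁
  have sgn : t.negOnePow = -s.negOnePow := by rw [← hs, Int.negOnePow_succ]
  obtain ⟨c, hc⟩ := exists_total_primitive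
    (U := fun j => ∀ i : {i : ℤ // j + s = i}, (T.X i.1 →ₗ[Env k A] C.X j))
    (V := fun j => ∀ i : {i : ℤ // j + t = i}, (T.X i.1 →ₗ[Env k A] C.X j))
    (W := fun j => ∀ i : {i : ℤ // j + t' = i}, (T.X i.1 →ₗ[Env k A] C.X j))
    (homStepTarget T.toBimodComplex C s t hs) (homStepSource T.toBimodComplex C s t hs)
    (homStepTarget T.toBimodComplex C t t' ht) (homStepSource T.toBimodComplex C t t' ht)
    (fun j j' j'' h h' u => funext fun ⟨i, hi⟩ => by
      change C.d j' j h ∘ₗ C.d j'' j' h' ∘ₗ u ⟨i, _⟩ = 0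
      rw [← LinearMap.comp_assoc, C.d_comp_d, LinearMap.zero_comp])
    (fun j u => funext fun ⟨i, hi⟩ => by
      change -(t.negOnePow • ((-(s.negOnePow • (u ⟨i - 1 - 1, _⟩ ∘ₗ T.d (i - 1) (i - 1 - 1) _))) ∘ₗ
        T.d i (i - 1) _)) = 0
      rw [LinearMap.neg_comp, units_smul_comp, LinearMap.comp_assoc, T.d_comp_d,
        LinearMap.comp_zero, smul_zero, neg_zero, smul_zero, neg_zero])
    (fun j j' h u => funext fun ⟨i, hi⟩ => by
      change C.d j' j h ∘ₗ (-(s.negOnePow • (u ⟨i - 1, _⟩ ∘ₗ T.d i (i - 1) _))) +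
        -(t.negOnePow • ((C.d j' j h ∘ₗ u ⟨i - 1, _⟩) ∘ₗ T.d i (i - 1) _)) = 0
      rw [LinearMap.comp_neg, comp_units_smul, sgn, Units.neg_smul, LinearMap.comp_assoc,
        neg_neg, neg_add_cancel])
    (fun j j' j'' h h' hj v hv => by
      -- Upward: C is exact at C_{j'} and the terms of T are projective, so linearity of the
      -- splitting of C is irrelevant.
      obtain ⟨σ, τ, -, -, hσ⟩ := hC.pos j j' j'' h h'
      obtain ⟨u, hu⟩ := exists_comp_eq_of_projective (v ⟨j' + t, rfl⟩) (C.d j'' j' h') fun p => by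
        have e : C.d j' j h ∘ₗ v ⟨j' + t, rfl⟩ = 0 :=
          congrFun hv ⟨j' + t, by omega⟩
        have e2 := hσ (v ⟨j' + t, rfl⟩ p)
        rw [← LinearMap.comp_apply (C.d j' j h), e, LinearMap.zero_apply, map_zero, zero_add] at e2
        exact ⟨_, e2⟩
      obtain ⟨u', rfl⟩ := exists_pi_eq (P := fun i => j'' + s = i)
        (F := fun i => T.X i →ₗ[Env k A] C.X j'') (j' + t) (by omega) (by omega) u
      refine ⟨u', funext fun ⟨i, hi⟩ => ?_⟩
      subst hi
      exact hu)
    (fun j hj v hv => by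
      -- Downward: Hom(T, C_j) is exact, because right linear splittings of T average to bimodule
      -- maps into C_j.
      obtain ⟨θ, hθ⟩ := hneg j
      obtain ⟨σ, τ, hσ, -, hστ⟩ := hT.pos (j + s) (j + t) (j + t') (by omega) (by omega)
      obtain ⟨u, hu⟩ := exists_comp_eq_of_isTraceIdentity hθ hσ hστ (v ⟨j + t, rfl⟩) (by
        have e := congrFun hv ⟨j + t', rfl⟩
        rw [homStepSource_apply _ _ t t' ht j v _ (j + t) rfl (by omega)] at e
        exact (smul_eq_zero_iff_eq _).1 (neg_eq_zero.1 e))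
      obtain ⟨u', hu'⟩ := exists_pi_eq (P := fun i => j + s = i)
        (F := fun i => T.X i →ₗ[Env k A] C.X j) (j + s) rfl (by omega) (-(s.negOnePow • u))
      refine ⟨u', funext fun ⟨i, hi⟩ => ?_⟩
      subst hi
      rw [homStepSource_apply _ _ s t hs j u' _ (j + s) rfl (by omega), hu', LinearMap.neg_comp,
        units_smul_comp, hu, smul_neg, neg_neg, smul_smul, Int.units_mul_self, one_smul])
    (fun j i => w.v i.1 j i.2)
    (fun j j' h => funext fun ⟨i, hi⟩ => by
      have e := congrArg (fun f => HomCochain.v f i j hi) hw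
      exact (sub_eq_add_neg _ _).symm.trans
        ((homD_v' t t' ht w i j (i - 1) j' hi (sub_add_cancel _ _) h).symm.trans e))
    u₀' u₁'
    (funext fun ⟨i, hi⟩ => by
      obtain rfl : t = i := by omega
      rw [Pi.add_apply, homStepSource_apply _ _ s t hs 0 u₀' t s hi hs, hu₀']
      change C.d 1 0 (zero_add 1) ∘ₗ u₁' ⟨t, _⟩ + _ = _
      rw [hu₁', hu₁, add_neg_cancel_right])
  let c' : HomCochain T.toBimodComplex C s := fun p => c p.1.2 ⟨p.1.1, p.2⟩
  refine ⟨c', HomCochain.ext fun i j hij => ?_⟩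
  rw [homD_v' s t hs c' i j (i - 1) (j + 1) hij (sub_add_cancel _ _) rfl, sub_eq_add_neg]
  exact congrFun (hc j (j + 1) rfl) ⟨i, hij⟩

/-- A cycle of the complete tensor product of a complete resolution and an augmented complex is a
boundary if its augmentation is. -/
theorem exists_completeEnvTensorD_eq
    (hC : HasContraction (rightHom k A) C η)
    (hT : HasContraction (leftHom k A) T.toBimodComplex T.aug)
    (hneg : ∀ j, ∃ θ : C.X j →ₗ[k] C.X j, IsTraceIdentity (leftHom k A) (rightHom k A) D θ)
    (s t t' : ℤ) (hs : t + 1 = s) (ht : t' + 1 = t)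
    (w : CompleteEnvTensorX T.toBimodComplex C t)
    (hw : completeEnvTensorD T.toBimodComplex C t t' ht w = 0)
    (y : ETensor k A (T.X s) N)
    (hy : ETensor.map LinearMap.id η (w ⟨(t, 0), add_zero t⟩) = tensorD T.toBimodComplex N s t hs y) :
    ∃ c, completeEnvTensorD T.toBimodComplex C s t hs c = w := by
  obtain ⟨σ, τ, hσ, hτ, h1, h2⟩ := hC.aug
  -- With u₀ lifting y, the chain w_0 - (d ⊗ 1)u₀ is killed by 1 ⊗ η. The right linear splitting of
  -- C and the right trace on T_t then write it as (1 ⊗ d)u₁.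
  obtain ⟨u₀, hu₀⟩ := ETensor.map_id_surjective (X := T.X s) (fun n => ⟨σ n, h1 n⟩) y
  obtain ⟨θ, hθ⟩ := T.exists_right_trace D t
  obtain ⟨u₁, hu₁⟩ := ETensor.exists_map_right_eq hθ hσ hτ h2
    (w ⟨(t, 0), add_zero t⟩ - ETensor.map (T.d s t hs) LinearMap.id u₀) (by
      rw [map_sub, hy, ETensor.map_map, ← hu₀, tensorD, ETensor.map_map, LinearMap.comp_id,
        LinearMap.comp_id, LinearMap.id_comp, LinearMap.id_comp, sub_self])
  obtain ⟨u₀', hu₀'⟩ := exists_pi_eq (P := fun i => i + 0 = s)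
    (F := fun i => ETensor k A (T.X i) (C.X 0)) s (add_zero s) (by omega) u₀
  obtain ⟨u₁', hu₁'⟩ := exists_pi_eq (P := fun i => i + 1 = s)
    -- The factor (-1)^t cancels the sign of 1 ⊗ d on T_t ⊗ C_1.
    (F := fun i => ETensor k A (T.X i) (C.X 1)) t hs (by omega) (t.negOnePow • u₁)
  obtain ⟨c, hc⟩ := exists_total_primitive
    (U := fun j => ∀ i : {i : ℤ // i + j = s}, ETensor k A (T.X i.1) (C.X j))
    (V := fun j => ∀ i : {i : ℤ // i + j = t}, ETensor k A (T.X i.1) (C.X j))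
    (W := fun j => ∀ i : {i : ℤ // i + j = t'}, ETensor k A (T.X i.1) (C.X j))
    (tensorStepRight T.toBimodComplex C s t hs) (tensorStepLeft T.toBimodComplex C s t hs)
    (tensorStepRight T.toBimodComplex C t t' ht) (tensorStepLeft T.toBimodComplex C t t' ht)
    (fun j j' j'' h h' u => funext fun ⟨i, hi⟩ => by
      change i.negOnePow • ETensor.map LinearMap.id (C.d j' j h)
        (i.negOnePow • ETensor.map LinearMap.id (C.d j'' j' h') (u ⟨i, _⟩)) = 0
      rw [map_units_smul, ETensor.map_map, C.d_comp_d, ETensor.map_zero_right,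
        LinearMap.zero_apply, smul_zero, smul_zero])
    (fun j u => funext fun ⟨i, hi⟩ => by
      change ETensor.map (T.d (i + 1) i _) LinearMap.id
        (ETensor.map (T.d (i + 1 + 1) (i + 1) _) LinearMap.id (u ⟨i + 1 + 1, _⟩)) = 0
      rw [ETensor.map_map, T.d_comp_d, ETensor.map_zero_left, LinearMap.zero_apply])
    (fun j j' h u => funext fun ⟨i, hi⟩ => by
      change i.negOnePow • ETensor.map LinearMap.id (C.d j' j h)
          (ETensor.map (T.d (i + 1) i _) LinearMap.id (u ⟨i + 1, _⟩)) +
        ETensor.map (T.d (i + 1) i _) LinearMap.id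
          ((i + 1).negOnePow • ETensor.map LinearMap.id (C.d j' j h) (u ⟨i + 1, _⟩)) = 0
      rw [map_units_smul, ETensor.map_map, ETensor.map_map, LinearMap.comp_id, LinearMap.comp_id,
        LinearMap.id_comp, LinearMap.id_comp, Int.negOnePow_succ, Units.neg_smul, add_neg_cancel])
    (fun j j' j'' h h' hj v hv => by
      obtain ⟨σ, τ, hσ, hτ, hστ⟩ := hC.pos j j' j'' h h'
      obtain ⟨θ, hθ⟩ := T.exists_right_trace D (t - j')
      obtain ⟨u, hu⟩ := ETensor.exists_map_right_eq hθ hσ hτ hστ (v ⟨t - j', sub_add_cancel _ _⟩)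
        ((smul_eq_zero_iff_eq _).1 (congrFun hv ⟨t - j', by omega⟩))
      obtain ⟨u', hu'⟩ := exists_pi_eq (P := fun i => i + j'' = s)
        (F := fun i => ETensor k A (T.X i) (C.X j'')) (t - j') (by omega) (by omega)
        ((t - j').negOnePow • u)
      refine ⟨u', funext fun ⟨i, hi⟩ => ?_⟩
      obtain rfl : t - j' = i := by omega
      change (t - j').negOnePow • ETensor.map LinearMap.id (C.d j'' j' h') (u' ⟨t - j', _⟩) = _
      rw [hu', map_units_smul, hu, smul_smul, Int.units_mul_self, one_smul])
    (fun j hj v hv => by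
      -- Downward, the roles switch: T is split left linearly and the trace identity is that of C_j.
      obtain ⟨θ, hθ⟩ := hneg j
      obtain ⟨σ, τ, hσ, hτ, hστ⟩ := hT.pos (t - j - 1) (t - j) (t - j + 1) (by omega) (by omega)
      obtain ⟨u, hu⟩ := ETensor.exists_map_left_eq hθ hσ hτ hστ (v ⟨t - j, sub_add_cancel _ _⟩)
        (by
          have e := congrFun hv ⟨t - j - 1, by omega⟩
          rwa [tensorStepLeft_apply _ _ t t' ht j v _ (t - j) _ (by omega)] at e)
      obtain ⟨u', hu'⟩ := exists_pi_eq (P := fun i => i + j = s)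
        (F := fun i => ETensor k A (T.X i) (C.X j)) (t - j + 1) (by omega) (by omega) u
      refine ⟨u', funext fun ⟨i, hi⟩ => ?_⟩
      obtain rfl : t - j = i := by omega
      rw [tensorStepLeft_apply _ _ s t hs j u' _ (t - j + 1) _ rfl, hu', hu])
    (fun j i => w ⟨(i.1, j), i.2⟩)
    (fun j j' h => funext fun ⟨i, hi⟩ => by
      have e := congrFun hw ⟨(i, j), hi⟩
      rw [completeEnvTensorD_apply T.toBimodComplex C t t' ht w i (i + 1) j j' rfl h hi,
        add_comm] at e
      exact e)
    u₀' u₁'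
    (funext fun ⟨i, hi⟩ => by
      obtain rfl : t = i := by omega
      rw [Pi.add_apply, tensorStepLeft_apply _ _ s t hs 0 u₀' t s hi hs, hu₀']
      change t.negOnePow • ETensor.map LinearMap.id (C.d 1 0 (zero_add 1)) (u₁' ⟨t, _⟩) + _ = _
      rw [hu₁', map_units_smul, hu₁, smul_smul, Int.units_mul_self, one_smul, sub_add_cancel])
  refine ⟨fun p => c p.1.2 ⟨p.1.1, p.2⟩, funext fun ⟨(i, j), hij⟩ => ?_⟩
  rw [completeEnvTensorD_apply T.toBimodComplex C s t hs _ i (i + 1) j (j + 1) rfl rfl hij,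
    add_comm]
  exact congrFun (hc j (j + 1) rfl) ⟨i, hij⟩

end Primitives

/-! ### Unit and associativity maps. -/

section UnitMaps

variable {k A : Type*} [Field k] [Ring A] [Algebra k A]
variable {X M M' N : Type*}
  [AddCommGroup X] [Module k X] [Module (Env k A) X] [IsScalarTower k (Env k A) X]
  [AddCommGroup M] [Module k M] [Module (Env k A) M] [IsScalarTower k (Env k A) M]
  [AddCommGroup M'] [Module k M'] [Module (Env k A) M'] [IsScalarTower k (Env k A) M']
  [AddCommGroup N] [Module k N] [Module (Env k A) N] [IsScalarTower k (Env k A) N]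

/-- The canonical map `M ⊗_A A → M`, `m ⊗ a ↦ m a`. -/
def BTensor.rid : BTensor k A M A →ₗ[Env k A] M :=
  BTensor.bimoduleLift
    (LinearMap.mk₂ k (fun (m : M) (a : A) => env k 1 a • m)
      (fun m m' a => smul_add _ _ _)
      (fun c m a => smul_comm _ _ _)
      (fun m a b => by rw [env_add_right, add_smul])
      (fun c m a => by rw [env_smul_right, smul_assoc]))
    (fun m a b => by simp [env_smul_self, smul_smul, env_mul])
    (fun a b m n => by simp [env_smul_self, smul_smul, env_mul])

@[simp] theorem BTensor.rid_mk (m : M) (a : A) :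
    BTensor.rid (BTensor.mk k A m a) = env k 1 a • m := by
  simp [BTensor.rid]

theorem BTensor.lid_natural (f : M →ₗ[Env k A] M') :
    BTensor.lid ∘ₗ BTensor.map LinearMap.id f = f ∘ₗ BTensor.lid :=
  BTensor.bimodule_hom_ext fun a m => by simp

theorem BTensor.rid_natural (f : M →ₗ[Env k A] M') :
    BTensor.rid ∘ₗ BTensor.map f LinearMap.id = f ∘ₗ BTensor.rid :=
  BTensor.bimodule_hom_ext fun m a => by simp

theorem BTensor.lid_eq_rid : (BTensor.lid : BTensor k A A A →ₗ[Env k A] A) = BTensor.rid :=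
  BTensor.bimodule_hom_ext fun a b => by simp [env_smul_self]

theorem assoc_natural_middle (g : M →ₗ[Env k A] M') (y : ETensor k A (BTensor k A X M) N) :
    ETensor.map LinearMap.id (BTensor.map g LinearMap.id) (assoc k A X M N y) =
      assoc k A X M' N (ETensor.map (BTensor.map LinearMap.id g) LinearMap.id y) := by
  refine LinearMap.congr_fun (ETensor.hom_ext
    (f := ETensor.map LinearMap.id (BTensor.map g LinearMap.id) ∘ₗ assoc k A X M N)
    (g := assoc k A X M' N ∘ₗ ETensor.map (BTensor.map LinearMap.id g) LinearMap.id)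
    (fun b n => ?_)) y
  refine LinearMap.congr_fun (BTensor.hom_ext
    (f := ETensor.map LinearMap.id (BTensor.map g LinearMap.id) ∘ₗ assoc k A X M N ∘ₗ
      ETensor.mkₗ.flip n)
    (g := assoc k A X M' N ∘ₗ ETensor.map (BTensor.map LinearMap.id g) LinearMap.id ∘ₗ
      ETensor.mkₗ.flip n) (fun x m => ?_)) b
  simp

/-- This is x ⊗ an = xa ⊗ n. It turns the augmentation of the second factor of T ⊗ (T ⊗_A N) into (1
⊗ ε)Δ on T. -/
theorem map_lid_assoc (y : ETensor k A (BTensor k A X A) N) :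
    ETensor.map LinearMap.id BTensor.lid (assoc k A X A N y) =
      ETensor.map BTensor.rid LinearMap.id y := by
  refine LinearMap.congr_fun (ETensor.hom_ext
    (f := ETensor.map LinearMap.id BTensor.lid ∘ₗ assoc k A X A N)
    (g := ETensor.map BTensor.rid LinearMap.id) (fun b n => ?_)) y
  refine LinearMap.congr_fun (BTensor.hom_ext
    (f := ETensor.map LinearMap.id BTensor.lid ∘ₗ assoc k A X A N ∘ₗ ETensor.mkₗ.flip n)
    (g := ETensor.map BTensor.rid LinearMap.id ∘ₗ ETensor.mkₗ.flip n) (fun x a => ?_)) b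
  simp [← ETensor.mk_balanced]

end UnitMaps

/-! ### Chain endomorphisms of T over A. -/

section Unit

variable {k A : Type*} [Field k] [Ring A] [Algebra k A] {T : CompleteResolution.{w} k A}

/-- The identity of a complex as a cochain of degree `0`. -/
def HomCochain.one (C : BimodComplex.{w} k A) : HomCochain C C 0 := fun p =>
  (show p.1.1 = p.1.2 by have := p.2; omega) ▸ LinearMap.id

theorem HomCochain.one_v (C : BimodComplex.{w} k A) (i : ℤ) (h : i + 0 = i) :
    (HomCochain.one C).v i i h = LinearMap.id := rfl

theorem homD_one (C : BimodComplex.{w} k A) : homD C C 0 1 (zero_add 1) (HomCochain.one C) = 0 :=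
  HomCochain.ext fun i j hij => by
    rw [homD_v' 0 1 (zero_add 1) _ i j j i hij hij hij, HomCochain.one_v, HomCochain.one_v,
      Int.negOnePow_zero, one_smul, LinearMap.comp_id, LinearMap.id_comp, sub_self]
    rfl

/-- A chain endomorphism of a complete resolution compatible with the augmentation is homotopic
to the identity. -/
theorem exists_homotopy_one (D : DualBases k A) (f : HomCochain T.toBimodComplex T.toBimodComplex 0)
    (hf : homD T.toBimodComplex T.toBimodComplex 0 1 (zero_add 1) f = 0)
    (haug : T.aug ∘ₗ f.v 0 0 (add_zero 0) = T.aug) :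
    ∃ c : ∀ i j : ℤ, i + 1 = j → (T.X i →ₗ[Env k A] T.X j), ∀ (l i j : ℤ) (hl : l + 1 = i)
      (hj : i + 1 = j), f.v i i (add_zero i) = LinearMap.id +
        (T.d j i hj ∘ₗ c i j hj + c l i hl ∘ₗ T.d i l hl) := by
  -- The cocycle f - 1 has zero augmentation, so y = 0 serves. Its primitive has degree -1, and
  -- (-1)^(-1) = -1 turns d c - (-1)^s c d into d c + c d.
  obtain ⟨c, hc⟩ := exists_homD_eq (T.hasContraction_right D) (T.hasContraction_right D)
    (T.exists_left_trace D) (-1) 0 1 (neg_add_cancel 1) (zero_add 1)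
    (f - HomCochain.one T.toBimodComplex) (by rw [map_sub, hf, homD_one, sub_zero]) 0 (by
      rw [map_zero]
      change T.aug ∘ₗ (f.v 0 0 (add_zero 0) - LinearMap.id) = 0
      rw [LinearMap.comp_sub, haug, LinearMap.comp_id, sub_self])
  refine ⟨fun i j h => c.v i j (by omega), fun l i j hl hj => ?_⟩
  have e := congrArg (fun g => HomCochain.v g i i (add_zero i)) hc
  have e' := (homD_v' (-1) 0 (neg_add_cancel 1) c i i l j (add_zero i) hl hj).symm.trans e
  have e'' : (f - HomCochain.one T.toBimodComplex).v i i (add_zero i) =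
    f.v i i (add_zero i) - LinearMap.id := rfl
  have s : (-1 : ℤ).negOnePow = -1 := by rw [Int.negOnePow_neg, Int.negOnePow_one]
  rw [s, Units.neg_smul, one_smul, sub_neg_eq_add] at e'
  rw [e']
  exact ((congrArg (LinearMap.id + ·) e'').trans (add_sub_cancel _ _)).symm

variable (Δ : DiagonalApproximation T)

/-- The chain map `(ε ⊗̂_A 1) Δ : T → A ⊗_A T = T`. -/
def DiagonalApproximation.leftUnit : HomCochain T.toBimodComplex T.toBimodComplex 0 := fun p =>
  BTensor.lid ∘ₗ BTensor.map T.aug LinearMap.id ∘ₗ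
    Δ.component 0 p.1.2 p.1.1 (by have := p.2; omega)

/-- The chain map `(1 ⊗̂_A ε) Δ : T → T ⊗_A A = T`. -/
def DiagonalApproximation.rightUnit : HomCochain T.toBimodComplex T.toBimodComplex 0 := fun p =>
  BTensor.rid ∘ₗ BTensor.map LinearMap.id T.aug ∘ₗ Δ.component p.1.2 0 p.1.1 p.2

theorem DiagonalApproximation.leftUnit_v (i j : ℤ) (h : j + 0 = i) :
    Δ.leftUnit.v i j h = BTensor.lid ∘ₗ BTensor.map T.aug LinearMap.id ∘ₗ
      Δ.component 0 j i (by omega) := rfl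

theorem DiagonalApproximation.rightUnit_v (i j : ℤ) (h : j + 0 = i) :
    Δ.rightUnit.v i j h = BTensor.rid ∘ₗ BTensor.map LinearMap.id T.aug ∘ₗ
      Δ.component j 0 i h := rfl

/-- In the (0, j) component of dΔ = Δd, the term with d ⊗ 1 dies because ε d = 0, and 1 ⊗ d carries
the sign (-1)^0. -/
theorem DiagonalApproximation.homD_leftUnit :
    homD T.toBimodComplex T.toBimodComplex 0 1 (zero_add 1) Δ.leftUnit = 0 :=
  HomCochain.ext fun i j hij => by
    have e1 := BTensor.map_comp_map (T.d 1 0 (zero_add 1)) (LinearMap.id (M := T.X j)) T.aug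
      LinearMap.id
    have e2 := BTensor.map_comp_map LinearMap.id (T.d i j hij) T.aug LinearMap.id
    have e3 := BTensor.map_comp_map T.aug LinearMap.id LinearMap.id (T.d i j hij)
    rw [T.aug_exact.linearMap_comp_eq_zero, BTensor.map_zero_left] at e1
    rw [LinearMap.comp_id, LinearMap.id_comp] at e2 e3
    rw [homD_v' 0 1 (zero_add 1) _ i j j i hij hij hij, Int.negOnePow_zero, one_smul, leftUnit_v,
      leftUnit_v, LinearMap.comp_assoc, LinearMap.comp_assoc,
      Δ.component_comp_d 0 1 j i j i (zero_add 1) hij hij (zero_add j), LinearMap.comp_add,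
      ← LinearMap.comp_assoc _ _ (BTensor.map T.aug LinearMap.id), e1, LinearMap.zero_comp,
      zero_add (BTensor.map T.aug LinearMap.id ∘ₗ _), Int.negOnePow_zero, one_smul,
      ← LinearMap.comp_assoc _ _ (BTensor.map T.aug LinearMap.id), e2,
      ← LinearMap.comp_assoc, ← BTensor.lid_natural, LinearMap.comp_assoc,
      ← LinearMap.comp_assoc _ (BTensor.map T.aug LinearMap.id), e3, sub_self]
    rfl

/-- Here the term carrying the sign (-1)^j is the one killed by ε d = 0. -/
theorem DiagonalApproximation.homD_rightUnit :
    homD T.toBimodComplex T.toBimodComplex 0 1 (zero_add 1) Δ.rightUnit = 0 :=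
  HomCochain.ext fun i j hij => by
    have e1 := BTensor.map_comp_map (LinearMap.id (M := T.X j)) (T.d 1 0 (zero_add 1))
      LinearMap.id T.aug
    have e2 := BTensor.map_comp_map (T.d i j hij) LinearMap.id LinearMap.id T.aug
    have e3 := BTensor.map_comp_map LinearMap.id T.aug (T.d i j hij) LinearMap.id
    rw [T.aug_exact.linearMap_comp_eq_zero, BTensor.map_zero_right] at e1
    rw [LinearMap.comp_id, LinearMap.id_comp] at e2 e3
    rw [homD_v' 0 1 (zero_add 1) _ i j j i hij hij hij, Int.negOnePow_zero, one_smul, rightUnit_v,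
      rightUnit_v, LinearMap.comp_assoc, LinearMap.comp_assoc,
      Δ.component_comp_d j i 0 1 j i hij (zero_add 1) hij (add_zero j), LinearMap.comp_add,
      comp_units_smul, ← LinearMap.comp_assoc _ _ (BTensor.map LinearMap.id T.aug),
      ← LinearMap.comp_assoc _ _ (BTensor.map LinearMap.id T.aug), e1, LinearMap.zero_comp,
      smul_zero, add_zero (_ ∘ₗ Δ.component i 0 i _), e2, ← LinearMap.comp_assoc, ← BTensor.rid_natural, LinearMap.comp_assoc,
      ← LinearMap.comp_assoc _ (BTensor.map LinearMap.id T.aug), e3, sub_self]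
    rfl

theorem DiagonalApproximation.aug_leftUnit :
    T.aug ∘ₗ Δ.leftUnit.v 0 0 (add_zero 0) = T.aug := LinearMap.ext fun x => by
  rw [leftUnit_v, ← LinearMap.comp_assoc, ← BTensor.lid_natural, LinearMap.comp_assoc,
    ← LinearMap.comp_assoc _ (BTensor.map T.aug LinearMap.id), BTensor.map_comp_map,
    LinearMap.id_comp, LinearMap.comp_id]
  exact Δ.aug x

theorem DiagonalApproximation.aug_rightUnit :
    T.aug ∘ₗ Δ.rightUnit.v 0 0 (add_zero 0) = T.aug := LinearMap.ext fun x => by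
  rw [rightUnit_v, ← LinearMap.comp_assoc, ← BTensor.rid_natural, LinearMap.comp_assoc,
    ← LinearMap.comp_assoc _ (BTensor.map LinearMap.id T.aug), BTensor.map_comp_map,
    LinearMap.id_comp, LinearMap.comp_id, ← BTensor.lid_eq_rid]
  exact Δ.aug x

end Unit

/-! ### Representatives of homology classes. -/

section HomologyClasses

variable {k X Y Z : Type*} [Field k] [AddCommGroup X] [Module k X] [AddCommGroup Y] [Module k Y]
  [AddCommGroup Z] [Module k Z] {f : X →ₗ[k] Y} {g : Y →ₗ[k] Z}

theorem Homology.exists_mk (c : Homology f g) : ∃ y hy, Homology.mk f g y hy = c := by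
  obtain ⟨⟨y, hy⟩, rfl⟩ := Submodule.mkQ_surjective _ c
  exact ⟨y, hy, rfl⟩

theorem Homology.mk_eq_zero {y : Y} {hy : g y = 0} :
    Homology.mk f g y hy = 0 ↔ ∃ x, f x = y :=
  Submodule.Quotient.mk_eq_zero _

theorem Homology.mk_eq_mk {y y' : Y} {hy : g y = 0} {hy' : g y' = 0} :
    Homology.mk f g y hy = Homology.mk f g y' hy' ↔ ∃ x, f x = y - y' :=
  Submodule.Quotient.eq _

end HomologyClasses

/-! ### Injectivity of α and β, and inverses from the diagonal. -/

section Comparison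

variable {k A : Type*} [Field k] [Ring A] [Algebra k A] {T : CompleteResolution.{w} k A}
variable {M N : Type*}
  [AddCommGroup M] [Module k M] [Module (Env k A) M] [IsScalarTower k (Env k A) M]
  [AddCommGroup N] [Module k N] [Module (Env k A) N] [IsScalarTower k (Env k A) N]

theorem augHom_injective (D : DualBases k A) (s : ℤ) : Function.Injective (augHom T N s) := by
  rw [injective_iff_map_eq_zero]
  intro c hc
  obtain ⟨w, hw, rfl⟩ := Homology.exists_mk c
  obtain ⟨y, hy⟩ := Homology.mk_eq_zero.1 hc
  exact Homology.mk_eq_zero.2 (exists_homD_eq (T.hasContraction_right D).tensorRight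
    (T.hasContraction_right D) (fun j => (T.exists_left_trace D j).elim fun _ h => ⟨_, h.rmap⟩)
    (s - 1) s (s + 1) (sub_add_cancel s 1) rfl w hw y hy.symm)

theorem augTensor_injective (D : DualBases k A) (s : ℤ) :
    Function.Injective (augTensor T N s) := by
  rw [injective_iff_map_eq_zero]
  intro c hc
  obtain ⟨w, hw, rfl⟩ := Homology.exists_mk c
  obtain ⟨y, hy⟩ := Homology.mk_eq_zero.1 hc
  exact Homology.mk_eq_zero.2 (exists_completeEnvTensorD_eq (T.hasContraction_right D).tensorRight
    (T.hasContraction_left D) (fun j => (T.exists_left_trace D j).elim fun _ h => ⟨_, h.rmap⟩)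
    (s + 1) s (s - 1) rfl (sub_add_cancel s 1) w hw y hy.symm)

variable (Δ : DiagonalApproximation T)

/-- The cochain `(1 ⊗̂_A v) Δ : T → T ⊗_A N`. -/
def homLift (s : ℤ) (v : T.X s →ₗ[Env k A] N) :
    HomCochain T.toBimodComplex (T.tensorRight N) s := fun p =>
  -- Koszul sign for moving v past an element of T_j, with j the target degree.
  (p.1.2 * s).negOnePow • (BTensor.map LinearMap.id v ∘ₗ Δ.component p.1.2 s p.1.1 p.2)

theorem homLift_v (s : ℤ) (v : T.X s →ₗ[Env k A] N) (i j : ℤ) (h : j + s = i) :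
    (homLift Δ s v).v i j h =
      (j * s).negOnePow • (BTensor.map LinearMap.id v ∘ₗ Δ.component j s i h) := rfl

theorem comp_d_eq_zero {s t : ℤ} (h : s + 1 = t) {v : T.X s →ₗ[Env k A] N}
    (hv : coD T.toBimodComplex N s t h v = 0) : v ∘ₗ T.d t s h = 0 :=
  (smul_eq_zero_iff_eq _).1 (neg_eq_zero.1 hv)

/-- As Δ is a chain map, only d ⊗ v and 1 ⊗ vd can occur. The second vanishes on a cocycle, and the
first cancels since (j + 1)s = s + js. -/
theorem homD_homLift (s : ℤ) (v : T.X s →ₗ[Env k A] N)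
    (hv : coD T.toBimodComplex N s (s + 1) rfl v = 0) :
    homD T.toBimodComplex (T.tensorRight N) s (s + 1) rfl (homLift Δ s v) = 0 :=
  HomCochain.ext fun i j hij => by
    have e1 := BTensor.map_comp_map (T.d (j + 1) j rfl) LinearMap.id LinearMap.id v
    have e2 := BTensor.map_comp_map (LinearMap.id (M := T.X j)) (T.d (s + 1) s rfl)
      LinearMap.id v
    have e3 := BTensor.map_comp_map LinearMap.id v (T.d (j + 1) j rfl) LinearMap.id
    rw [comp_d_eq_zero rfl hv, BTensor.map_zero_right] at e2
    rw [LinearMap.comp_id, LinearMap.id_comp] at e1 e3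
    have c1 : ((j + 1) * s).negOnePow = s.negOnePow * (j * s).negOnePow := by
      rw [← Int.negOnePow_add]; congr 1; ring
    refine (homD_v' s (s + 1) rfl (homLift Δ s v) i j (i - 1) (j + 1) hij (sub_add_cancel _ _)
      rfl).trans ?_
    rw [homLift_v, homLift_v, units_smul_comp, LinearMap.comp_assoc,
      Δ.component_comp_d j (j + 1) s (s + 1) (i - 1) i rfl rfl (sub_add_cancel _ _),
      LinearMap.comp_add, comp_units_smul, comp_units_smul,
      ← LinearMap.comp_assoc _ _ (BTensor.map LinearMap.id v),
      ← LinearMap.comp_assoc _ _ (BTensor.map LinearMap.id v), e1, e2, LinearMap.zero_comp,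
      smul_zero, add_zero, ← LinearMap.comp_assoc, e3, c1, mul_smul, sub_self]
    rfl

theorem compC_homLift (r s t : ℤ) (h : r + s = t) (u : T.X r →ₗ[Env k A] M)
    (v : T.X s →ₗ[Env k A] N) : compC T M N r s t h u (homLift Δ s v) = cupC M N Δ r s t h u v := by
  rw [compC_apply, cupC_apply, homLift_v, comp_units_smul, ← LinearMap.comp_assoc,
    BTensor.map_comp_map, LinearMap.comp_id, LinearMap.id_comp]

theorem augHomC_homLift (s : ℤ) (v : T.X s →ₗ[Env k A] N) :
    augHomC T N s (homLift Δ s v) = v ∘ₗ Δ.leftUnit.v s s (add_zero s) := by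
  rw [augHomC_apply, homLift_v, zero_mul, Int.negOnePow_zero, one_smul, Δ.leftUnit_v, augRight,
    LinearMap.comp_assoc, ← LinearMap.comp_assoc _ _ (BTensor.map T.aug LinearMap.id),
    BTensor.map_comp_map, ← LinearMap.comp_assoc, ← LinearMap.comp_assoc, ← BTensor.lid_natural,
    LinearMap.comp_assoc, LinearMap.comp_assoc,
    ← LinearMap.comp_assoc _ (BTensor.map T.aug LinearMap.id), BTensor.map_comp_map]
  simp only [LinearMap.comp_id, LinearMap.id_comp]

/-- If (ε ⊗ 1)Δ = 1 + dc + cd, then v(ε ⊗ 1)Δ - v = vdc + vcd. The first term is zero for a cocycle.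
-/
theorem augHom_homLift (D : DualBases k A) (s : ℤ) (v : T.X s →ₗ[Env k A] N)
    (hv : coD T.toBimodComplex N s (s + 1) rfl v = 0) :
    augHom T N s (Homology.mk _ _ (homLift Δ s v) (homD_homLift Δ s v hv)) =
      Homology.mk _ _ v hv := by
  obtain ⟨c, hc⟩ := exists_homotopy_one D Δ.leftUnit Δ.homD_leftUnit Δ.aug_leftUnit
  -- The sign offsets the one in `coD`, so that the coboundary is exactly v c d.
  refine Homology.mk_eq_mk.2 ⟨-((s - 1).negOnePow • (v ∘ₗ c (s - 1) s (sub_add_cancel s 1))), ?_⟩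
  change coD T.toBimodComplex N (s - 1) s (sub_add_cancel s 1) _ =
    augHomC T N s (homLift Δ s v) - v
  rw [augHomC_homLift, hc (s - 1) s (s + 1) (sub_add_cancel s 1) rfl, coD_apply,
    LinearMap.comp_add, LinearMap.comp_add, LinearMap.comp_id, ← LinearMap.comp_assoc,
    comp_d_eq_zero rfl hv, LinearMap.zero_comp, zero_add, add_sub_cancel_left, LinearMap.neg_comp,
    units_smul_comp, smul_neg, neg_neg, smul_smul, Int.units_mul_self, one_smul,
    LinearMap.comp_assoc]

/-- The chain in `T ⊗̂_{Aᵉ} (T ⊗_A N)` obtained from a chain in `T ⊗_{Aᵉ} N` by applying `Δ`. -/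
def tensorLift (s : ℤ) (z : ETensor k A (T.X s) N) :
    CompleteEnvTensorX T.toBimodComplex (T.tensorRight N) s := fun p =>
  assoc k A (T.X p.1.1) (T.X p.1.2) N
    (ETensor.map (Δ.component p.1.1 p.1.2 s p.2) LinearMap.id z)

theorem tensorLift_apply (s : ℤ) (z : ETensor k A (T.X s) N) (p q : ℤ) (h : p + q = s) :
    tensorLift Δ s z ⟨(p, q), h⟩ = assoc k A (T.X p) (T.X q) N
      (ETensor.map (Δ.component p q s h) LinearMap.id z) := rfl

/-- The (p, q) component of the differential is Δ_{p,q} applied to dz. No signs appear in the lift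
because Δ has degree 0. -/
theorem completeEnvTensorD_tensorLift (s t : ℤ) (h : t + 1 = s) (z : ETensor k A (T.X s) N)
    (hz : tensorD T.toBimodComplex N s t h z = 0) :
    completeEnvTensorD T.toBimodComplex (T.tensorRight N) s t h (tensorLift Δ s z) = 0 :=
  funext fun ⟨(p, q), hpq⟩ => by
    refine (completeEnvTensorD_apply T.toBimodComplex (T.tensorRight N) s t h _ p (p + 1) q (q + 1)
      rfl rfl hpq).trans ?_
    have e := Δ.component_comp_d p (p + 1) q (q + 1) t s rfl rfl h hpq
    have e1 := ETensor.map_map (T.d s t h) (LinearMap.id (M := N)) (Δ.component p q t hpq)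
      LinearMap.id z
    rw [tensorD] at hz
    rw [hz, map_zero, e, ETensor.map_add_left, ETensor.map_units_left, LinearMap.id_comp] at e1
    rw [tensorLift_apply, tensorLift_apply, assoc_natural, assoc_natural_middle, ETensor.map_map,
      ETensor.map_map, LinearMap.id_comp, ← map_units_smul, ← map_add]
    exact (congrArg _ e1.symm).trans (map_zero _)

theorem capCompC_tensorLift (r s t : ℤ) (h : t + r = s) (u : T.X r →ₗ[Env k A] M)
    (z : ETensor k A (T.X s) N) :
    capCompC T M N r s t h u (tensorLift Δ s z) = capC M N Δ r s t h u z := by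
  rw [capCompC_apply, capC_apply, tensorLift_apply, assoc_natural_middle, ETensor.map_map,
    LinearMap.id_comp]

theorem augTensorC_tensorLift (s : ℤ) (z : ETensor k A (T.X s) N) :
    augTensorC T N s (tensorLift Δ s z) =
      ETensor.map (Δ.rightUnit.v s s (add_zero s)) LinearMap.id z := by
  have e := ETensor.map_map LinearMap.id (BTensor.map T.aug LinearMap.id) LinearMap.id BTensor.lid
    (tensorLift Δ s z ⟨(s, 0), add_zero s⟩)
  rw [augTensorC_apply, augRight, Δ.rightUnit_v]
  rw [LinearMap.comp_id] at e
  rw [← e, tensorLift_apply, assoc_natural_middle, map_lid_assoc, ETensor.map_map,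
    ETensor.map_map, LinearMap.comp_id, LinearMap.comp_id, LinearMap.comp_assoc]

theorem augTensor_tensorLift (D : DualBases k A) (s : ℤ) (z : ETensor k A (T.X s) N)
    (hz : tensorD T.toBimodComplex N s (s - 1) (sub_add_cancel s 1) z = 0) :
    augTensor T N s (Homology.mk _ _ (tensorLift Δ s z)
      (completeEnvTensorD_tensorLift Δ s (s - 1) (sub_add_cancel s 1) z hz)) =
        Homology.mk _ _ z hz := by
  obtain ⟨c, hc⟩ := exists_homotopy_one D Δ.rightUnit Δ.homD_rightUnit Δ.aug_rightUnit
  -- On a cycle z, the homotopy for (1 ⊗ ε)Δ leaves only (dc ⊗ 1)z.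
  refine Homology.mk_eq_mk.2 ⟨ETensor.map (c s (s + 1) rfl) LinearMap.id z, ?_⟩
  have e1 := ETensor.map_map (T.d s (s - 1) (sub_add_cancel s 1)) (LinearMap.id (M := N))
    (c (s - 1) s (sub_add_cancel s 1)) LinearMap.id z
  have e2 : ETensor.map LinearMap.id LinearMap.id z = z :=
    LinearMap.congr_fun (ETensor.hom_ext (g := LinearMap.id) fun x n => ETensor.map_mk _ _ _ _) z
  rw [tensorD] at hz
  rw [hz, map_zero, LinearMap.id_comp] at e1
  change tensorD T.toBimodComplex N (s + 1) s rfl _ = augTensorC T N s (tensorLift Δ s z) - z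
  rw [augTensorC_tensorLift, hc (s - 1) s (s + 1) (sub_add_cancel s 1) rfl, ETensor.map_add_left,
    ETensor.map_add_left, LinearMap.add_apply, LinearMap.add_apply, e2, ← e1, add_zero,
    add_sub_cancel_left, tensorD, ETensor.map_map, LinearMap.id_comp]

end Comparison

end TateHochschild

/-- Cup and cap products of Tate-Hochschild (co)homology, defined by a diagonal approximation, are
the composition products transported along the isomorphisms induced by `ε ⊗_A 1`. -/
theorem theorem3p13 {k A : Type*} [Field k] [Ring A] [Algebra k A] [FiniteDimensional k A]
    (hA : TateHochschild.IsFrobenius k A) (T : TateHochschild.CompleteResolution k A)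
    (Δ : TateHochschild.DiagonalApproximation T) (M N : Type*)
    [AddCommGroup M] [Module k M] [Module (TateHochschild.Env k A) M]
    [IsScalarTower k (TateHochschild.Env k A) M]
    [AddCommGroup N] [Module k N] [Module (TateHochschild.Env k A) N]
    [IsScalarTower k (TateHochschild.Env k A) N] :
    (∀ s : ℤ, ∃ e :
        TateHochschild.HomComplexCohomology T.toBimodComplex (T.tensorRight N) s ≃ₗ[k]
          TateHochschild.TateCohomology T N s,
      (∀ w, e w = TateHochschild.augHom T N s w) ∧
      ∀ (r : ℤ) (u : TateHochschild.TateCohomology T M r)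
        (v : TateHochschild.TateCohomology T N s),
        TateHochschild.cup M N Δ r s (r + s) rfl u v =
          TateHochschild.compositionProduct T M N r s (r + s) rfl u (e.symm v)) ∧
    (∀ s : ℤ, ∃ e :
        TateHochschild.CompleteEnvTensorHomology T.toBimodComplex (T.tensorRight N) s ≃ₗ[k]
          TateHochschild.TateHomology T N s,
      (∀ w, e w = TateHochschild.augTensor T N s w) ∧
      ∀ (r : ℤ) (u : TateHochschild.TateCohomology T M r)
        (z : TateHochschild.TateHomology T N s),
        TateHochschild.cap M N Δ r s (s - r) (sub_add_cancel s r) u z =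
          TateHochschild.capCompositionProduct T M N r s (s - r) (sub_add_cancel s r) u
            (e.symm z)) := by
  obtain ⟨D⟩ := hA.exists_dualBases
  refine ⟨fun s => ?_, fun s => ?_⟩
  · refine ⟨LinearEquiv.ofBijective (TateHochschild.augHom T N s)
      ⟨TateHochschild.augHom_injective D s, fun v => ?_⟩, fun w => rfl, fun r u v => ?_⟩
    · obtain ⟨v, hv, rfl⟩ := TateHochschild.Homology.exists_mk v
      exact ⟨_, TateHochschild.augHom_homLift Δ D s v hv⟩
    · obtain ⟨u, hu, rfl⟩ := TateHochschild.Homology.exists_mk u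
      obtain ⟨v, hv, rfl⟩ := TateHochschild.Homology.exists_mk v
      -- The preimage of the class of v is the class of its lift, so the two products agree on
      -- representatives.
      rw [(LinearEquiv.symm_apply_eq _).2 (TateHochschild.augHom_homLift Δ D s v hv).symm]
      exact congrArg (Submodule.mkQ _) (Subtype.ext
        (TateHochschild.compC_homLift Δ r s (r + s) rfl u v).symm)
  · refine ⟨LinearEquiv.ofBijective (TateHochschild.augTensor T N s)
      ⟨TateHochschild.augTensor_injective D s, fun z => ?_⟩, fun w => rfl, fun r u z => ?_⟩
    · obtain ⟨z, hz, rfl⟩ := TateHochschild.Homology.exists_mk z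
      exact ⟨_, TateHochschild.augTensor_tensorLift Δ D s z hz⟩
    · obtain ⟨u, hu, rfl⟩ := TateHochschild.Homology.exists_mk u
      obtain ⟨z, hz, rfl⟩ := TateHochschild.Homology.exists_mk z
      rw [(LinearEquiv.symm_apply_eq _).2 (TateHochschild.augTensor_tensorLift Δ D s z hz).symm]
      exact congrArg (Submodule.mkQ _) (Subtype.ext
        (TateHochschild.capCompC_tensorLift Δ r s (s - r) (sub_add_cancel s r) u z).symm)
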